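/- **Theorem (refined triangle estimation upper bound).** *Setting.* Let $G$ be a finite simple graph with $m$ edges and $T$ triangles; $T_v$ and $T_e$ are the numbers of triangles through a vertex $v$ and an edge $e$. For $\eta>0$ list the vertices in descending order of $T_v$, let $H_V$ be the maximal prefix with $\sum_{v\in H_V}T_v\le\eta T$, and put $\Delta_{V,\eta}=\max_{v\notin H_V}T_v$; define $\Delta_{E,\eta}$ in the same way from the edges and the $T_e$ (an empty maximum is $0$). *The algorithm.* It is a nonadaptive edge sampling algorithm with inputs $\widetilde T\ge 1$ (a proposed lower bound on $T$), $\epsilon\in(0,1]$, $\delta\in(0,\tfrac12]$ and numbers $D_V,D_E$ with $\Delta_{V,\epsilon/24}\le D_V\le c\,\Delta_{V,\epsilon/24}$, $\Delta_{E,\epsilon/24}\le D_E\le c\,\Delta_{E,\epsilon/24}$ (the parameters are known up to a constant factor $c\geq 1$). Put $$\frac1k=\min\Big\{1,\max\Big\{\frac1{\widetilde T^{2/3}},\frac{\sqrt{D_V}}{\widetilde T},\frac{D_E}{\widetilde T}\Big\}\Big\},\qquad \omega=\min\Big\{\max\Big\{2,\frac{\widetilde T}{\max\{1,D_V\}}\Big\},\sqrt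 k\Big\},$$ $L=\lceil\log_2(\sqrt k/\omega)\rceil$ and $w_j=\min\{\omega2^j,\sqrt k\}$ for $0\le j\le L$. One *run* uses independent random hash functions: $c,d_1,d_2:V\to\{0,1\}$, each value being $1$ with probability $1/\sqrt k$; $h$ on $V$ with $h(v)=j$ with probability $1/w_j$ for $0\le j\le L$ and $h(v)=-\infty$ otherwise; and $r_C,r_{D,1},r_{D,2}$, uniform in $[0,1]$ on pairs of vertices. The run keeps the edge $uv$ if, for one of its two orientations and some $i\in\{1,2\}$, one of the following holds: $d_i(u)=d_i(v)=1$; $c(u)=d_i(v)=1$; $c(u)=c(v)=1$; $h(u)=j\ge0$, $r_{D,i}(uv)<w_j/\sqrt k$ and $d_i(v)=1$; $h(u)=j\ge0$, $r_C(uv)<w_j/\sqrt k$ and $c(v)=1$. From the graph $S$ of kept edges alone (and the hash values) it computes its output as follows. * First pass: $X_{v,i}^{(j)}$ is the number of triangles $uvw$ of $S$ with $d_i(u)=d_i(w)=1$ and $r_{D,i}(vu),r_{D,i}(vw)<w_j/\sqrt k$; $\mathcal T_v$ is the least $j\in\{0,\dots,L\}$ with $X_{v,i}^{(j)}\ge w_j\widetilde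 T/k^2$ for some $i\in\{1,2\}$, and $v$ is *light* if there is no such $j$. * Second pass: the output is $k^{3/2}$ times the number of triangles of $S$ all of whose vertices $x$ are light with $c(x)=1$, plus, for every non-light $v$ with $h(v)=\mathcal T_v=j$ and every triangle $uvw$ of $S$ with $c(u)=c(w)=1$ and $r_C(vu),r_C(vw)<w_j/\sqrt k$, the number $\frac{k^2}{w_j}$ divided by the number of non-light vertices among $u,v,w$. The algorithm makes $\lceil B\log\frac1\delta\rceil$ blocks of $\lceil A/\epsilon^2\rceil$ independent runs, takes the mean of the outputs in each block and the median $\overline T$ of these means. If $\overline T\ge\frac34\widetilde T$ it returns $\overline T$; otherwise it reports that $\widetilde T>T$. *Claim.* There are universal constants $A,B>0$ and, for each $c\ge1$, a constant $C$ such that for all $G,\widetilde T,\epsilon,\delta,D_V,D_E$ as above: 1. if $\widetilde T\le T$, then with probability at least $1-\delta$ the algorithm returns a number $\overline T$ with $|\overline T-T|\le\epsilon T$; 2. if $\widetilde T>T$, then with probability at least $1-\delta$ the algorithm either reports that $\widetilde T>T$ or returns a number $\overline T$ with $|\overline T-T|\le\epsilon T$; 3. the expected number of edges kept, summed over all runs,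 is at most $$C\,\frac{m\log\frac1\delta}{\epsilon^2}\left(\frac1{\widetilde T^{2/3}}+\frac{\sqrt{\Delta_{V,\epsilon/24}}\,\log\widetilde T}{\widetilde T}+\frac{\Delta_{E,\epsilon/24}\,\log\widetilde T}{\widetilde T}\right).$$ -/

import Mathlib

open MeasureTheory
open scoped ENNReal

namespace TriangleEstimation

/-! ### Triangle counts -/

section Counts

variable {V : Type*} [Fintype V]

/-- The set of triangles of `G`, as 3-element vertex sets. -/
noncomputable def triangles (G : SimpleGraph V) : Finset (Finset V) :=
  open scoped Classical in Finset.univ.filter fun t => G.IsNClique 3 t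

/-- `T(G)`, the number of triangles. -/
noncomputable def numTri (G : SimpleGraph V) : ℕ := (triangles G).card

/-- `T_v`, the number of triangles through the vertex `v`. -/
noncomputable def vertexTri (G : SimpleGraph V) (v : V) : ℕ :=
  open scoped Classical in ((triangles G).filter fun t => v ∈ t).card

/-- `T_e`, the number of triangles that contain both ends of `e`. -/
noncomputable def edgeTri (G : SimpleGraph V) (e : Sym2 V) : ℕ :=
  open scoped Classical in ((triangles G).filter fun t => ∀ x ∈ e, x ∈ t).card

/-- The edges of `G` as a finset. -/
noncomputable def edges (G : SimpleGraph V) : Finset (Sym2 V) :=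
  open scoped Classical in Set.toFinset G.edgeSet

/-- List the elements of `s` in descending order of `f`. -/
noncomputable def descending {α : Type*} (s : Finset α) (f : α → ℕ) : List α :=
  s.toList.mergeSort fun a c => decide (f c ≤ f a)

/-- The length of the maximal prefix of `descending s f` whose total `f`-value is at most `b`. -/
noncomputable def prefixLength {α : Type*} (s : Finset α) (f : α → ℕ) (b : ℝ) : ℕ :=
  open scoped Classical in
  Nat.findGreatest
    (fun j => ((((descending s f).take j).map f).sum : ℝ) ≤ b) (descending s f).length

/-- The largest value of `f` outside that maximal prefix (`0` if nothing is left). -/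
noncomputable def truncatedMax {α : Type*} (s : Finset α) (f : α → ℕ) (b : ℝ) : ℕ :=
  (((descending s f).drop (prefixLength s f b)).map f).foldr max 0

/-- `Δ_{V,ε}(G)`. -/
noncomputable def DeltaV (G : SimpleGraph V) (ε : ℝ) : ℕ :=
  truncatedMax Finset.univ (vertexTri G) (ε * numTri G)

/-- `Δ_{E,ε}(G)`. -/
noncomputable def DeltaE (G : SimpleGraph V) (ε : ℝ) : ℕ :=
  truncatedMax (edges G) (edgeTri G) (ε * numTri G)

end Counts

/-! ### Parameters of one run -/

/-- The numbers that one run of the algorithm is given: the guess `Tt` for a lower bound on `T`,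
the sampling parameter `k` and the number `TVp` from which the least weight is computed. -/
structure Params where
  Tt : ℝ
  k : ℝ
  TVp : ℝ

namespace Params

/-- The least weight `ω = min {Tt² / TVp, √k}`, where weights below `2` are not used unless
`√k < 2` (so that the level probabilities `1 / w_j` below sum to at most `1`). -/
noncomputable def omega (p : Params) : ℝ := min (max 2 (p.Tt ^ 2 / p.TVp)) √p.k

/-- The index of the top level, `⌈log₂ (√k / ω)⌉`; the levels are `0, …, top`. -/
noncomputable def top (p : Params) : ℕ := ⌈Real.logb 2 (√p.k / p.omega)⌉₊

/-- The weight `w_j = ω 2^j` of level `j`, capped at `√k`. -/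
noncomputable def weight (p : Params) (j : ℕ) : ℝ := min (p.omega * 2 ^ j) √p.k

end Params

/-! ### The random hash functions of one run -/

/-- The randomness of one run: one number in `[0,1]` for each value of the hash functions
`c, d₁, d₂` on vertices (`Fin 3 × V`), `h` on vertices (`V`) and
`r_C, r_{D,1}, r_{D,2}` on pairs of vertices (`Fin 3 × Sym2 V`). -/
abbrev Seed (V : Type*) : Type _ := ((Fin 3 × V) ⊕ (V ⊕ (Fin 3 × Sym2 V))) → unitInterval

section Run

variable {V : Type*}

/-- `c(v) = 1`, an event of probability `1 / √k`. -/
def cBit (p : Params) (s : Seed V) (v : V) : Prop :=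
  (s (Sum.inl (0, v)) : ℝ) < 1 / √p.k

/-- `d_i(v) = 1`, an event of probability `1 / √k`. -/
def dBit (p : Params) (s : Seed V) (i : Fin 2) (v : V) : Prop :=
  (s (Sum.inl (i.succ, v)) : ℝ) < 1 / √p.k

/-- `h(v) = j`: the levels `j = 0, …, top` are taken with probabilities `1 / w_j`, and `h(v)` is
no level with the remaining probability. -/
def hEq (p : Params) (s : Seed V) (v : V) (j : ℕ) : Prop :=
  j ≤ p.top ∧
    ∑ i ∈ Finset.range j, 1 / p.weight i ≤ (s (Sum.inr (Sum.inl v)) : ℝ) ∧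
    (s (Sum.inr (Sum.inl v)) : ℝ) < ∑ i ∈ Finset.range (j + 1), 1 / p.weight i

/-- `r_C(e)`, uniform on `[0,1]`. -/
def rC (s : Seed V) (e : Sym2 V) : ℝ := s (Sum.inr (Sum.inr (0, e)))

/-- `r_{D,i}(e)`, uniform on `[0,1]`. -/
def rD (s : Seed V) (i : Fin 2) (e : Sym2 V) : ℝ := s (Sum.inr (Sum.inr (i.succ, e)))

/-! ### The edges kept by one run -/

/-- The set of pairs that the run keeps when they are edges of the input graph: the union of the
five sets `E₀, …, E₄`. It is chosen without looking at the graph. -/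
def keep (p : Params) (s : Seed V) : Set (Sym2 V) :=
  {e | ∃ u v : V, e = s(u, v) ∧
    ((∃ i, dBit p s i u ∧ dBit p s i v) ∨
     (∃ i, cBit p s u ∧ dBit p s i v) ∨
     (cBit p s u ∧ cBit p s v) ∨
     (∃ i j, hEq p s u j ∧ rD s i e < p.weight j / √p.k ∧ dBit p s i v) ∨
     (∃ j, hEq p s u j ∧ rC s e < p.weight j / √p.k ∧ cBit p s v))}

/-- The graph formed by the kept edges of `G`. -/
def sampled (p : Params) (s : Seed V) (G : SimpleGraph V) : SimpleGraph V :=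
  SimpleGraph.fromEdgeSet (G.edgeSet ∩ keep p s)

variable [Fintype V]

/-- The number of edges of `G` that the run keeps. -/
noncomputable def keptCount (p : Params) (s : Seed V) (G : SimpleGraph V) : ℕ :=
  (edges (sampled p s G)).card

/-! ### First pass: the scale of each vertex -/

/-- `X_{v,i}^{(j)}`, the number of triangles counted at `v` under weight `w_j`. -/
noncomputable def firstCount (p : Params) (s : Seed V) (G : SimpleGraph V)
    (i : Fin 2) (v : V) (j : ℕ) : ℕ :=
  open scoped Classical in
  ((triangles G).filter fun t =>
    v ∈ t ∧ ∀ x ∈ t, x ≠ v → dBit p s i x ∧ rD s i s(v, x) < p.weight j / √p.k).card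

/-- `𝒯_{v,i}`, the least level `j` with `X_{v,i}^{(j)} ≥ w_j Tt / k²`; the value `⊤` stands for
"light". -/
noncomputable def scaleAux (p : Params) (s : Seed V) (G : SimpleGraph V)
    (i : Fin 2) (v : V) : WithTop ℕ :=
  open scoped Classical in
  ((Finset.range (p.top + 1)).filter fun j =>
    p.weight j * p.Tt / p.k ^ 2 ≤ (firstCount p s G i v j : ℝ)).min

/-- `𝒯_v`, the smaller of `𝒯_{v,1}` and `𝒯_{v,2}`. -/
noncomputable def scale (p : Params) (s : Seed V) (G : SimpleGraph V) (v : V) : WithTop ℕ :=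
  min (scaleAux p s G 0 v) (scaleAux p s G 1 v)

/-! ### Second pass: the estimate -/

/-- The estimate of the number of triangles all of whose vertices are light. -/
noncomputable def estLight (p : Params) (s : Seed V) (G : SimpleGraph V) : ℝ :=
  open scoped Classical in
  p.k ^ (3 / 2 : ℝ) *
    ((triangles G).filter fun t => ∀ x ∈ t, scale p s G x = ⊤ ∧ cBit p s x).card

/-- The contribution of a vertex `v` with `𝒯_v = j = h(v)` to the estimate of the number of the
other triangles. -/
noncomputable def vertexEst (p : Params) (s : Seed V) (G : SimpleGraph V) (v : V) (j : ℕ) : ℝ :=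
  open scoped Classical in
  ∑ t ∈ (triangles G).filter (fun t =>
      v ∈ t ∧ ∀ x ∈ t, x ≠ v → cBit p s x ∧ rC s s(v, x) < p.weight j / √p.k),
    p.k ^ 2 / p.weight j * (1 / ((t.filter fun x => scale p s G x ≠ ⊤).card : ℝ))

/-- The estimate of the number of triangles with at least one vertex that is not light. -/
noncomputable def estHeavy (p : Params) (s : Seed V) (G : SimpleGraph V) : ℝ :=
  open scoped Classical in
  ∑ v : V, ∑ j ∈ Finset.range (p.top + 1),
    if scale p s G v = (j : WithTop ℕ) ∧ hEq p s v j then vertexEst p s G v j else 0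

/-- The output of one run on the graph `G`. -/
noncomputable def estimate (p : Params) (s : Seed V) (G : SimpleGraph V) : ℝ :=
  estLight p s G + estHeavy p s G

/-- The output of one run when the input is `G`: the run only sees the kept edges of `G`. -/
noncomputable def runOutput (p : Params) (s : Seed V) (G : SimpleGraph V) : ℝ :=
  estimate p s (sampled p s G)

end Run

/-! ### The full algorithm -/

/-- The median of a tuple of reals (the upper one, if the number of entries is even). -/
noncomputable def median {n : ℕ} (x : Fin n → ℝ) : ℝ :=
  ((Finset.univ.val.map x).sort (· ≤ ·)).getD (n / 2) 0

/-- The parameters of the runs, computed from `Tt` and the values `DV`, `DE` that the algorithm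
knows for the truncated triangle degrees. Here
`k = min {Tt^(2/3), Tt / √DV, Tt / DE}`, but at least `1`; it is written through `1 / k` so that
nothing is divided by zero. -/
noncomputable def params (Tt DV DE : ℝ) : Params where
  Tt := Tt
  k := (min 1 (max (1 / Tt ^ (2 / 3 : ℝ)) (max (√DV / Tt) (DE / Tt))))⁻¹
  TVp := Tt * max 1 DV

/-- The randomness of the full algorithm: `n` blocks of `b` runs each. -/
abbrev Seeds (V : Type*) (n b : ℕ) : Type _ := Fin n → Fin b → Seed V

/-- All hash values of all runs are independent and uniform on `[0,1]`. -/
noncomputable def seedMeasure (V : Type*) [Fintype V] (n b : ℕ) : Measure (Seeds V n b) :=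
  open scoped Classical in
  Measure.pi fun _ => Measure.pi fun _ => Measure.pi fun _ => (volume : Measure unitInterval)

section Algorithm

variable {V : Type*} [Fintype V] {n b : ℕ}

/-- The median, over the blocks, of the mean of the outputs of the runs of the block. -/
noncomputable def combined (p : Params) (s : Seeds V n b) (G : SimpleGraph V) : ℝ :=
  median fun i : Fin n => (∑ j : Fin b, runOutput p (s i j) G) / b

/-- The answer of the algorithm: `some x` for the estimate `x`, and `none` for the verdict that
`Tt > T`. -/
noncomputable def answer (p : Params) (s : Seeds V n b) (G : SimpleGraph V) : Option ℝ :=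
  open scoped Classical in
  if 3 / 4 * p.Tt ≤ combined p s G then some (combined p s G) else none

/-- The number of edges kept by the algorithm, summed over all runs. -/
noncomputable def totalKept (p : Params) (s : Seeds V n b) (G : SimpleGraph V) : ℕ :=
  ∑ i : Fin n, ∑ j : Fin b, keptCount p (s i j) G

/-- The answer is a `(1 ± ε)` approximation to `T(G)`. -/
def IsApprox (G : SimpleGraph V) (ε : ℝ) (a : Option ℝ) : Prop :=
  ∃ x : ℝ, a = some x ∧ |x - (numTri G : ℝ)| ≤ ε * numTri G

end Algorithm

/-- The number of blocks, `⌈B log (1/δ)⌉`. -/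
noncomputable def numBlocks (B δ : ℝ) : ℕ := ⌈B * Real.log (1 / δ)⌉₊

/-- The number of runs in a block, `⌈A / ε²⌉`. -/
noncomputable def blockSize (A ε : ℝ) : ℕ := ⌈A / ε ^ 2⌉₊

end TriangleEstimation

open TriangleEstimation

/-! The output of a run is analysed as a sum over triangles of normalised indicators of boxes in the
cube of hash values. The kept edges are enough to compute the idealised estimate on all of `G`
(`runOutput_eq_estimate`). For a fixed classification `σ` of the vertices, this estimate is `estAt`:
each triangle is counted as a light one or split evenly among its non-light vertices, and each share
is multiplied by a function of mean one. The classification depends only on `d_i` and `r_{D,i}`, the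
second pass only on `c`, `h` and `r_C`. Resampling the second group with the first frozen therefore
gives the exact mean (`integral_estAt_scale`) and reduces the variance to that for a fixed `σ`.

For fixed `σ`, the correlation of two boxes is at most the product, over shared coordinates, of the
inverse probabilities. Summed over pairs of triangles (`integral_estAt_sub_sq_le`), this leaves a
term for shared edges, a diagonal term, a term proportional to the number of non-light vertices, and
a sum of `cost(v) τ_v²`, where `τ_v` is the number of triangles at `v` and the cost is the weight
assigned to `v`, or `√k` if `v` is light. The number of non-light vertices is controlled by Markov
(`integral_heavyCount_le`). For the cost, Chebyshev shows that one copy of the test at level `j`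
fails with probability at most `y / w_j`, where `y = O(Tt / τ_v)`. Level `j + 1` is assigned only if
both independent copies fail at level `j`, so its probability is at most `(y / w_j)²`. The square
makes the sum of weight times probability `O(ω + y)` without a factor for the number of levels
(`integral_vertexCost_le`). Altogether the second moment of the error is `O(M²)` with `M ≥ max(Tt,
T)` (`integral_run_error_sq_le`).

These bounds need small triangle degrees, so they are applied only to the triangles that avoid the
heavy prefixes of vertices and edges (`exists_good_triangles`). The remaining triangles contribute a
nonnegative amount of mean at most `εT/12`, for which Markov suffices. Means over blocks and a
median turn the resulting failure probability `1/4` into `δ` (`measureReal_half_le`).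

For the cost, every level keeps a given pair with probability `O(1/k)`, so a run keeps `O(m (top +
1) / k)` edges in expectation. If there is more than one level, then `1/k` is bounded by the two
terms with `DV` and `DE`, so no logarithm falls on `Tt^(-2/3)` (`params_cost_le`). -/

namespace TriangleEstimation

/-! ### Bounded measurable functions -/

/-- Bounded measurable real functions. -/
def BddMeas {Ω : Type*} [MeasurableSpace Ω] (f : Ω → ℝ) : Prop :=
  Measurable f ∧ ∃ K : ℝ, ∀ x, |f x| ≤ K

namespace BddMeas

variable {Ω : Type*} [MeasurableSpace Ω] {f g : Ω → ℝ}

theorem integrable (hf : BddMeas f) (μ : Measure Ω) [IsFiniteMeasure μ] : Integrable f μ := by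
  obtain ⟨hm, K, hK⟩ := hf
  exact Integrable.of_bound hm.aestronglyMeasurable K (Filter.Eventually.of_forall hK)

theorem memLp (hf : BddMeas f) (μ : Measure Ω) [IsFiniteMeasure μ] (q : ℝ≥0∞) : MemLp f q μ := by
  obtain ⟨hm, K, hK⟩ := hf
  exact MemLp.of_bound hm.aestronglyMeasurable K (Filter.Eventually.of_forall hK)

theorem const (a : ℝ) : BddMeas fun _ : Ω => a := ⟨measurable_const, |a|, fun _ => le_rfl⟩

theorem add (hf : BddMeas f) (hg : BddMeas g) : BddMeas fun x => f x + g x := by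
  obtain ⟨hm, K, hK⟩ := hf
  obtain ⟨hm', K', hK'⟩ := hg
  exact ⟨hm.add hm', K + K', fun x => (abs_add_le _ _).trans (add_le_add (hK x) (hK' x))⟩

theorem mul (hf : BddMeas f) (hg : BddMeas g) : BddMeas fun x => f x * g x := by
  obtain ⟨hm, K, hK⟩ := hf
  obtain ⟨hm', K', hK'⟩ := hg
  refine ⟨hm.mul hm', K * K', fun x => ?_⟩
  rw [abs_mul]
  exact mul_le_mul (hK x) (hK' x) (abs_nonneg _) ((abs_nonneg _).trans (hK x))

theorem sub (hf : BddMeas f) (hg : BddMeas g) : BddMeas fun x => f x - g x := by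
  simpa [sub_eq_add_neg] using hf.add ((BddMeas.const (-1)).mul hg)

theorem const_mul (a : ℝ) (hf : BddMeas f) : BddMeas fun x => a * f x := (const a).mul hf

theorem sq (hf : BddMeas f) : BddMeas fun x => f x ^ 2 := by simpa [pow_two] using hf.mul hf

theorem sum {κ : Type*} {s : Finset κ} {F : κ → Ω → ℝ} (h : ∀ i ∈ s, BddMeas (F i)) :
    BddMeas fun x => ∑ i ∈ s, F i x := by
  classical
  induction s using Finset.induction_on with
  | empty => simpa using const 0
  | insert a s ha ih =>
    simp only [Finset.sum_insert ha]
    exact (h a (by simp)).add (ih fun i hi => h i (by simp [hi]))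

theorem prod {κ : Type*} {s : Finset κ} {F : κ → Ω → ℝ} (h : ∀ i ∈ s, BddMeas (F i)) :
    BddMeas fun x => ∏ i ∈ s, F i x := by
  classical
  induction s using Finset.induction_on with
  | empty => simpa using const 1
  | insert a s ha ih =>
    simp only [Finset.prod_insert ha]
    exact (h a (by simp)).mul (ih fun i hi => h i (by simp [hi]))

theorem indicator {A : Set Ω} (hA : MeasurableSet A) (a : ℝ) :
    BddMeas (A.indicator fun _ => a) := by
  refine ⟨measurable_const.indicator hA, |a|, fun x => ?_⟩
  by_cases h : x ∈ A <;> simp [h]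

theorem comp {Ω' : Type*} [MeasurableSpace Ω'] (hf : BddMeas f) {φ : Ω' → Ω} (hφ : Measurable φ) :
    BddMeas fun x => f (φ x) :=
  ⟨hf.1.comp hφ, hf.2.choose, fun _ => hf.2.choose_spec _⟩

end BddMeas

/-- A function that depends only on finitely many measurable events is measurable and takes finitely
many values. -/
theorem measurable_of_events {Ω β κ : Type*} [MeasurableSpace Ω] [MeasurableSpace β] [Finite κ]
    (E : κ → Set Ω) (hE : ∀ i, MeasurableSet (E i)) (f : Ω → β)
    (h : ∀ x y, (∀ i, x ∈ E i ↔ y ∈ E i) → f x = f y) :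
    Measurable f ∧ (Set.range f).Finite := by
  -- The pattern of events that occur is a measurable map into a finite space, and `f` factors
  -- through it.
  have hpat : Measurable fun x : Ω => fun i => x ∈ E i :=
    measurable_pi_lambda _ fun i => measurable_mem.mpr (hE i) |> fun h => h
  have hfac : Function.FactorsThrough f fun x : Ω => fun i => x ∈ E i := by
    intro x y hxy
    exact h x y fun i => iff_of_eq (congrFun hxy i)
  rcases isEmpty_or_nonempty Ω with hΩ | ⟨⟨x0⟩⟩
  · exact ⟨measurable_of_empty f, Set.finite_range f⟩
  have hf : f = Function.extend (fun x : Ω => fun i => x ∈ E i) f (fun _ => f x0) ∘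
      (fun x : Ω => fun i => x ∈ E i) := by
    funext x
    exact (hfac.extend_apply _ x).symm
  constructor
  · rw [hf]
    exact (measurable_of_finite _).comp hpat
  · rw [hf]
    exact (Set.finite_range _).subset (Set.range_comp_subset_range _ _)

/-! ### Intervals in the unit interval -/

theorem measurableSet_coe_lt (a : ℝ) : MeasurableSet {x : unitInterval | (x : ℝ) < a} :=
  measurableSet_lt measurable_subtype_coe measurable_const

theorem measurableSet_le_coe_lt (a b : ℝ) :
    MeasurableSet {x : unitInterval | a ≤ (x : ℝ) ∧ (x : ℝ) < b} :=
  (measurableSet_le measurable_const measurable_subtype_coe).inter (measurableSet_coe_lt b)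

theorem volume_le_coe_lt {a b : ℝ} (ha : 0 ≤ a) (hab : a ≤ b) (hb : b ≤ 1) :
    volume.real {x : unitInterval | a ≤ (x : ℝ) ∧ (x : ℝ) < b} = b - a := by
  have h : volume {x : unitInterval | a ≤ (x : ℝ) ∧ (x : ℝ) < b} = ENNReal.ofReal (b - a) := by
    rw [unitInterval.volume_apply, ← Real.volume_Ico]
    congr 1
    ext y
    constructor
    · rintro ⟨x, hx, rfl⟩
      exact hx
    · intro hy
      exact ⟨⟨y, ha.trans hy.1, hy.2.le.trans hb⟩, hy, rfl⟩
  rw [Measure.real, h, ENNReal.toReal_ofReal (by linarith)]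

theorem volume_coe_lt {a : ℝ} (ha : 0 ≤ a) (h1 : a ≤ 1) :
    volume.real {x : unitInterval | (x : ℝ) < a} = a := by
  have := volume_le_coe_lt le_rfl ha h1
  rw [sub_zero] at this
  refine Eq.trans ?_ this
  congr 1
  ext x
  simp [x.2.1]

/-! ### Normalised indicators of boxes -/

section Box

variable {ι : Type*}

/-- The indicator of the box `{x | ∀ i ∈ S, x i ∈ A i}`, divided by the measure of the box. -/
noncomputable def boxFun (S : Finset ι) (A : ι → Set unitInterval) (x : ι → unitInterval) : ℝ :=
  ∏ i ∈ S, (A i).indicator (fun _ => (volume.real (A i))⁻¹) (x i)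

variable {S S' : Finset ι} {A A' : ι → Set unitInterval}

theorem boxFun_nonneg (x : ι → unitInterval) : 0 ≤ boxFun S A x :=
  Finset.prod_nonneg fun _ _ => Set.indicator_nonneg (fun _ _ => by positivity) _

theorem boxFun_congr {x y : ι → unitInterval} (h : ∀ i ∈ S, x i ∈ A i ↔ y i ∈ A i) :
    boxFun S A x = boxFun S A y := by
  refine Finset.prod_congr rfl fun i hi => ?_
  by_cases hx : x i ∈ A i
  · simp [hx, (h i hi).mp hx]
  · simp [hx, mt (h i hi).mpr hx]

theorem bddMeas_boxFun (hA : ∀ i ∈ S, MeasurableSet (A i)) : BddMeas (boxFun S A) :=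
  BddMeas.prod fun i hi => (BddMeas.indicator (hA i hi) _).comp (measurable_pi_apply i)

open scoped Classical in
/-- Take the coordinates in `D` from `x` and the others from `y`. -/
noncomputable def merge (D : Set ι) (x y : ι → unitInterval) : ι → unitInterval :=
  fun i => if i ∈ D then x i else y i

theorem measurable_merge (D : Set ι) :
    Measurable fun z : (ι → unitInterval) × (ι → unitInterval) => merge D z.1 z.2 := by
  refine measurable_pi_lambda _ fun i => ?_
  by_cases hi : i ∈ D <;> simp only [merge, hi, if_true, if_false]
  · exact (measurable_pi_apply i).comp measurable_fst
  · exact (measurable_pi_apply i).comp measurable_snd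

variable [Fintype ι]

/-- The uniform probability measure on a cube. -/
noncomputable def cube (ι : Type*) [Fintype ι] : Measure (ι → unitInterval) :=
  Measure.pi fun _ => volume

instance : IsProbabilityMeasure (cube ι) := by unfold cube; infer_instance

theorem integral_cube_prod (f : ι → unitInterval → ℝ) :
    ∫ x, ∏ i, f i (x i) ∂cube ι = ∏ i, ∫ y, f i y :=
  integral_fintype_prod_eq_prod f

theorem integral_boxFun (hA : ∀ i ∈ S, MeasurableSet (A i)) (h0 : ∀ i ∈ S, 0 < volume.real (A i)) :
    ∫ x, boxFun S A x ∂cube ι = 1 := by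
  classical
  obtain ⟨f, hf⟩ : ∃ f : ι → unitInterval → ℝ, f = fun i y => if i ∈ S then
      (A i).indicator (fun _ => (volume.real (A i))⁻¹) y else 1 := ⟨_, rfl⟩
  have h : ∀ x : ι → unitInterval, boxFun S A x = ∏ i, f i (x i) := by
    intro x
    simp [hf, boxFun, Finset.prod_ite_mem]
  refine (integral_congr_ae (ae_of_all _ h)).trans ?_
  rw [integral_cube_prod, hf]
  refine Finset.prod_eq_one fun i _ => ?_
  by_cases hi : i ∈ S
  · simp only [hi, if_true]
    rw [integral_indicator_const _ (hA i hi), smul_eq_mul, mul_inv_cancel₀ (h0 i hi).ne']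
  · simp [hi]

/-- By independence the integral factors over coordinates. A coordinate used by at most one box
contributes one; on a shared coordinate the first indicator is at most its normalising constant, and
the second still integrates to one. -/
theorem integral_boxFun_mul_le [DecidableEq ι] (B : ι → ℝ)
    (hA : ∀ i ∈ S, MeasurableSet (A i)) (h0 : ∀ i ∈ S, 0 < volume.real (A i))
    (hA' : ∀ i ∈ S', MeasurableSet (A' i)) (h0' : ∀ i ∈ S', 0 < volume.real (A' i))
    (hB : ∀ i ∈ S, i ∈ S' → (volume.real (A i))⁻¹ ≤ B i) :
    ∫ x, boxFun S A x * boxFun S' A' x ∂cube ι ≤ ∏ i ∈ S, if i ∈ S' then B i else 1 := by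
  have hint : ∀ i ∈ S, ∫ y, (A i).indicator (fun _ => (volume.real (A i))⁻¹) y = 1 := by
    intro i hi
    rw [integral_indicator_const _ (hA i hi), smul_eq_mul, mul_inv_cancel₀ (h0 i hi).ne']
  have hint' : ∀ i ∈ S', ∫ y, (A' i).indicator (fun _ => (volume.real (A' i))⁻¹) y = 1 := by
    intro i hi
    rw [integral_indicator_const _ (hA' i hi), smul_eq_mul, mul_inv_cancel₀ (h0' i hi).ne']
  obtain ⟨f, hf⟩ : ∃ f : ι → unitInterval → ℝ, f = fun i y => (if i ∈ S then
      (A i).indicator (fun _ => (volume.real (A i))⁻¹) y else 1) * (if i ∈ S' then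
      (A' i).indicator (fun _ => (volume.real (A' i))⁻¹) y else 1) := ⟨_, rfl⟩
  have h : ∀ x : ι → unitInterval, boxFun S A x * boxFun S' A' x = ∏ i, f i (x i) := by
    intro x
    rw [hf, Finset.prod_mul_distrib]
    simp only [boxFun, Finset.prod_ite_mem, Finset.univ_inter]
  refine le_of_eq_of_le (integral_congr_ae (ae_of_all _ h)) ?_
  rw [integral_cube_prod, hf]
  have hR : (∏ i ∈ S, if i ∈ S' then B i else 1)
      = ∏ i, if i ∈ S then (if i ∈ S' then B i else 1) else 1 := by
    simp [Finset.prod_ite_mem]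
  rw [hR]
  refine Finset.prod_le_prod (fun i _ => ?_) (fun i _ => ?_)
  · refine integral_nonneg fun y => mul_nonneg ?_ ?_
    · split_ifs
      · exact Set.indicator_nonneg (fun _ _ => by positivity) _
      · exact zero_le_one
    · split_ifs
      · exact Set.indicator_nonneg (fun _ _ => by positivity) _
      · exact zero_le_one
  · by_cases hi : i ∈ S <;> by_cases hi' : i ∈ S' <;> simp only [hi, hi', if_true, if_false]
    · refine le_trans ?_ (hB i hi hi')
      have hm' := BddMeas.indicator (hA' i hi') (volume.real (A' i))⁻¹
      calc _ ≤ ∫ y, (volume.real (A i))⁻¹ *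
            (A' i).indicator (fun _ => (volume.real (A' i))⁻¹) y := by
            refine integral_mono (((BddMeas.indicator (hA i hi) _).mul hm').integrable _)
              ((hm'.const_mul _).integrable _) fun y => ?_
            refine mul_le_mul_of_nonneg_right ?_
              (Set.indicator_nonneg (fun _ _ => by positivity) _)
            by_cases hy : y ∈ A i
            · simp [hy]
            · simp [hy, measureReal_nonneg]
        _ = (volume.real (A i))⁻¹ := by rw [integral_const_mul, hint' i hi', mul_one]
    · simp only [mul_one]; exact (hint i hi).le
    · simp only [one_mul]; exact (hint' i hi').le
    · simp

/-- The second moment of a weighted sum of functions with expectation one. -/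
theorem integral_sq_sum_le {Ω κ : Type*} [MeasurableSpace Ω] (μ : Measure Ω)
    [IsProbabilityMeasure μ] (P : Finset κ) (α : κ → ℝ) (Y : κ → Ω → ℝ) (β : κ → κ → ℝ)
    (hα : ∀ i ∈ P, 0 ≤ α i) (hY : ∀ i ∈ P, BddMeas (Y i)) (h1 : ∀ i ∈ P, ∫ x, Y i x ∂μ = 1)
    (hβ : ∀ i ∈ P, ∀ j ∈ P, ∫ x, Y i x * Y j x ∂μ ≤ 1 + β i j) :
    ∫ x, (∑ i ∈ P, α i * Y i x - ∑ i ∈ P, α i) ^ 2 ∂μ ≤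
      ∑ i ∈ P, ∑ j ∈ P, α i * α j * β i j := by
  -- The summand is `(Y i - 1) (Y j - 1)` multiplied out, whose mean is the mean of `Y i * Y j`
  -- minus one.
  have hexp : ∀ x, (∑ i ∈ P, α i * Y i x - ∑ i ∈ P, α i) ^ 2 =
      ∑ i ∈ P, ∑ j ∈ P, α i * α j * ((Y i x * Y j x - Y i x) - (Y j x - 1)) := by
    intro x
    rw [← Finset.sum_sub_distrib, pow_two, Finset.sum_mul_sum]
    exact Finset.sum_congr rfl fun i _ => Finset.sum_congr rfl fun j _ => by ring
  have hb : ∀ i ∈ P, ∀ j ∈ P,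
      BddMeas fun x => (Y i x * Y j x - Y i x) - (Y j x - 1) := fun i hi j hj =>
    (((hY i hi).mul (hY j hj)).sub (hY i hi)).sub ((hY j hj).sub (BddMeas.const 1))
  simp only [hexp]
  rw [integral_finsetSum _ fun i hi => (BddMeas.sum fun j hj =>
    (hb i hi j hj).const_mul (α i * α j)).integrable μ]
  refine Finset.sum_le_sum fun i hi => ?_
  rw [integral_finsetSum _ fun j hj => ((hb i hi j hj).const_mul (α i * α j)).integrable μ]
  refine Finset.sum_le_sum fun j hj => ?_
  rw [integral_const_mul]
  refine mul_le_mul_of_nonneg_left ?_ (mul_nonneg (hα i hi) (hα j hj))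
  rw [integral_sub ((((hY i hi).mul (hY j hj)).sub (hY i hi)).integrable μ)
      (((hY j hj).sub (BddMeas.const 1)).integrable μ),
    integral_sub (((hY i hi).mul (hY j hj)).integrable μ) ((hY i hi).integrable μ),
    integral_sub ((hY j hj).integrable μ) ((BddMeas.const 1).integrable μ), h1 i hi, h1 j hj]
  have := hβ i hi j hj
  simp only [integral_const, probReal_univ, smul_eq_mul]
  linarith

/-! ### Resampling coordinates -/

/-- This replaces conditional expectations: a uniform point can be drawn by taking the coordinates
in `D` from one sample and the others from an independent one, so Fubini integrates out the second
group with the first fixed. -/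
theorem map_merge (D : Set ι) :
    ((cube ι).prod (cube ι)).map (fun z => merge D z.1 z.2) = cube ι := by
  classical
  symm
  refine Measure.pi_eq fun s hs => ?_
  rw [Measure.map_apply (measurable_merge D) (MeasurableSet.univ_pi hs)]
  have : (fun z : (ι → unitInterval) × (ι → unitInterval) => merge D z.1 z.2) ⁻¹' Set.univ.pi s
      = (Set.univ.pi fun i => if i ∈ D then s i else Set.univ) ×ˢ
        (Set.univ.pi fun i => if i ∈ D then Set.univ else s i) := by
    ext ⟨x, y⟩
    simp only [Set.mem_preimage, Set.mem_pi, Set.mem_univ, true_implies, Set.mem_prod,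
      ← forall_and]
    refine forall_congr' fun i => ?_
    by_cases hi : i ∈ D <;> simp [merge, hi]
  rw [this, Measure.prod_prod, cube, Measure.pi_pi, Measure.pi_pi, ← Finset.prod_mul_distrib]
  refine Finset.prod_congr rfl fun i _ => ?_
  by_cases hi : i ∈ D <;> simp [hi]

theorem integral_merge (D : Set ι) {F : (ι → unitInterval) → ℝ} (hF : BddMeas F) :
    ∫ x, F x ∂cube ι = ∫ x, ∫ y, F (merge D x y) ∂cube ι ∂cube ι := by
  conv_lhs => rw [← map_merge D]
  rw [integral_map (measurable_merge D).aemeasurable hF.1.aestronglyMeasurable]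
  rw [integral_prod _ ((hF.comp (measurable_merge D)).integrable _)]

/-- If, for the frozen coordinates `x`, the remaining integral is at most `H x`, then the whole
integral is at most that of `H`. -/
theorem integral_le_of_merge (D : Set ι) {F H : (ι → unitInterval) → ℝ} (hF : BddMeas F)
    (hH : BddMeas H) (h : ∀ x, ∫ y, F (merge D x y) ∂cube ι ≤ H x) :
    ∫ x, F x ∂cube ι ≤ ∫ x, H x ∂cube ι := by
  rw [integral_merge D hF]
  exact integral_mono ((hF.comp (measurable_merge D)).integrable _).integral_prod_left
    (hH.integrable _) h

/-- Functions of disjoint sets of coordinates are independent. -/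
theorem integral_mul_of_merge (D : Set ι) {f g : (ι → unitInterval) → ℝ} (hf : BddMeas f)
    (hg : BddMeas g) (hfD : ∀ x y, f (merge D x y) = f x) (hgD : ∀ x y, g (merge D x y) = g y) :
    ∫ x, f x * g x ∂cube ι = (∫ x, f x ∂cube ι) * ∫ x, g x ∂cube ι := by
  rw [integral_merge D (hf.mul hg)]
  simp only [hfD, hgD, integral_const_mul, integral_mul_const]

end Box

/-! ### The weights -/

namespace Params

variable {p : Params}

theorem one_le_sqrt_k (hk : 1 ≤ p.k) : 1 ≤ √p.k := Real.one_le_sqrt.mpr hk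

theorem one_le_omega (hk : 1 ≤ p.k) : 1 ≤ p.omega :=
  le_min (one_le_two.trans (le_max_left _ _)) (one_le_sqrt_k hk)

theorem omega_le_sqrt : p.omega ≤ √p.k := min_le_right _ _

theorem one_le_weight (hk : 1 ≤ p.k) (j : ℕ) : 1 ≤ p.weight j :=
  le_min (one_le_mul_of_one_le_of_one_le (one_le_omega hk) (one_le_pow₀ one_le_two))
    (one_le_sqrt_k hk)

theorem weight_pos (hk : 1 ≤ p.k) (j : ℕ) : 0 < p.weight j :=
  zero_lt_one.trans_le (one_le_weight hk j)

theorem weight_le_sqrt (j : ℕ) : p.weight j ≤ √p.k := min_le_right _ _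

theorem omega_le_weight (hk : 1 ≤ p.k) (j : ℕ) : p.omega ≤ p.weight j :=
  le_min (le_mul_of_one_le_right (zero_le_one.trans (one_le_omega hk)) (one_le_pow₀ one_le_two))
    omega_le_sqrt

theorem weight_mono (hk : 1 ≤ p.k) : Monotone p.weight := by
  intro i j hij
  refine min_le_min_right _ (mul_le_mul_of_nonneg_left ?_ (zero_le_one.trans (one_le_omega hk)))
  exact pow_le_pow_right₀ one_le_two hij

theorem weight_succ_le (j : ℕ) : p.weight (j + 1) ≤ 2 * p.weight j := by
  unfold weight
  rw [mul_min_of_nonneg _ _ zero_le_two]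
  refine min_le_min ?_ ?_
  · rw [pow_succ]; linarith
  · have := Real.sqrt_nonneg p.k; linarith

theorem omega_mul_lt_of_lt_top (hk : 1 ≤ p.k) {j : ℕ} (hj : j < p.top) :
    p.omega * 2 ^ j < √p.k := by
  have hω := one_le_omega hk
  have hs := one_le_sqrt_k hk
  have h := Nat.lt_ceil.mp hj
  rw [Real.lt_logb_iff_rpow_lt one_lt_two (by positivity), Real.rpow_natCast,
    lt_div_iff₀ (by positivity)] at h
  linarith

theorem sqrt_le_omega_mul_top (hk : 1 ≤ p.k) : √p.k ≤ p.omega * 2 ^ p.top := by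
  have hω := one_le_omega hk
  have hs := one_le_sqrt_k hk
  have h : Real.logb 2 (√p.k / p.omega) ≤ p.top := Nat.le_ceil _
  rw [Real.logb_le_iff_le_rpow one_lt_two (by positivity), Real.rpow_natCast,
    div_le_iff₀ (by positivity)] at h
  linarith

theorem weight_of_lt_top (hk : 1 ≤ p.k) {j : ℕ} (hj : j < p.top) :
    p.weight j = p.omega * 2 ^ j :=
  min_eq_left (omega_mul_lt_of_lt_top hk hj).le

theorem weight_top (hk : 1 ≤ p.k) : p.weight p.top = √p.k :=
  min_eq_right (sqrt_le_omega_mul_top hk)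

/-- With more than one level, `ω` is strictly below `√k`, so the cap in its definition is inactive.
-/
theorem two_le_omega_of_top_pos (hk : 1 ≤ p.k) (h : 0 < p.top) : 2 ≤ p.omega := by
  have h1 := omega_mul_lt_of_lt_top hk h
  rw [pow_zero, mul_one] at h1
  rcases min_choice (max 2 (p.Tt ^ 2 / p.TVp)) √p.k with h2 | h2
  · exact (le_max_left _ _).trans h2.ge
  · exact absurd h2 h1.ne

/-- This makes the intervals that define `h` fit into `[0,1]`. The levels below the top form a
geometric series with sum `2/ω - 2/(ω 2^top)`; the subtracted term pays for the capped top level,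
and `2/ω ≤ 1`. -/
theorem sum_inv_weight_le_one (hk : 1 ≤ p.k) {j : ℕ} (hj : j ≤ p.top + 1) :
    ∑ i ∈ Finset.range j, 1 / p.weight i ≤ 1 := by
  have hmono : ∑ i ∈ Finset.range j, 1 / p.weight i
      ≤ ∑ i ∈ Finset.range (p.top + 1), 1 / p.weight i :=
    Finset.sum_le_sum_of_subset_of_nonneg (Finset.range_mono hj)
      fun i _ _ => by have := weight_pos hk i; positivity
  refine hmono.trans ?_
  have hω := one_le_omega hk
  have hs := one_le_sqrt_k hk
  rw [Finset.sum_range_succ, weight_top hk]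
  have hgeom : ∀ n : ℕ, ∑ i ∈ Finset.range n, 1 / (p.omega * 2 ^ i)
      = 2 / p.omega - 2 / (p.omega * 2 ^ n) := by
    intro n
    induction n with
    | zero => simp
    | succ n ih =>
      rw [Finset.sum_range_succ, ih, pow_succ]
      field_simp
      ring
  rw [Finset.sum_congr rfl fun i hi => by rw [weight_of_lt_top hk (Finset.mem_range.mp hi)], hgeom]
  rcases Nat.eq_zero_or_pos p.top with h0 | h0
  · rw [h0, pow_zero, mul_one, sub_self, zero_add]
    exact (div_le_one (by positivity)).mpr hs
  · have h2 := two_le_omega_of_top_pos hk h0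
    have h3 := omega_mul_lt_of_lt_top hk (Nat.sub_lt h0 one_pos)
    have h4 : (2 : ℝ) ^ p.top = 2 ^ (p.top - 1) * 2 := by
      rw [← pow_succ, Nat.sub_add_cancel h0]
    have h5 : 1 / √p.k ≤ 2 / (p.omega * 2 ^ p.top) := by
      rw [div_le_div_iff₀ (by positivity) (by positivity), h4]
      linarith
    have h6 : 2 / p.omega ≤ 1 := (div_le_one (by positivity)).mpr h2
    linarith

theorem sum_weight_le (hk : 1 ≤ p.k) :
    ∑ j ∈ Finset.range (p.top + 1), p.weight j ≤ 3 * √p.k := by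
  have hω := one_le_omega hk
  have hgeom : ∀ n : ℕ, n ≤ p.top → ∑ i ∈ Finset.range n, p.weight i ≤ p.omega * 2 ^ n := by
    intro n
    induction n with
    | zero => intro _; simp; linarith
    | succ n ih =>
      intro hn
      rw [Finset.sum_range_succ, weight_of_lt_top hk hn, pow_succ]
      linarith [ih (Nat.le_of_succ_le hn)]
  rw [Finset.sum_range_succ, weight_top hk]
  rcases Nat.eq_zero_or_pos p.top with h0 | h0
  · rw [h0]; simp; linarith [Real.sqrt_nonneg p.k]
  · have h1 := omega_mul_lt_of_lt_top hk (Nat.sub_lt h0 one_pos)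
    have h4 : (2 : ℝ) ^ p.top = 2 ^ (p.top - 1) * 2 := by
      rw [← pow_succ, Nat.sub_add_cancel h0]
    have := hgeom _ le_rfl
    rw [h4] at this
    linarith

end Params

/-! ### The run sees everything it needs -/

section Sampled

open scoped Classical

variable {V : Type*} {p : Params} {s : Seed V} {G : SimpleGraph V}

theorem keep_of_center {t : Finset V} {v : V}
    (hv : ∀ x ∈ t, x ≠ v → s(v, x) ∈ keep p s)
    (h : ∀ x ∈ t, ∀ y ∈ t, x ≠ v → y ≠ v → s(x, y) ∈ keep p s) :
    ∀ x ∈ t, ∀ y ∈ t, x ≠ y → s(x, y) ∈ keep p s := by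
  intro x hx y hy hxy
  by_cases h1 : x = v
  · subst h1; exact hv y hy hxy.symm
  · by_cases h2 : y = v
    · subst h2; rw [Sym2.eq_swap]; exact hv x hx h1
    · exact h x hx y hy h1 h2

variable [Fintype V]

theorem mem_triangles {t : Finset V} : t ∈ triangles G ↔ G.IsNClique 3 t := by
  simp [triangles]

theorem card_of_mem_triangles {t : Finset V} (h : t ∈ triangles G) : t.card = 3 :=
  (mem_triangles.mp h).card_eq

theorem mem_triangles_sampled {t : Finset V} :
    t ∈ triangles (sampled p s G) ↔
      t ∈ triangles G ∧ ∀ x ∈ t, ∀ y ∈ t, x ≠ y → s(x, y) ∈ keep p s := by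
  simp only [mem_triangles, SimpleGraph.isNClique_iff, SimpleGraph.isClique_iff, Set.Pairwise,
    sampled, SimpleGraph.fromEdgeSet_adj, Set.mem_inter_iff, SimpleGraph.mem_edgeSet,
    Finset.mem_coe]
  constructor
  · rintro ⟨h, h3⟩
    exact ⟨⟨fun x hx y hy hxy => (h hx hy hxy).1.1, h3⟩,
      fun x hx y hy hxy => (h hx hy hxy).1.2⟩
  · rintro ⟨⟨h, h3⟩, h'⟩
    exact ⟨fun x hx y hy hxy => ⟨⟨h hx hy hxy, h' x hx y hy hxy⟩, hxy⟩, h3⟩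

/-- All edges of a counted triangle are kept. The edge opposite `v` joins two vertices with `d_i =
1`; the edges at `v` are kept because of `c(v) = 1`, or through the level `j' ≥ j` of `v`, whose
threshold for `r_{D,i}` is at least that of level `j`. -/
theorem firstCount_sampled (hk : 1 ≤ p.k) (i : Fin 2) (v : V) (j : ℕ)
    (hv : cBit p s v ∨ ∃ j', j ≤ j' ∧ hEq p s v j') :
    firstCount p s (sampled p s G) i v j = firstCount p s G i v j := by
  unfold firstCount
  refine congrArg Finset.card ?_
  ext t
  simp only [Finset.mem_filter, mem_triangles_sampled, and_assoc, and_congr_right_iff]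
  intro _
  constructor
  · rintro ⟨_, h⟩; exact h
  · rintro ⟨hvt, h⟩
    refine ⟨keep_of_center (v := v) ?_ ?_, hvt, h⟩
    · intro x hx hxv
      refine ⟨v, x, rfl, ?_⟩
      rcases hv with hc | ⟨j', hj, hh⟩
      · exact Or.inr (Or.inl ⟨i, hc, (h x hx hxv).1⟩)
      · refine Or.inr (Or.inr (Or.inr (Or.inl ⟨i, j', hh, ?_, (h x hx hxv).1⟩)))
        refine (h x hx hxv).2.trans_le ?_
        exact div_le_div_of_nonneg_right (Params.weight_mono hk hj) (Real.sqrt_nonneg _)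
    · intro x hx y hy h1 h2
      exact ⟨x, y, rfl, Or.inl ⟨i, (h x hx h1).1, (h y hy h2).1⟩⟩

/-- The vertex `v` passes the test of level `j` in one of the two copies of the first pass. -/
def Passes (p : Params) (s : Seed V) (G : SimpleGraph V) (v : V) (j : ℕ) : Prop :=
  ∃ i, p.weight j * p.Tt / p.k ^ 2 ≤ (firstCount p s G i v j : ℝ)

theorem scale_eq_min (v : V) :
    scale p s G v = ((Finset.range (p.top + 1)).filter fun j => Passes p s G v j).min := by
  unfold scale scaleAux
  rw [← Finset.min_union, ← Finset.filter_or]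
  simp only [Passes, Fin.exists_fin_two]

theorem scale_eq_top_iff (v : V) :
    scale p s G v = ⊤ ↔ ∀ j ≤ p.top, ¬ Passes p s G v j := by
  rw [scale_eq_min, Finset.min_eq_top, Finset.filter_eq_empty_iff]
  simp

theorem scale_eq_coe_iff (v : V) (j : ℕ) :
    scale p s G v = (j : WithTop ℕ) ↔
      j ≤ p.top ∧ Passes p s G v j ∧ ∀ j' < j, ¬ Passes p s G v j' := by
  rw [scale_eq_min]
  constructor
  · intro h
    have h1 := Finset.mem_of_min h
    simp only [Finset.mem_filter, Finset.mem_range, Nat.lt_succ_iff] at h1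
    refine ⟨h1.1, h1.2, fun j' hj' hp => ?_⟩
    refine absurd (Finset.min_le_of_eq (b := j') ?_ h) (not_le.mpr hj')
    simp only [Finset.mem_filter, Finset.mem_range, Nat.lt_succ_iff]
    exact ⟨hj'.le.trans h1.1, hp⟩
  · rintro ⟨h1, h2, h3⟩
    refine le_antisymm (Finset.min_le ?_) (Finset.le_min fun b hb => ?_)
    · simp only [Finset.mem_filter, Finset.mem_range, Nat.lt_succ_iff]
      exact ⟨h1, h2⟩
    · simp only [Finset.mem_filter] at hb
      by_contra hlt
      exact h3 b (not_le.mp fun h => hlt (WithTop.coe_le_coe.mpr h)) hb.2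

theorem exists_scale_eq_coe {v : V} (h : scale p s G v ≠ ⊤) :
    ∃ j ≤ p.top, scale p s G v = (j : WithTop ℕ) := by
  obtain ⟨j, hj⟩ := WithTop.ne_top_iff_exists.mp h
  exact ⟨j, ((scale_eq_coe_iff v j).mp hj.symm).1, hj.symm⟩

theorem scale_sampled_of_cBit (hk : 1 ≤ p.k) {v : V} (hv : cBit p s v) :
    scale p s (sampled p s G) v = scale p s G v := by
  rw [scale_eq_min, scale_eq_min]
  refine congrArg Finset.min (Finset.filter_congr fun j _ => ?_)
  simp only [Passes, firstCount_sampled hk _ _ _ (Or.inl hv)]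

/-- Only an equivalence is available: a vertex hashed to level `j` sees its tests correctly up to
level `j` but perhaps not above. Those tests decide whether `j` is the least level passed, and the
estimate needs nothing else about such a vertex. -/
theorem scale_sampled_of_hEq (hk : 1 ≤ p.k) {v : V} {j : ℕ} (hv : hEq p s v j) :
    scale p s (sampled p s G) v = (j : WithTop ℕ) ↔ scale p s G v = (j : WithTop ℕ) := by
  have h : ∀ j' ≤ j, Passes p s (sampled p s G) v j' ↔ Passes p s G v j' := by
    intro j' hj'
    simp only [Passes, firstCount_sampled hk _ _ _ (Or.inr ⟨j, hj', hv⟩)]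
  rw [scale_eq_coe_iff, scale_eq_coe_iff, h j le_rfl]
  refine and_congr_right fun _ => and_congr_right fun _ => ?_
  exact forall_congr' fun j' => forall_congr' fun hj' => not_congr (h j' hj'.le)

theorem estLight_sampled (hk : 1 ≤ p.k) : estLight p s (sampled p s G) = estLight p s G := by
  unfold estLight
  refine congrArg (fun n : Finset (Finset V) => p.k ^ (3 / 2 : ℝ) * (n.card : ℝ)) ?_
  ext t
  simp only [Finset.mem_filter, mem_triangles_sampled, and_assoc, and_congr_right_iff]
  intro _
  constructor
  · rintro ⟨_, h⟩ x hx
    exact ⟨scale_sampled_of_cBit hk (h x hx).2 ▸ (h x hx).1, (h x hx).2⟩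
  · intro h
    refine ⟨fun x hx y hy _ => ⟨x, y, rfl, Or.inr (Or.inr (Or.inl ⟨(h x hx).2, (h y hy).2⟩))⟩,
      fun x hx => ⟨?_, (h x hx).2⟩⟩
    rw [scale_sampled_of_cBit hk (h x hx).2]
    exact (h x hx).1

theorem vertexEst_sampled (hk : 1 ≤ p.k) {v : V} {j : ℕ} (hv : hEq p s v j)
    (hs : scale p s G v = (j : WithTop ℕ)) :
    vertexEst p s (sampled p s G) v j = vertexEst p s G v j := by
  unfold vertexEst
  refine Finset.sum_congr ?_ ?_
  · ext t
    simp only [Finset.mem_filter, mem_triangles_sampled, and_assoc, and_congr_right_iff]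
    intro _
    constructor
    · rintro ⟨_, h⟩; exact h
    · rintro ⟨hvt, h⟩
      refine ⟨keep_of_center (v := v) ?_ ?_, hvt, h⟩
      · intro x hx hxv
        exact ⟨v, x, rfl, Or.inr (Or.inr (Or.inr (Or.inr ⟨j, hv, (h x hx hxv).2,
          (h x hx hxv).1⟩)))⟩
      · intro x hx y hy h1 h2
        exact ⟨x, y, rfl, Or.inr (Or.inr (Or.inl ⟨(h x hx h1).1, (h y hy h2).1⟩))⟩
  · intro t ht
    simp only [Finset.mem_filter] at ht
    refine congrArg (fun n : Finset V => p.k ^ 2 / p.weight j * (1 / (n.card : ℝ))) ?_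
    refine Finset.filter_congr fun x hx => ?_
    by_cases hxv : x = v
    · subst hxv
      rw [(scale_sampled_of_hEq hk hv).mpr hs, hs]
    · rw [scale_sampled_of_cBit hk (ht.2.2 x hx hxv).1]

/-- The kept edges determine the estimate. -/
theorem runOutput_eq_estimate (hk : 1 ≤ p.k) : runOutput p s G = estimate p s G := by
  unfold runOutput estimate
  rw [estLight_sampled hk]
  refine congrArg (fun x => estLight p s G + x) ?_
  unfold estHeavy
  refine Finset.sum_congr rfl fun v _ => Finset.sum_congr rfl fun j _ => ?_
  by_cases hv : hEq p s v j
  · simp only [hv, and_true, scale_sampled_of_hEq hk hv]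
    split_ifs with h
    · exact vertexEst_sampled hk hv h
    · rfl
  · simp [hv]

end Sampled

theorem boxFun_eq_ite {ι : Type*} (S : Finset ι) (A : ι → Set unitInterval)
    (x : ι → unitInterval) [Decidable (∀ i ∈ S, x i ∈ A i)] :
    boxFun S A x = if ∀ i ∈ S, x i ∈ A i then ∏ i ∈ S, (volume.real (A i))⁻¹ else 0 := by
  split_ifs with h
  · exact Finset.prod_congr rfl fun i hi => Set.indicator_of_mem (h i hi) _
  · push Not at h
    obtain ⟨i, hi, hx⟩ := h
    exact Finset.prod_eq_zero hi (Set.indicator_of_notMem hx _)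

/-! ### The boxes of the algorithm -/

section Items

open scoped Classical

/-- The coordinates of a seed. -/
abbrev Idx (V : Type*) : Type _ := (Fin 3 × V) ⊕ (V ⊕ (Fin 3 × Sym2 V))

/-- The range of the hash values that count at level `j`. -/
noncomputable def levelBox {V : Type*} (p : Params) (j : ℕ) : Idx V → Set unitInterval
  | .inl _ => {y | (y : ℝ) < 1 / √p.k}
  | .inr (.inl _) => {y | ∑ i ∈ Finset.range j, 1 / p.weight i ≤ (y : ℝ) ∧
      (y : ℝ) < ∑ i ∈ Finset.range (j + 1), 1 / p.weight i}
  | .inr (.inr _) => {y | (y : ℝ) < p.weight j / √p.k}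

/-- The coordinates that decide whether the triangle `t` is counted at its vertex `v`. -/
noncomputable def starSet {V : Type*} (i : Fin 3) (t : Finset V) (v : V) (H : Finset V) :
    Finset (Idx V) :=
  (({i} : Finset (Fin 3)) ×ˢ t.erase v).disjSum
    (H.disjSum (({i} : Finset (Fin 3)) ×ˢ (t.erase v).image fun x => s(v, x)))

/-- The coordinates that decide whether the triangle `t` is counted as a light one. -/
def lightSet {V : Type*} (t : Finset V) : Finset (Idx V) :=
  (({0} : Finset (Fin 3)) ×ˢ t).disjSum ∅

section Basic

variable {V : Type*} {p : Params}

theorem measurableSet_levelBox (j : ℕ) (i : Idx V) : MeasurableSet (levelBox p j i) := by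
  rcases i with i | i | i
  · exact measurableSet_coe_lt _
  · exact measurableSet_le_coe_lt _ _
  · exact measurableSet_coe_lt _

theorem volume_levelBox_inl (hk : 1 ≤ p.k) (j : ℕ) (i : Fin 3 × V) :
    volume.real (levelBox p j (.inl i)) = 1 / √p.k := by
  have := Params.one_le_sqrt_k hk
  exact volume_coe_lt (by positivity) ((div_le_one (by positivity)).mpr this)

theorem volume_levelBox_mid (hk : 1 ≤ p.k) {j : ℕ} (hj : j ≤ p.top) (v : V) :
    volume.real (levelBox p j (.inr (.inl v))) = 1 / p.weight j := by
  have h := volume_le_coe_lt (a := ∑ i ∈ Finset.range j, 1 / p.weight i)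
    (b := ∑ i ∈ Finset.range (j + 1), 1 / p.weight i)
    (Finset.sum_nonneg fun i _ => by have := Params.weight_pos hk i; positivity)
    (by
      rw [Finset.sum_range_succ]
      have := Params.weight_pos hk j
      have : 0 < 1 / p.weight j := by positivity
      linarith)
    (Params.sum_inv_weight_le_one hk (by omega))
  rw [Finset.sum_range_succ, add_sub_cancel_left, ← Finset.sum_range_succ] at h
  exact h

theorem volume_levelBox_inr (hk : 1 ≤ p.k) (j : ℕ) (e : Fin 3 × Sym2 V) :
    volume.real (levelBox p j (.inr (.inr e))) = p.weight j / √p.k := by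
  have := Params.one_le_sqrt_k hk
  have h2 := Params.weight_pos hk j
  exact volume_coe_lt (by positivity) ((div_le_one (by positivity)).mpr (Params.weight_le_sqrt j))

theorem volume_levelBox_pos (hk : 1 ≤ p.k) {j : ℕ} (hj : j ≤ p.top) (i : Idx V) :
    0 < volume.real (levelBox p j i) := by
  have h1 := Params.one_le_sqrt_k hk
  have h2 := Params.weight_pos hk j
  rcases i with i | i | i
  · rw [volume_levelBox_inl hk]; positivity
  · rw [volume_levelBox_mid hk hj]; positivity
  · rw [volume_levelBox_inr hk]; positivity

theorem prod_starSet (i : Fin 3) (t : Finset V) (v : V) (H : Finset V) (f : Idx V → ℝ) :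
    ∏ x ∈ starSet i t v H, f x = (∏ x ∈ t.erase v, f (.inl (i, x))) *
      ((∏ x ∈ H, f (.inr (.inl x))) * ∏ x ∈ t.erase v, f (.inr (.inr (i, s(v, x))))) := by
  rw [starSet, Finset.prod_disjSum, Finset.prod_disjSum, Finset.prod_product, Finset.prod_product,
    Finset.prod_singleton, Finset.prod_singleton, Finset.prod_image]
  intro x hx y hy hxy
  exact Sym2.congr_right.mp hxy

theorem prod_lightSet (t : Finset V) (f : Idx V → ℝ) :
    ∏ x ∈ lightSet t, f x = ∏ x ∈ t, f (.inl (0, x)) := by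
  rw [lightSet, Finset.prod_disjSum, Finset.prod_product, Finset.prod_singleton]
  simp

theorem forall_starSet (i : Fin 3) (t : Finset V) (v : V) (H : Finset V) (P : Idx V → Prop) :
    (∀ x ∈ starSet i t v H, P x) ↔ (∀ x ∈ H, P (.inr (.inl x))) ∧
      ∀ x ∈ t, x ≠ v → P (.inl (i, x)) ∧ P (.inr (.inr (i, s(v, x)))) := by
  simp only [starSet, Sum.forall, Finset.inl_mem_disjSum, Finset.inr_mem_disjSum,
    Finset.mem_product, Finset.mem_singleton, Prod.forall, Finset.mem_erase, Finset.mem_image]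
  constructor
  · rintro ⟨h1, h2, h3⟩
    exact ⟨h2, fun x hx hxv => ⟨h1 i x ⟨rfl, hxv, hx⟩, h3 i _ ⟨rfl, x, ⟨hxv, hx⟩, rfl⟩⟩⟩
  · rintro ⟨h1, h2⟩
    refine ⟨?_, h1, ?_⟩
    · rintro _ x ⟨rfl, hxv, hx⟩; exact (h2 x hx hxv).1
    · rintro _ _ ⟨rfl, x, ⟨hxv, hx⟩, rfl⟩; exact (h2 x hx hxv).2

theorem forall_lightSet (t : Finset V) (P : Idx V → Prop) :
    (∀ x ∈ lightSet t, P x) ↔ ∀ x ∈ t, P (.inl (0, x)) := by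
  simp only [lightSet, Sum.forall, Finset.inl_mem_disjSum, Finset.inr_mem_disjSum,
    Finset.mem_product, Finset.mem_singleton, Prod.forall, Finset.notMem_empty]
  constructor
  · intro h x hx; exact h.1 0 x ⟨rfl, hx⟩
  · intro h; exact ⟨by rintro _ x ⟨rfl, hx⟩; exact h x hx, by simp⟩

theorem inl_mem_starSet {i a : Fin 3} {t : Finset V} {v x : V} {H : Finset V} :
    (Sum.inl (a, x) : Idx V) ∈ starSet i t v H ↔ a = i ∧ x ≠ v ∧ x ∈ t := by
  simp only [starSet, Finset.inl_mem_disjSum, Finset.mem_product, Finset.mem_singleton,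
    Finset.mem_erase]

theorem mid_mem_starSet {i : Fin 3} {t : Finset V} {v x : V} {H : Finset V} :
    (Sum.inr (Sum.inl x) : Idx V) ∈ starSet i t v H ↔ x ∈ H := by
  simp [starSet]

theorem inr_mem_starSet {i a : Fin 3} {t : Finset V} {v : V} {e : Sym2 V} {H : Finset V} :
    (Sum.inr (Sum.inr (a, e)) : Idx V) ∈ starSet i t v H ↔
      a = i ∧ ∃ x ∈ t, x ≠ v ∧ s(v, x) = e := by
  simp only [starSet, Finset.inr_mem_disjSum, Finset.mem_product, Finset.mem_singleton,
    Finset.mem_erase, Finset.mem_image, and_assoc, and_left_comm]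

theorem inl_mem_lightSet {a : Fin 3} {t : Finset V} {x : V} :
    (Sum.inl (a, x) : Idx V) ∈ lightSet t ↔ a = 0 ∧ x ∈ t := by
  simp only [lightSet, Finset.inl_mem_disjSum, Finset.mem_product, Finset.mem_singleton]

/-- The value of a normalised star indicator. -/
theorem boxFun_star (hk : 1 ≤ p.k) {j : ℕ} (hj : j ≤ p.top) {t : Finset V} (ht : t.card = 3)
    {v : V} (hv : v ∈ t) (s : Seed V) :
    boxFun (starSet 0 t v {v}) (levelBox p j) s =
      if hEq p s v j ∧ ∀ x ∈ t, x ≠ v → cBit p s x ∧ rC s s(v, x) < p.weight j / √p.k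
      then p.k ^ 2 / p.weight j else 0 := by
  have h1 := Params.one_le_sqrt_k hk
  have h2 := Params.weight_pos hk j
  have hc : (t.erase v).card = 2 := by rw [Finset.card_erase_of_mem hv, ht]
  rw [boxFun_eq_ite]
  refine if_congr ?_ ?_ rfl
  · rw [forall_starSet]
    simp only [Finset.mem_singleton, forall_eq, levelBox, Set.mem_ofPred_eq, hEq, cBit, rC, hj,
      true_and]
  · rw [prod_starSet]
    simp only [volume_levelBox_inl hk, volume_levelBox_mid hk hj, volume_levelBox_inr hk,
      Finset.prod_const, hc, Finset.card_singleton, pow_one, one_div, inv_inv, inv_div, div_pow]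
    rw [Real.sq_sqrt (by linarith)]
    field_simp

theorem boxFun_light (hk : 1 ≤ p.k) {t : Finset V} (ht : t.card = 3) (s : Seed V) :
    boxFun (lightSet t) (levelBox p 0) s =
      if ∀ x ∈ t, cBit p s x then p.k ^ (3 / 2 : ℝ) else 0 := by
  rw [boxFun_eq_ite]
  refine if_congr ?_ ?_ rfl
  · rw [forall_lightSet]
    rfl
  · rw [prod_lightSet]
    simp only [volume_levelBox_inl hk, Finset.prod_const, ht, one_div, inv_inv]
    rw [Real.sqrt_eq_rpow, ← Real.rpow_natCast, ← Real.rpow_mul (by linarith)]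
    norm_num

/-- An upper bound for the correlation of two boxes. -/
theorem integral_box_mul_le [Fintype V] (hk : 1 ≤ p.k) {j j' : ℕ} (hj : j ≤ p.top) (hj' : j' ≤ p.top)
    (S S' : Finset (Idx V)) :
    ∫ s, boxFun S (levelBox p j) s * boxFun S' (levelBox p j') s ∂cube (Idx V) ≤
      ∏ i ∈ S, if i ∈ S' then (volume.real (levelBox p j i))⁻¹ else 1 :=
  integral_boxFun_mul_le _ (fun _ _ => measurableSet_levelBox _ _)
    (fun _ _ => volume_levelBox_pos hk hj _) (fun _ _ => measurableSet_levelBox _ _)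
    (fun _ _ => volume_levelBox_pos hk hj' _) fun _ _ _ => le_rfl

/-- Each further common vertex shares a vertex bit and a pair value, with inverse probabilities `√k`
and `√k / w_j`. The set `H` is empty for the first pass and `{v}` for the second, where the shared
level of `v` costs the factor `w_j`. -/
theorem integral_star_mul_star_le [Fintype V] (hk : 1 ≤ p.k) {j : ℕ} (hj : j ≤ p.top) (i : Fin 3)
    (t t' : Finset V) (v : V) (H : Finset V) :
    ∫ s, boxFun (starSet i t v H) (levelBox p j) s * boxFun (starSet i t' v H) (levelBox p j) s
        ∂cube (Idx V) ≤
      p.weight j ^ H.card * (p.k / p.weight j) ^ ((t ∩ t').erase v).card := by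
  have h1 := Params.one_le_sqrt_k hk
  have h2 := Params.weight_pos hk j
  refine (integral_box_mul_le hk hj hj _ _).trans (le_of_eq ?_)
  rw [prod_starSet]
  simp only [volume_levelBox_inl hk, volume_levelBox_mid hk hj, volume_levelBox_inr hk,
    inl_mem_starSet, mid_mem_starSet, inr_mem_starSet, true_and]
  have hH : (∏ x ∈ H, if x ∈ H then (1 / p.weight j)⁻¹ else 1) = p.weight j ^ H.card := by
    rw [Finset.prod_congr rfl fun x hx => if_pos hx]
    simp
  have hE : ∀ x ∈ t.erase v, (∃ y ∈ t', y ≠ v ∧ s(v, y) = s(v, x)) ↔ x ≠ v ∧ x ∈ t' := by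
    intro x hx
    constructor
    · rintro ⟨y, hy, hyv, hxy⟩
      have : y = x := Sym2.congr_right.mp hxy
      exact this ▸ ⟨hyv, hy⟩
    · rintro ⟨h, h'⟩; exact ⟨x, h', h, rfl⟩
  have hF : (t.erase v).filter (fun x => x ≠ v ∧ x ∈ t') = (t ∩ t').erase v := by
    ext x; simp; tauto
  rw [hH, Finset.prod_congr rfl fun x hx => if_congr (hE x hx) rfl rfl, ← Finset.prod_filter,
    ← Finset.prod_filter, hF, Finset.prod_const, Finset.prod_const, mul_left_comm, ← mul_pow]
  congr 2
  rw [one_div, inv_inv, inv_div, ← mul_div_assoc, Real.mul_self_sqrt (by linarith)]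

/-- With distinct centres the level hashes are independent, and the only pair value that can be
shared is that of `vv'`. A vertex `x` therefore shares either its bit (when `x ≠ v'`) or the pair
value (when `x = v'`), never both, and each costs at most `√k`. -/
theorem integral_star_mul_star_le_of_ne [Fintype V] (hk : 1 ≤ p.k) {j j' : ℕ} (hj : j ≤ p.top)
    (hj' : j' ≤ p.top) (t t' : Finset V) {v v' : V} (hv : v ≠ v') :
    ∫ s, boxFun (starSet 0 t v {v}) (levelBox p j) s *
        boxFun (starSet 0 t' v' {v'}) (levelBox p j') s ∂cube (Idx V) ≤
      √p.k ^ ((t.erase v).filter fun x =>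
        (x ∈ t' ∧ x ≠ v') ∨ (x = v' ∧ v ∈ t')).card := by
  have h1 := Params.one_le_sqrt_k hk
  have h2 := Params.one_le_weight hk j
  refine (integral_box_mul_le hk hj hj' _ _).trans ?_
  rw [prod_starSet]
  simp only [volume_levelBox_inl hk, volume_levelBox_mid hk hj, volume_levelBox_inr hk,
    inl_mem_starSet, mid_mem_starSet, inr_mem_starSet, true_and, Finset.prod_singleton,
    Finset.mem_singleton, hv, if_false, one_mul, ← Finset.prod_mul_distrib]
  rw [Finset.card_filter, ← Finset.prod_pow_eq_pow_sum]
  refine Finset.prod_le_prod (fun x _ => ?_) fun x hx => ?_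
  · refine mul_nonneg ?_ ?_ <;> split_ifs <;> positivity
  · have hE : (∃ y ∈ t', y ≠ v' ∧ s(v', y) = s(v, x)) ↔ (x = v' ∧ v ∈ t') := by
      constructor
      · rintro ⟨y, hy, hyv, hxy⟩
        rw [Sym2.eq_iff] at hxy
        rcases hxy with ⟨h, _⟩ | ⟨h, h'⟩
        · exact absurd h.symm hv
        · exact ⟨h.symm, h' ▸ hy⟩
      · rintro ⟨rfl, h⟩
        exact ⟨v, h, hv, Sym2.eq_swap⟩
    rw [if_congr hE rfl rfl]
    have h3 : (p.weight j / √p.k)⁻¹ ≤ √p.k := by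
      rw [inv_div]; exact div_le_self (by positivity) h2
    by_cases hxv : x = v'
    · by_cases hvt : v ∈ t'
      · simp [hxv, hvt]
        simpa using h3
      · simp [hxv, hvt]
    · by_cases hxt : x ∈ t' <;> simp [hxv, hxt]

theorem integral_light_mul_light_le [Fintype V] (hk : 1 ≤ p.k) (t t' : Finset V) :
    ∫ s, boxFun (lightSet t) (levelBox p 0) s * boxFun (lightSet t') (levelBox p 0) s
        ∂cube (Idx V) ≤ √p.k ^ (t ∩ t').card := by
  refine (integral_box_mul_le hk (Nat.zero_le _) (Nat.zero_le _) _ _).trans (le_of_eq ?_)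
  rw [prod_lightSet]
  simp only [volume_levelBox_inl hk, inl_mem_lightSet, true_and]
  rw [← Finset.prod_filter, Finset.filter_mem_eq_inter, Finset.prod_const, one_div, inv_inv]

theorem integral_light_mul_star_le [Fintype V] (hk : 1 ≤ p.k) {j : ℕ} (hj : j ≤ p.top)
    (t t' : Finset V) (v : V) :
    ∫ s, boxFun (lightSet t) (levelBox p 0) s * boxFun (starSet 0 t' v {v}) (levelBox p j) s
        ∂cube (Idx V) ≤ √p.k ^ ((t ∩ t').erase v).card := by
  refine (integral_box_mul_le hk (Nat.zero_le _) hj _ _).trans (le_of_eq ?_)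
  rw [prod_lightSet]
  simp only [volume_levelBox_inl hk, inl_mem_starSet, true_and]
  have hF : t.filter (fun x => x ≠ v ∧ x ∈ t') = (t ∩ t').erase v := by
    ext x; simp; tauto
  rw [← Finset.prod_filter, hF, Finset.prod_const, one_div, inv_inv]

end Basic

end Items

section Fixed

open scoped Classical

/-! ### The estimate for a fixed classification of the vertices -/

section Coef

variable {V : Type*}

/-- The weight with which the triangle `t` is counted as a light triangle (`none`) or at the vertex
`v` (`some v`) if `σ` is the scale function. -/
noncomputable def coef (σ : V → WithTop ℕ) (t : Finset V) : Option V → ℝ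
  | none => if ∀ x ∈ t, σ x = ⊤ then 1 else 0
  | some v => if v ∈ t ∧ σ v ≠ ⊤ then 1 / ((t.filter fun x => σ x ≠ ⊤).card : ℝ) else 0

/-- The coordinates used by an item. -/
noncomputable def itemSet (t : Finset V) : Option V → Finset (Idx V)
  | none => lightSet t
  | some v => starSet 0 t v {v}

/-- The level used by an item. -/
def lev (σ : V → WithTop ℕ) : Option V → ℕ
  | none => 0
  | some v => (σ v).untopD 0

/-- The estimate of the size of the set `𝒢` of triangles if `σ` is the scale function. -/
noncomputable def estAt [Fintype V] (p : Params) (σ : V → WithTop ℕ) (𝒢 : Finset (Finset V))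
    (s : Seed V) : ℝ :=
  ∑ t ∈ 𝒢, ∑ o : Option V, coef σ t o * boxFun (itemSet t o) (levelBox p (lev σ o)) s

variable {σ : V → WithTop ℕ} {t : Finset V}

theorem coef_nonneg (o : Option V) : 0 ≤ coef σ t o := by
  cases o <;> simp only [coef] <;> split_ifs <;> positivity

theorem coef_some_le (v : V) : coef σ t (some v) ≤ if v ∈ t ∧ σ v ≠ ⊤ then 1 else 0 := by
  simp only [coef]
  split_ifs with h
  · have : 1 ≤ (t.filter fun x => σ x ≠ ⊤).card :=
      Finset.card_pos.mpr ⟨v, Finset.mem_filter.mpr h⟩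
    have h1 : (1 : ℝ) ≤ ((t.filter fun x => σ x ≠ ⊤).card : ℝ) := by exact_mod_cast this
    exact (div_le_one (by positivity)).mpr h1
  · exact le_rfl

/-- Unbiasedness rests on this: an all-light triangle has its whole weight at `none`, any other is
shared evenly by its non-light vertices. -/
theorem sum_coef [Fintype V] (σ : V → WithTop ℕ) (t : Finset V) : ∑ o, coef σ t o = 1 := by
  rw [Fintype.sum_option]
  simp only [coef]
  rw [← Finset.sum_filter]
  have hF : (Finset.univ.filter fun v => v ∈ t ∧ σ v ≠ ⊤) = t.filter fun x => σ x ≠ ⊤ := by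
    ext x; simp
  rw [hF, Finset.sum_const, nsmul_eq_mul]
  split_ifs with h
  · rw [Finset.filter_eq_empty_iff.mpr fun x hx => not_not.mpr (h x hx)]
    simp
  · have : (t.filter fun x => σ x ≠ ⊤).card ≠ 0 := by
      rw [Finset.card_ne_zero]
      push Not at h
      obtain ⟨x, hx, hx'⟩ := h
      exact ⟨x, Finset.mem_filter.mpr ⟨hx, hx'⟩⟩
    have h1 : ((t.filter fun x => σ x ≠ ⊤).card : ℝ) ≠ 0 := by exact_mod_cast this
    field_simp
    simp

theorem lev_le_top {p : Params} (hσ : ∀ v, σ v ≠ ⊤ → (σ v).untopD 0 ≤ p.top)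
    (o : Option V) : lev σ o ≤ p.top := by
  rcases o with _ | v
  · exact Nat.zero_le _
  · by_cases h : σ v = ⊤
    · simp [lev, h]
    · exact hσ v h

end Coef

variable {V : Type*} [Fintype V] {p : Params}

theorem scale_untopD_le (s : Seed V) (G : SimpleGraph V) (v : V) (h : scale p s G v ≠ ⊤) :
    (scale p s G v).untopD 0 ≤ p.top := by
  obtain ⟨j, hj, h'⟩ := exists_scale_eq_coe h
  rw [h']
  exact hj

/-- The factors `k^(3/2)` and `k² / w_j` of the algorithm are exactly the inverse measures of the
boxes, so its output is a combination of functions of mean one once `σ` is frozen. -/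
theorem estimate_eq_estAt (hk : 1 ≤ p.k) (s : Seed V) (G : SimpleGraph V) :
    estimate p s G = estAt p (scale p s G) (triangles G) s := by
  unfold estimate estAt
  simp only [Fintype.sum_option]
  rw [Finset.sum_add_distrib]
  refine congrArg₂ (· + ·) ?_ ?_
  · unfold estLight
    rw [mul_comm, ← nsmul_eq_mul, ← Finset.sum_const, Finset.sum_filter]
    refine Finset.sum_congr rfl fun t ht => ?_
    have h3 := card_of_mem_triangles ht
    simp only [coef, itemSet, lev, boxFun_light hk h3]
    by_cases h1 : ∀ x ∈ t, scale p s G x = ⊤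
    · by_cases h2 : ∀ x ∈ t, cBit p s x
      · rw [if_pos h1, if_pos h2, if_pos fun x hx => ⟨h1 x hx, h2 x hx⟩, one_mul]
      · rw [if_neg h2, mul_zero, if_neg fun h => h2 fun x hx => (h x hx).2]
    · rw [if_neg h1, zero_mul, if_neg fun h => h1 fun x hx => (h x hx).1]
  · unfold estHeavy
    rw [Finset.sum_comm (s := triangles G)]
    refine Finset.sum_congr rfl fun v _ => ?_
    by_cases hv : scale p s G v = ⊤
    · simp [hv, coef]
    obtain ⟨j, hj, hvj⟩ := exists_scale_eq_coe hv
    rw [Finset.sum_eq_single j]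
    · unfold vertexEst
      have hl : lev (scale p s G) (some v) = j := by rw [lev, hvj]; rfl
      by_cases h1 : hEq p s v j
      · rw [if_pos ⟨hvj, h1⟩, Finset.sum_filter]
        refine Finset.sum_congr rfl fun t ht => ?_
        simp only [coef, itemSet, hl, hv, ne_eq, not_false_eq_true, and_true]
        by_cases hvt : v ∈ t
        · rw [boxFun_star hk hj (card_of_mem_triangles ht) hvt]
          simp only [hvt, true_and, if_true, h1]
          split_ifs
          · rw [mul_comm]
          · rw [mul_zero]
        · simp [hvt]
      · rw [if_neg fun h => h1 h.2]
        refine (Finset.sum_eq_zero fun t ht => ?_).symm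
        simp only [coef, itemSet, hl]
        by_cases hvt : v ∈ t
        · rw [boxFun_star hk hj (card_of_mem_triangles ht) hvt,
            if_neg (show ¬ (hEq p s v j ∧ _) from fun h => h1 h.1), mul_zero]
        · simp [hvt]
    · intro j' _ hj'
      rw [if_neg]
      rintro ⟨h, -⟩
      rw [hvj] at h
      exact hj' (WithTop.coe_injective h).symm
    · intro h
      exact absurd (Finset.mem_range.mpr (Nat.lt_succ_of_le hj)) h

/-- A bound for the correlation of two items. -/
noncomputable def corr (p : Params) (D : ℝ) (σ : V → WithTop ℕ) (x y : Finset V × Option V) : ℝ :=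
  (if 2 ≤ (x.1 ∩ y.1).card then p.k else 0) + (if x.1 = y.1 then D else 0) +
    (if x.2 = y.2 ∧ x.2 ≠ none then p.weight (lev σ x.2) else 0) +
    √p.k * ∑ u ∈ x.1 ∩ y.1, ((if σ u = ⊤ then 1 else 0) +
      (if ∃ v, y.2 = some v ∧ v ≠ u then 1 else 0))

/-- The cases follow the number of common vertices. Equal triangles cost at most `D`, a common edge
costs `k`. A single common vertex costs the weight if it is the centre of both stars, and otherwise
at most `√k`; this is charged to a light common vertex or to one that is not the second centre. The
nonvanishing of the coefficients ensures that vertices of light items are light and that centres are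
non-light vertices of their triangles. -/
theorem integral_items_le {D : ℝ} (hk : 1 ≤ p.k) (hD : √p.k ^ 3 ≤ D)
    (hD' : ∀ j, p.k ^ 2 / p.weight j ≤ D) {σ : V → WithTop ℕ}
    (hσ : ∀ v, σ v ≠ ⊤ → (σ v).untopD 0 ≤ p.top) {t t' : Finset V} (ht : t.card = 3)
    (ht' : t'.card = 3) {o o' : Option V} (ho : coef σ t o ≠ 0) (ho' : coef σ t' o' ≠ 0) :
    ∫ s, boxFun (itemSet t o) (levelBox p (lev σ o)) s *
      boxFun (itemSet t' o') (levelBox p (lev σ o')) s ∂cube (Idx V) ≤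
        1 + corr p D σ (t, o) (t', o') := by
  have hs := Params.one_le_sqrt_k hk
  have hss : √p.k ^ 2 = p.k := Real.sq_sqrt (by linarith)
  have hD0 : 0 ≤ D := le_trans (by positivity) hD
  set c := (t ∩ t').card with hc
  have hc3 : c ≤ 3 := ht ▸ Finset.card_le_card Finset.inter_subset_left
  have hceq : c = 3 → t = t' := by
    intro h
    have h1 : t ∩ t' = t := Finset.eq_of_subset_of_card_le Finset.inter_subset_left (by omega)
    have h2 : t ∩ t' = t' := Finset.eq_of_subset_of_card_le Finset.inter_subset_right (by omega)
    exact h1.symm.trans h2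
  have hw := fun j => Params.weight_pos hk j
  set L : ℝ := ∑ u ∈ t ∩ t', (if σ u = ⊤ then 1 else 0) with hL
  set M : ℝ := ∑ u ∈ t ∩ t', (if ∃ v, o' = some v ∧ v ≠ u then 1 else 0) with hM
  have hL0 : 0 ≤ L := Finset.sum_nonneg fun _ _ => by positivity
  have hM0 : 0 ≤ M := Finset.sum_nonneg fun _ _ => by positivity
  have hcorr : corr p D σ (t, o) (t', o') = (if 2 ≤ c then p.k else 0) + (if t = t' then D else 0) +
    (if o = o' ∧ o ≠ none then p.weight (lev σ o) else 0) + √p.k * (L + M) := by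
    simp only [corr, ← hc, Finset.sum_add_distrib]
    rfl
  have hX0 : (0 : ℝ) ≤ if 2 ≤ c then p.k else 0 := by split_ifs <;> linarith
  have hY0 : (0 : ℝ) ≤ if t = t' then D else 0 := by split_ifs <;> linarith
  have hZ0 : (0 : ℝ) ≤ if o = o' ∧ o ≠ none then p.weight (lev σ o) else 0 := by
    split_ifs
    · exact (hw _).le
    · exact le_rfl
  have hS0 : 0 ≤ √p.k * L := by positivity
  have hS1 : 0 ≤ √p.k * M := by positivity
  rw [hcorr]
  have hlight : ∀ u, u ∈ t ∩ t' → (∀ x ∈ t ∩ t', σ x = ⊤) → 1 ≤ L := by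
    intro u hu hall
    rw [hL, Finset.sum_congr rfl fun x hx => if_pos (hall x hx)]
    simp only [Finset.sum_const, nsmul_eq_mul, mul_one]
    exact_mod_cast Finset.card_pos.mpr ⟨u, hu⟩
  have hpow : (∀ x ∈ t ∩ t', σ x = ⊤) → √p.k ^ c ≤ 1 + ((if 2 ≤ c then p.k else 0) +
      (if c = 3 then D else 0) + √p.k * L) := by
    intro hall
    have : c = 0 ∨ c = 1 ∨ c = 2 ∨ c = 3 := by omega
    rcases this with h | h | h | h
    · rw [h]; simp; positivity
    · obtain ⟨u, hu⟩ := Finset.card_pos.mp (show 0 < (t ∩ t').card by omega)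
      have := hlight u hu hall
      rw [h]; norm_num
      nlinarith
    · rw [h, hss]; norm_num; linarith
    · rw [h]; norm_num; linarith
  rcases o with _ | v <;> rcases o' with _ | v'
  · have hall : ∀ x ∈ t, σ x = ⊤ := by
      by_contra h; exact ho (if_neg h)
    have h1 := integral_light_mul_light_le hk t t'
    have h2 := hpow fun x hx => hall x (Finset.mem_of_mem_inter_left hx)
    have h3 : (if c = 3 then D else 0) ≤ if t = t' then D else 0 := by
      by_cases h : c = 3
      · rw [if_pos h, if_pos (hceq h)]
      · rw [if_neg h]; exact hY0
    simp only [itemSet, ne_eq, not_true_eq_false, and_false, if_false, add_zero]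
    exact h1.trans (by linarith)
  · have hall : ∀ x ∈ t, σ x = ⊤ := by
      by_contra h; exact ho (if_neg h)
    have hv' : v' ∈ t' ∧ σ v' ≠ ⊤ := by
      by_contra h; exact ho' (if_neg h)
    have h1 := integral_light_mul_star_le hk (lev_le_top hσ (some v')) t t' v'
    -- A non-light centre cannot lie in an all-light triangle, so the two triangles differ and no
    -- common vertex is lost by erasing the centre.
    have hnv : v' ∉ t := fun h => hv'.2 (hall v' h)
    rw [Finset.erase_eq_of_notMem fun h => hnv (Finset.mem_of_mem_inter_left h), ← hc] at h1
    have h2 := hpow fun x hx => hall x (Finset.mem_of_mem_inter_left hx)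
    have h3 : c ≠ 3 := fun h => hnv (hceq h ▸ hv'.1)
    rw [if_neg h3] at h2
    simp only [itemSet]
    exact h1.trans (by linarith)
  · have hall : ∀ x ∈ t', σ x = ⊤ := by
      by_contra h; exact ho' (if_neg h)
    have hv : v ∈ t ∧ σ v ≠ ⊤ := by
      by_contra h; exact ho (if_neg h)
    have h1 := integral_light_mul_star_le hk (lev_le_top hσ (some v)) t' t v
    have hnv : v ∉ t' := fun h => hv.2 (hall v h)
    rw [Finset.erase_eq_of_notMem fun h => hnv (Finset.mem_of_mem_inter_left h),
      Finset.inter_comm, ← hc] at h1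
    have h2 := hpow fun x hx => hall x (Finset.mem_of_mem_inter_right hx)
    have h3 : c ≠ 3 := fun h => hnv (hceq h ▸ hv.1)
    rw [if_neg h3] at h2
    simp only [itemSet]
    simp only [mul_comm (boxFun (lightSet t') _ _)] at h1
    exact h1.trans (by linarith)
  · have hv : v ∈ t ∧ σ v ≠ ⊤ := by
      by_contra h; exact ho (if_neg h)
    have hv' : v' ∈ t' ∧ σ v' ≠ ⊤ := by
      by_contra h; exact ho' (if_neg h)
    by_cases hvv : v = v'
    · subst hvv
      have h1 := integral_star_mul_star_le hk (lev_le_top hσ (some v)) 0 t t' v {v}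
      have hvi : v ∈ t ∩ t' := Finset.mem_inter.mpr ⟨hv.1, hv'.1⟩
      rw [Finset.card_erase_of_mem hvi, ← hc, Finset.card_singleton, pow_one] at h1
      have hc1 : 1 ≤ c := Finset.card_pos.mpr ⟨v, hvi⟩
      have hw0 := hw (lev σ (some v))
      have hDw := hD' (lev σ (some v))
      simp only [itemSet]
      refine h1.trans ?_
      simp only [ne_eq, reduceCtorEq, not_false_eq_true, and_true, if_true] at hZ0 ⊢
      have : c = 1 ∨ c = 2 ∨ c = 3 := by omega
      rcases this with h | h | h
      · rw [h, Nat.sub_self, pow_zero, mul_one]; rw [h] at hX0; linarith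
      · rw [h]
        have : p.weight (lev σ (some v)) * (p.k / p.weight (lev σ (some v))) ^ (2 - 1) = p.k := by
          norm_num; field_simp
        rw [this]; norm_num; linarith
      · rw [if_pos (hceq h)]
        have : p.weight (lev σ (some v)) * (p.k / p.weight (lev σ (some v))) ^ (c - 1)
            = p.k ^ 2 / p.weight (lev σ (some v)) := by
          rw [h]; norm_num; field_simp
        rw [this]; linarith
    · have h1 := integral_star_mul_star_le_of_ne hk (lev_le_top hσ (some v))
        (lev_le_top hσ (some v')) t t' hvv
      simp only [itemSet]
      refine h1.trans ?_
      set F := (t.erase v).filter fun x => (x ∈ t' ∧ x ≠ v') ∨ (x = v' ∧ v ∈ t') with hF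
      by_cases h2 : 2 ≤ c
      · have hF2 : F.card ≤ 2 := by
          refine (Finset.card_filter_le _ _).trans ?_
          rw [Finset.card_erase_of_mem hv.1, ht]
        have h3 : √p.k ^ F.card ≤ √p.k ^ 2 := pow_le_pow_right₀ hs hF2
        rw [hss] at h3
        rw [if_pos h2]
        linarith
      · have hFM : (F.card : ℝ) ≤ M := by
          rw [hM, ← Finset.sum_filter, Finset.sum_const, nsmul_eq_mul, mul_one]
          norm_cast
          refine Finset.card_le_card fun x hx => ?_
          simp only [hF, Finset.mem_filter, Finset.mem_erase] at hx
          rcases hx.2 with h | h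
          · exact Finset.mem_filter.mpr
              ⟨Finset.mem_inter.mpr ⟨hx.1.2, h.1⟩, v', rfl, fun h' => h.2 h'.symm⟩
          -- If the pair `vv'` were shared, both centres would be common vertices, contrary to there
          -- being at most one.
          · refine absurd (Finset.one_lt_card.mpr ⟨v, ?_, v', ?_, hvv⟩) h2
            · exact Finset.mem_inter.mpr ⟨hv.1, h.2⟩
            · exact Finset.mem_inter.mpr ⟨h.1 ▸ hx.1.2, hv'.1⟩
        have hFc : F.card ≤ c := by
          have h4 : (F.card : ℝ) ≤ c := by
            refine hFM.trans ?_
            rw [hM, ← Finset.sum_filter, Finset.sum_const, nsmul_eq_mul, mul_one]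
            exact_mod_cast Finset.card_filter_le _ _
          exact_mod_cast h4
        have : F.card = 0 ∨ F.card = 1 := by omega
        rcases this with h | h
        · rw [h, pow_zero]; nlinarith
        · rw [h] at hFM ⊢
          push_cast at hFM
          rw [pow_one]; nlinarith

end Fixed

/-! ### Variance of the estimate for a fixed classification -/

section FixedVariance

open scoped Classical

variable {V : Type*} [Fintype V] {p : Params}

/-- The number of non-light vertices. -/
noncomputable def heavyCount (σ : V → WithTop ℕ) : ℕ := (Finset.univ.filter fun v => σ v ≠ ⊤).card

/-- The factor of `(number of triangles at v)²` in the variance. -/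
noncomputable def vertexCost (p : Params) (σ : V → WithTop ℕ) (v : V) : ℝ :=
  if σ v = ⊤ then √p.k else p.weight (lev σ (some v))

/-- A bound for the variance of the estimate for a fixed scale function. -/
noncomputable def varBound (p : Params) (D dE : ℝ) (σ : V → WithTop ℕ)
    (𝒢 : Finset (Finset V)) : ℝ :=
  (6 * p.k * dE + D + 3 * √p.k * dE * heavyCount σ) * 𝒢.card +
    ∑ v, vertexCost p σ v * ((𝒢.filter fun t => v ∈ t).card : ℝ) ^ 2

/-- The coefficients form a probability distribution over the items of a triangle, so the terms that
ignore the items pass unchanged. A common centre `u` must lie in both triangles and has coefficients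
at most one. Together with the `√k` for light common vertices this gives `vertexCost`. -/
theorem sum_coef_corr_le {D : ℝ} (hk : 1 ≤ p.k) (σ : V → WithTop ℕ) (t t' : Finset V) :
    ∑ o, ∑ o', coef σ t o * coef σ t' o' * corr p D σ (t, o) (t', o') ≤
      (if 2 ≤ (t ∩ t').card then p.k else 0) + (if t = t' then D else 0) +
      ∑ u ∈ t ∩ t', (vertexCost p σ u +
        √p.k * ∑ v, if (v ≠ u ∧ v ∈ t') ∧ σ v ≠ ⊤ then 1 else 0) := by
  set X : ℝ := (if 2 ≤ (t ∩ t').card then p.k else 0) + (if t = t' then D else 0) +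
    √p.k * ∑ u ∈ t ∩ t', (if σ u = ⊤ then 1 else 0) with hX
  have hsplit : ∀ o o', coef σ t o * coef σ t' o' * corr p D σ (t, o) (t', o') =
      coef σ t o * coef σ t' o' * X +
      coef σ t o * coef σ t' o' * (if o = o' ∧ o ≠ none then p.weight (lev σ o) else 0) +
      coef σ t o * (coef σ t' o' *
        (√p.k * ∑ u ∈ t ∩ t', if ∃ v, o' = some v ∧ v ≠ u then 1 else 0)) := by
    intro o o'
    simp only [corr, hX, Finset.sum_add_distrib]
    ring
  simp only [hsplit, Finset.sum_add_distrib]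
  have h1 : ∑ o, ∑ o', coef σ t o * coef σ t' o' * X = X := by
    simp only [← Finset.sum_mul]
    rw [← Finset.sum_mul_sum, sum_coef, sum_coef, one_mul, one_mul]
  have h2 : ∑ o, ∑ o', coef σ t o * coef σ t' o' *
      (if o = o' ∧ o ≠ none then p.weight (lev σ o) else 0) ≤
      ∑ u ∈ t ∩ t', if σ u = ⊤ then 0 else p.weight (lev σ (some u)) := by
    rw [Fintype.sum_option]
    simp only [ne_eq, not_true_eq_false, and_false, if_false, mul_zero, Finset.sum_const_zero,
      zero_add, reduceCtorEq, not_false_eq_true, and_true, mul_ite, Finset.sum_ite_eq,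
      Finset.mem_univ, if_true]
    rw [← Finset.sum_subset (Finset.subset_univ (t ∩ t'))]
    · refine Finset.sum_le_sum fun u _ => ?_
      have hw := Params.weight_pos hk (lev σ (some u))
      split_ifs with h
      · have : coef σ t (some u) = 0 := if_neg fun h' => h'.2 h
        rw [this]; simp
      · have h3 := coef_some_le (σ := σ) (t := t) u
        have h4 := coef_some_le (σ := σ) (t := t') u
        have h5 : coef σ t (some u) ≤ 1 := h3.trans (by split_ifs <;> norm_num)
        have h6 : coef σ t' (some u) ≤ 1 := h4.trans (by split_ifs <;> norm_num)
        have h7 := mul_le_one₀ h5 (coef_nonneg _) h6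
        nlinarith
    · intro u _ hu
      have : u ∉ t ∨ u ∉ t' := by
        by_contra h
        push Not at h
        exact hu (Finset.mem_inter.mpr h)
      rcases this with h | h
      · have : coef σ t (some u) = 0 := if_neg fun h' => h h'.1
        rw [this]; simp
      · have : coef σ t' (some u) = 0 := if_neg fun h' => h h'.1
        rw [this]; simp
  have h3 : ∑ o, ∑ o', coef σ t o * (coef σ t' o' *
        (√p.k * ∑ u ∈ t ∩ t', if ∃ v, o' = some v ∧ v ≠ u then 1 else 0)) ≤
      ∑ u ∈ t ∩ t', √p.k * ∑ v, if (v ≠ u ∧ v ∈ t') ∧ σ v ≠ ⊤ then 1 else 0 := by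
    simp only [← Finset.mul_sum]
    rw [← Finset.sum_mul, sum_coef, one_mul, Fintype.sum_option]
    simp only [reduceCtorEq, false_and, exists_false, if_false, Finset.sum_const_zero, mul_zero,
      zero_add, Option.some.injEq, exists_eq_left']
    have : ∀ v, coef σ t' (some v) * (√p.k * ∑ u ∈ t ∩ t', if v ≠ u then 1 else 0) ≤
        √p.k * ∑ u ∈ t ∩ t', if (v ≠ u ∧ v ∈ t') ∧ σ v ≠ ⊤ then 1 else 0 := by
      intro v
      rw [mul_left_comm, Finset.mul_sum]
      refine mul_le_mul_of_nonneg_left (Finset.sum_le_sum fun u _ => ?_) (Real.sqrt_nonneg _)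
      have h4 := coef_some_le (σ := σ) (t := t') v
      by_cases hvu : v = u
      · simp [hvu]
      · simp only [ne_eq, hvu, not_false_eq_true, if_true, mul_one, true_and]
        exact h4
    refine (Finset.sum_le_sum fun v _ => this v).trans (le_of_eq ?_)
    rw [← Finset.mul_sum, Finset.sum_comm]
  have h4 : ∀ u, vertexCost p σ u = √p.k * (if σ u = ⊤ then 1 else 0) +
      (if σ u = ⊤ then 0 else p.weight (lev σ (some u))) := by
    intro u; unfold vertexCost; split_ifs <;> simp
  rw [h1]
  simp only [h4, Finset.sum_add_distrib, ← Finset.mul_sum, hX] at h2 h3 ⊢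
  linarith

theorem integral_item (hk : 1 ≤ p.k) {σ : V → WithTop ℕ}
    (hσ : ∀ v, σ v ≠ ⊤ → (σ v).untopD 0 ≤ p.top) (t : Finset V) (o : Option V) :
    ∫ s, boxFun (itemSet t o) (levelBox p (lev σ o)) s ∂cube (Idx V) = 1 :=
  integral_boxFun (fun _ _ => measurableSet_levelBox _ _)
    fun _ _ => volume_levelBox_pos hk (lev_le_top hσ o) _

theorem integral_estAt (hk : 1 ≤ p.k) {σ : V → WithTop ℕ}
    (hσ : ∀ v, σ v ≠ ⊤ → (σ v).untopD 0 ≤ p.top) (𝒢 : Finset (Finset V)) :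
    ∫ s, estAt p σ 𝒢 s ∂cube (Idx V) = 𝒢.card := by
  have hb : ∀ t (o : Option V), BddMeas
      fun s => coef σ t o * boxFun (itemSet t o) (levelBox p (lev σ o)) s :=
    fun t o => BddMeas.const_mul _ (bddMeas_boxFun fun _ _ => measurableSet_levelBox _ _)
  unfold estAt
  rw [integral_finsetSum _ fun t _ => (BddMeas.sum fun o _ => hb t o).integrable _]
  have : ∀ t ∈ 𝒢, ∫ s, ∑ o : Option V, coef σ t o *
      boxFun (itemSet t o) (levelBox p (lev σ o)) s ∂cube (Idx V) = 1 := by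
    intro t _
    rw [integral_finsetSum _ fun o _ => (hb t o).integrable _]
    simp only [integral_const_mul, integral_item hk hσ, mul_one, sum_coef]
  rw [Finset.sum_congr rfl this]
  simp

/-- Two common vertices form one of the six ordered pairs of distinct vertices of `t`, and each pair
lies in at most `dE` triangles. -/
theorem sum_pair_le {dE : ℝ} {𝒢 : Finset (Finset V)} (h3 : ∀ t ∈ 𝒢, t.card = 3)
    (hE : ∀ u v, u ≠ v → ((𝒢.filter fun t => u ∈ t ∧ v ∈ t).card : ℝ) ≤ dE) {t : Finset V}
    (ht : t ∈ 𝒢) : ∑ t' ∈ 𝒢, (if 2 ≤ (t ∩ t').card then (1 : ℝ) else 0) ≤ 6 * dE := by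
  have h1 : ∀ t' ∈ 𝒢, (if 2 ≤ (t ∩ t').card then (1 : ℝ) else 0) ≤
      ∑ x ∈ t.offDiag, if x.1 ∈ t' ∧ x.2 ∈ t' then 1 else 0 := by
    intro t' _
    have hnn : ∀ x ∈ t.offDiag, (0 : ℝ) ≤ if x.1 ∈ t' ∧ x.2 ∈ t' then 1 else 0 := fun x _ => by
      positivity
    split_ifs with h
    · obtain ⟨x, hx, y, hy, hxy⟩ := Finset.one_lt_card.mp h
      rw [Finset.mem_inter] at hx hy
      have hm : (x, y) ∈ t.offDiag := Finset.mem_offDiag.mpr ⟨hx.1, hy.1, hxy⟩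
      refine le_trans ?_ (Finset.single_le_sum hnn hm)
      simp [hx.2, hy.2]
    · exact Finset.sum_nonneg hnn
  refine (Finset.sum_le_sum h1).trans ?_
  rw [Finset.sum_comm]
  have h2 : ∀ x ∈ t.offDiag, (∑ t' ∈ 𝒢, if x.1 ∈ t' ∧ x.2 ∈ t' then (1 : ℝ) else 0) ≤ dE := by
    intro x hx
    rw [← Finset.sum_filter, Finset.sum_const, nsmul_eq_mul, mul_one]
    exact hE _ _ (Finset.mem_offDiag.mp hx).2.2
  refine (Finset.sum_le_sum h2).trans (le_of_eq ?_)
  rw [Finset.sum_const, Finset.offDiag_card, h3 t ht, nsmul_eq_mul]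
  norm_num

theorem integral_estAt_sub_sq_le {D dE : ℝ} (hk : 1 ≤ p.k) (hD : √p.k ^ 3 ≤ D)
    (hD' : ∀ j, p.k ^ 2 / p.weight j ≤ D) {σ : V → WithTop ℕ}
    (hσ : ∀ v, σ v ≠ ⊤ → (σ v).untopD 0 ≤ p.top) {𝒢 : Finset (Finset V)}
    (h3 : ∀ t ∈ 𝒢, t.card = 3)
    (hE : ∀ u v, u ≠ v → ((𝒢.filter fun t => u ∈ t ∧ v ∈ t).card : ℝ) ≤ dE) :
    ∫ s, (estAt p σ 𝒢 s - 𝒢.card) ^ 2 ∂cube (Idx V) ≤ varBound p D dE σ 𝒢 := by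
  -- Items with coefficient zero are dropped because the correlation bound does not cover them.
  set P : Finset (Finset V × Option V) :=
    (𝒢 ×ˢ Finset.univ).filter fun x => coef σ x.1 x.2 ≠ 0 with hP
  have hsum : ∀ f : Finset V × Option V → ℝ,
      ∑ x ∈ P, coef σ x.1 x.2 * f x = ∑ t ∈ 𝒢, ∑ o, coef σ t o * f (t, o) := by
    intro f
    rw [← Finset.sum_product' 𝒢 Finset.univ (f := fun t o => coef σ t o * f (t, o)), hP]
    exact Finset.sum_filter_of_ne fun x _ hx h => hx (by rw [h, zero_mul])
  have hone : ∑ x ∈ P, coef σ x.1 x.2 = 𝒢.card := by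
    have := hsum fun _ => 1
    simp only [mul_one, sum_coef] at this
    rw [this]; simp
  have hmain := integral_sq_sum_le (cube (Idx V)) P (fun x => coef σ x.1 x.2)
    (fun x => boxFun (itemSet x.1 x.2) (levelBox p (lev σ x.2))) (corr p D σ)
    (fun x _ => coef_nonneg _) (fun x _ => bddMeas_boxFun fun _ _ => measurableSet_levelBox _ _)
    (fun x _ => integral_item hk hσ x.1 x.2)
    (fun x hx y hy => by
      simp only [hP, Finset.mem_filter, Finset.mem_product] at hx hy
      exact integral_items_le hk hD hD' hσ (h3 _ hx.1.1) (h3 _ hy.1.1) hx.2 hy.2)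
  rw [hone] at hmain
  have hest : ∀ s, ∑ x ∈ P, coef σ x.1 x.2 *
      boxFun (itemSet x.1 x.2) (levelBox p (lev σ x.2)) s = estAt p σ 𝒢 s := by
    intro s
    exact hsum fun x => boxFun (itemSet x.1 x.2) (levelBox p (lev σ x.2)) s
  simp only [hest] at hmain
  refine hmain.trans ?_
  have hdouble : ∑ x ∈ P, ∑ y ∈ P, coef σ x.1 x.2 * coef σ y.1 y.2 * corr p D σ x y =
      ∑ t ∈ 𝒢, ∑ t' ∈ 𝒢, ∑ o, ∑ o', coef σ t o * coef σ t' o' *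
        corr p D σ (t, o) (t', o') := by
    simp only [mul_assoc, ← Finset.mul_sum, hsum]
    refine Finset.sum_congr rfl fun t _ => ?_
    simp only [Finset.mul_sum]
    rw [Finset.sum_comm]
  rw [hdouble]
  refine (Finset.sum_le_sum fun t _ => Finset.sum_le_sum fun t' _ =>
    sum_coef_corr_le hk σ t t').trans ?_
  simp only [Finset.sum_add_distrib]
  have hs := Real.sqrt_nonneg p.k
  have e1 : ∑ t ∈ 𝒢, ∑ t' ∈ 𝒢, (if 2 ≤ (t ∩ t').card then p.k else 0) ≤
      6 * p.k * dE * 𝒢.card := by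
    have : ∀ t ∈ 𝒢, ∑ t' ∈ 𝒢, (if 2 ≤ (t ∩ t').card then p.k else 0) ≤ 6 * p.k * dE := by
      intro t ht
      have := mul_le_mul_of_nonneg_left (sum_pair_le h3 hE ht) (zero_le_one.trans hk)
      simp only [Finset.mul_sum, mul_ite, mul_one, mul_zero] at this
      linarith
    refine (Finset.sum_le_sum this).trans (le_of_eq ?_)
    rw [Finset.sum_const, nsmul_eq_mul, mul_comm]
  have e2 : ∑ t ∈ 𝒢, ∑ t' ∈ 𝒢, (if t = t' then D else 0) = D * 𝒢.card := by
    rw [Finset.sum_congr rfl fun t ht => by rw [Finset.sum_ite_eq, if_pos ht], Finset.sum_const,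
      nsmul_eq_mul, mul_comm]
  have e3 : ∑ t ∈ 𝒢, ∑ t' ∈ 𝒢, ∑ u ∈ t ∩ t', vertexCost p σ u =
      ∑ v, vertexCost p σ v * ((𝒢.filter fun t => v ∈ t).card : ℝ) ^ 2 := by
    have : ∀ t t' : Finset V, ∑ u ∈ t ∩ t', vertexCost p σ u =
        ∑ u, vertexCost p σ u * ((if u ∈ t then 1 else 0) * (if u ∈ t' then 1 else 0)) := by
      intro t t'
      rw [← Finset.sum_subset (Finset.subset_univ (t ∩ t'))]
      · refine Finset.sum_congr rfl fun u hu => ?_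
        rw [Finset.mem_inter] at hu
        simp [hu.1, hu.2]
      · intro u _ hu
        rw [Finset.mem_inter] at hu
        by_cases h : u ∈ t
        · have : u ∉ t' := fun h' => hu ⟨h, h'⟩
          simp [this]
        · simp [h]
    simp only [this]
    simp_rw [Finset.sum_comm (s := 𝒢) (t := Finset.univ)]
    refine Finset.sum_congr rfl fun u _ => ?_
    simp only [← Finset.mul_sum, ← Finset.sum_mul]
    rw [Finset.card_filter, pow_two]
    push_cast
    rfl
  -- For fixed `t`, a vertex `u` of `t` and a non-light `v ≠ u`, the triangles `t'` through `u` and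
  -- `v` number at most `dE`. This produces the term with `heavyCount`.
  have e4 : ∑ t ∈ 𝒢, ∑ t' ∈ 𝒢, ∑ u ∈ t ∩ t',
      (√p.k * ∑ v, if (v ≠ u ∧ v ∈ t') ∧ σ v ≠ ⊤ then (1 : ℝ) else 0) ≤
        3 * √p.k * dE * heavyCount σ * 𝒢.card := by
    have : ∀ t ∈ 𝒢, ∑ t' ∈ 𝒢, ∑ u ∈ t ∩ t',
        (√p.k * ∑ v, if (v ≠ u ∧ v ∈ t') ∧ σ v ≠ ⊤ then (1 : ℝ) else 0) ≤
        3 * √p.k * dE * heavyCount σ := by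
      intro t ht
      have hin : ∀ t' : Finset V, ∑ u ∈ t ∩ t',
          (√p.k * ∑ v, if (v ≠ u ∧ v ∈ t') ∧ σ v ≠ ⊤ then (1 : ℝ) else 0) =
          ∑ u ∈ t, ∑ v ∈ Finset.univ.filter (fun v => σ v ≠ ⊤),
            √p.k * (if v ≠ u ∧ (u ∈ t' ∧ v ∈ t') then 1 else 0) := by
        intro t'
        rw [← Finset.filter_mem_eq_inter, Finset.sum_filter]
        refine Finset.sum_congr rfl fun u _ => ?_
        rw [← Finset.mul_sum, Finset.sum_filter]
        by_cases hu : u ∈ t'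
        · rw [if_pos hu]
          refine congrArg (√p.k * ·) (Finset.sum_congr rfl fun v _ => ?_)
          by_cases h1 : σ v = ⊤ <;> by_cases h2 : v = u <;> simp [h1, h2, hu]
        · simp [hu]
      simp only [hin]
      rw [Finset.sum_comm]
      have hu : ∀ u ∈ t, ∑ t' ∈ 𝒢, ∑ v ∈ Finset.univ.filter (fun v => σ v ≠ ⊤),
          √p.k * (if v ≠ u ∧ (u ∈ t' ∧ v ∈ t') then (1 : ℝ) else 0) ≤
            √p.k * dE * heavyCount σ := by
        intro u _
        rw [Finset.sum_comm]
        have hv : ∀ v ∈ Finset.univ.filter (fun v => σ v ≠ ⊤), ∑ t' ∈ 𝒢,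
            √p.k * (if v ≠ u ∧ (u ∈ t' ∧ v ∈ t') then (1 : ℝ) else 0) ≤ √p.k * dE := by
          intro v _
          rw [← Finset.mul_sum]
          refine mul_le_mul_of_nonneg_left ?_ hs
          by_cases hvu : v = u
          · simp only [hvu, ne_eq, not_true_eq_false, false_and, if_false, Finset.sum_const_zero]
            -- Any two distinct vertices of `t` witness `0 ≤ dE`, which is not among the hypotheses.
            obtain ⟨a, _, b, _, hab⟩ := Finset.one_lt_card.mp (by rw [h3 t ht]; norm_num : 1 < t.card)
            exact (Nat.cast_nonneg _).trans (hE a b hab)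
          · simp only [ne_eq, hvu, not_false_eq_true, true_and]
            rw [← Finset.sum_filter, Finset.sum_const, nsmul_eq_mul, mul_one]
            exact hE u v (Ne.symm hvu)
        refine (Finset.sum_le_sum hv).trans (le_of_eq ?_)
        rw [Finset.sum_const, nsmul_eq_mul, heavyCount, mul_comm]
      refine (Finset.sum_le_sum hu).trans (le_of_eq ?_)
      rw [Finset.sum_const, h3 t ht, nsmul_eq_mul]
      push_cast
      ring
    refine (Finset.sum_le_sum this).trans (le_of_eq ?_)
    rw [Finset.sum_const, nsmul_eq_mul, mul_comm]
  rw [e2, e3]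
  unfold varBound
  linarith

end FixedVariance

section FirstPass

open scoped Classical

/-! ### Measurability -/

section Bits

variable {V : Type*} {p : Params}

/-- The numbers with which the algorithm compares its hash values. -/
noncomputable def thresholds (p : Params) : Finset ℝ :=
  insert (1 / √p.k) ((Finset.range (p.top + 1)).image (fun j => p.weight j / √p.k) ∪
    (Finset.range (p.top + 2)).image fun j => ∑ i ∈ Finset.range j, 1 / p.weight i)

/-- The seeds `s` and `s'` cannot be distinguished by the algorithm. -/
def SameBits (p : Params) (s s' : Seed V) : Prop :=
  ∀ i, ∀ r ∈ thresholds p, (s i : ℝ) < r ↔ (s' i : ℝ) < r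

variable {s s' : Seed V}

theorem SameBits.inv_sqrt (h : SameBits p s s') (i : Idx V) :
    (s i : ℝ) < 1 / √p.k ↔ (s' i : ℝ) < 1 / √p.k :=
  h i _ (Finset.mem_insert_self _ _)

theorem SameBits.weight (h : SameBits p s s') (i : Idx V) {j : ℕ} (hj : j ≤ p.top) :
    (s i : ℝ) < p.weight j / √p.k ↔ (s' i : ℝ) < p.weight j / √p.k :=
  h i _ (Finset.mem_insert_of_mem (Finset.mem_union_left _
    (Finset.mem_image_of_mem _ (Finset.mem_range.mpr (by omega)))))

theorem SameBits.sum (h : SameBits p s s') (i : Idx V) {j : ℕ} (hj : j ≤ p.top + 1) :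
    (s i : ℝ) < ∑ i ∈ Finset.range j, 1 / p.weight i ↔
      (s' i : ℝ) < ∑ i ∈ Finset.range j, 1 / p.weight i :=
  h i _ (Finset.mem_insert_of_mem (Finset.mem_union_right _
    (Finset.mem_image_of_mem (fun j => ∑ i ∈ Finset.range j, 1 / p.weight i)
      (Finset.mem_range.mpr (by omega)))))

theorem SameBits.levelBox (h : SameBits p s s') {j : ℕ} (hj : j ≤ p.top) (i : Idx V) :
    s i ∈ levelBox p j i ↔ s' i ∈ levelBox p j i := by
  rcases i with i | i | i
  · exact h.inv_sqrt _
  · simp only [TriangleEstimation.levelBox, Set.mem_ofPred_eq, h.sum _ (show j + 1 ≤ p.top + 1 by omega)]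
    rw [← not_lt, ← not_lt, h.sum _ (show j ≤ p.top + 1 by omega)]
  · exact h.weight _ hj

variable [Fintype V]

/-- The algorithm only compares hash values with finitely many thresholds, so measurability and
boundedness of everything it computes follow from invariance under `SameBits`. -/
theorem measurable_of_sameBits {β : Type*} [MeasurableSpace β] (f : Seed V → β)
    (h : ∀ s s', SameBits p s s' → f s = f s') : Measurable f ∧ (Set.range f).Finite :=
  measurable_of_events (κ := Idx V × thresholds p) (fun x => {s : Seed V | (s x.1 : ℝ) < x.2})
    (fun x => measurableSet_lt (measurable_subtype_coe.comp (measurable_pi_apply x.1))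
      measurable_const) f
    fun s s' hs => h s s' fun i r hr => hs (i, ⟨r, hr⟩)

theorem bddMeas_of_sameBits (f : Seed V → ℝ) (h : ∀ s s', SameBits p s s' → f s = f s') :
    BddMeas f := by
  obtain ⟨hm, hfin⟩ := measurable_of_sameBits f h
  obtain ⟨K, hK⟩ := (hfin.image abs).bddAbove
  exact ⟨hm, K, fun x => hK ⟨f x, ⟨x, rfl⟩, rfl⟩⟩

theorem measurableSet_of_sameBits (P : Seed V → Prop) (h : ∀ s s', SameBits p s s' → P s = P s') :
    MeasurableSet {s | P s} :=
  (measurable_of_sameBits P h).1.setOf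

variable {G : SimpleGraph V}

theorem firstCount_congr {i : Fin 2} {v : V} {j : ℕ}
    (hd : ∀ x, dBit p s i x ↔ dBit p s' i x)
    (hr : ∀ e, rD s i e < p.weight j / √p.k ↔ rD s' i e < p.weight j / √p.k) :
    firstCount p s G i v j = firstCount p s' G i v j := by
  unfold firstCount
  simp only [hd, hr]

theorem SameBits.firstCount (h : SameBits p s s') {i : Fin 2} {v : V} {j : ℕ} (hj : j ≤ p.top) :
    firstCount p s G i v j = firstCount p s' G i v j :=
  firstCount_congr (fun _ => h.inv_sqrt _) fun _ => h.weight _ hj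

theorem scale_congr
    (h : ∀ i v, ∀ j ≤ p.top, firstCount p s G i v j = firstCount p s' G i v j) :
    scale p s G = scale p s' G := by
  funext v
  rw [scale_eq_min, scale_eq_min]
  refine congrArg Finset.min (Finset.filter_congr fun j hj => ?_)
  simp only [Passes, h _ _ j (Nat.lt_succ_iff.mp (Finset.mem_range.mp hj))]

theorem SameBits.scale (h : SameBits p s s') : scale p s G = scale p s' G :=
  scale_congr fun _ _ _ hj => h.firstCount hj

theorem SameBits.estAt (h : SameBits p s s') {σ : V → WithTop ℕ}
    (hσ : ∀ v, σ v ≠ ⊤ → (σ v).untopD 0 ≤ p.top) (𝒢 : Finset (Finset V)) :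
    estAt p σ 𝒢 s = estAt p σ 𝒢 s' := by
  unfold TriangleEstimation.estAt
  refine Finset.sum_congr rfl fun t _ => Finset.sum_congr rfl fun o _ => ?_
  rw [boxFun_congr fun i _ => h.levelBox (lev_le_top hσ o) i]

theorem bddMeas_estAt_scale (p : Params) (G : SimpleGraph V) (𝒢 : Finset (Finset V)) :
    BddMeas fun s : Seed V => estAt p (scale p s G) 𝒢 s :=
  bddMeas_of_sameBits (p := p) _ fun s s' h => by
    rw [← h.scale, h.estAt fun v hv => scale_untopD_le s G v hv]

theorem bddMeas_scale (p : Params) (G : SimpleGraph V) (F : (V → WithTop ℕ) → ℝ) :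
    BddMeas fun s : Seed V => F (scale p s G) :=
  bddMeas_of_sameBits (p := p) _ fun s s' h => by rw [h.scale]

theorem measurableSet_scale (p : Params) (G : SimpleGraph V) (P : (V → WithTop ℕ) → Prop) :
    MeasurableSet {s : Seed V | P (scale p s G)} :=
  measurableSet_of_sameBits (p := p) _ fun s s' h => by rw [h.scale]

end Bits

/-! ### The first pass -/

variable {V : Type*} [Fintype V] {p : Params} {G : SimpleGraph V}

/-- The normalised number of triangles of `𝒢` counted at `v` in the first pass. -/
noncomputable def starCount (p : Params) (𝒢 : Finset (Finset V)) (i : Fin 2) (v : V) (j : ℕ)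
    (s : Seed V) : ℝ :=
  ∑ t ∈ 𝒢.filter (fun t => v ∈ t), boxFun (starSet i.succ t v ∅) (levelBox p j) s

theorem bddMeas_starCount (𝒢 : Finset (Finset V)) (i : Fin 2) (v : V) (j : ℕ) :
    BddMeas (starCount p 𝒢 i v j) :=
  BddMeas.sum fun _ _ => bddMeas_boxFun fun _ _ => measurableSet_levelBox _ _

theorem integral_star (hk : 1 ≤ p.k) {j : ℕ} (hj : j ≤ p.top) (i : Fin 3) (t : Finset V) (v : V) :
    ∫ s, boxFun (starSet i t v ∅) (levelBox p j) s ∂cube (Idx V) = 1 :=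
  integral_boxFun (fun _ _ => measurableSet_levelBox _ _) fun _ _ => volume_levelBox_pos hk hj _

theorem integral_starCount (hk : 1 ≤ p.k) {j : ℕ} (hj : j ≤ p.top) (𝒢 : Finset (Finset V))
    (i : Fin 2) (v : V) :
    ∫ s, starCount p 𝒢 i v j s ∂cube (Idx V) = (𝒢.filter fun t => v ∈ t).card := by
  unfold starCount
  rw [integral_finsetSum _ fun t _ =>
    (bddMeas_boxFun fun _ _ => measurableSet_levelBox _ _).integrable _]
  simp [integral_star hk hj]

/-- In this normalisation the mean is the number of triangles at `v`, and the test threshold `w_j Tt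
/ k²` becomes `Tt / w_j`. -/
theorem starCount_triangles (hk : 1 ≤ p.k) (i : Fin 2) (v : V) {j : ℕ} (s : Seed V) :
    starCount p (triangles G) i v j s =
      p.k ^ 2 / p.weight j ^ 2 * (firstCount p s G i v j : ℝ) := by
  have hs := Params.one_le_sqrt_k hk
  have hw := Params.weight_pos hk j
  unfold starCount firstCount
  rw [← Finset.filter_filter, mul_comm, ← nsmul_eq_mul, ← Finset.sum_const,
    Finset.sum_filter (s := (triangles G).filter fun t => v ∈ t)]
  refine Finset.sum_congr rfl fun t ht => ?_
  obtain ⟨ht, hv⟩ := Finset.mem_filter.mp ht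
  have hc : (t.erase v).card = 2 := by
    rw [Finset.card_erase_of_mem hv, card_of_mem_triangles ht]
  rw [boxFun_eq_ite]
  refine if_congr ?_ ?_ rfl
  · rw [forall_starSet]
    simp only [Finset.notMem_empty, false_imp_iff, implies_true, true_and]
    rfl
  · rw [prod_starSet]
    simp only [volume_levelBox_inl hk, volume_levelBox_inr hk, Finset.prod_empty,
      Finset.prod_const, hc, one_div, inv_inv, inv_div, div_pow]
    rw [Real.sq_sqrt (by linarith)]
    field_simp

theorem starCount_mono {𝒢 𝒢' : Finset (Finset V)} (h : 𝒢 ⊆ 𝒢') (i : Fin 2) (v : V) (j : ℕ)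
    (s : Seed V) : starCount p 𝒢 i v j s ≤ starCount p 𝒢' i v j s :=
  Finset.sum_le_sum_of_subset_of_nonneg (Finset.filter_subset_filter _ h)
    fun _ _ _ => boxFun_nonneg _

/-- Two triangles at `v` are correlated only through a further common vertex: a common edge costs `q
= k / w_j`, equality costs `q²`. -/
theorem integral_starCount_sub_sq_le {dE : ℝ} (hk : 1 ≤ p.k) {j : ℕ} (hj : j ≤ p.top)
    {𝒢 : Finset (Finset V)} (h3 : ∀ t ∈ 𝒢, t.card = 3)
    (hE : ∀ u v, u ≠ v → ((𝒢.filter fun t => u ∈ t ∧ v ∈ t).card : ℝ) ≤ dE) (i : Fin 2) (v : V) :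
    ∫ s, (starCount p 𝒢 i v j s - (𝒢.filter fun t => v ∈ t).card) ^ 2 ∂cube (Idx V) ≤
      (6 * dE * (p.k / p.weight j) + (p.k / p.weight j) ^ 2) *
        (𝒢.filter fun t => v ∈ t).card := by
  set 𝒢v := 𝒢.filter fun t => v ∈ t with h𝒢v
  set q := p.k / p.weight j with hq
  have hq0 : 0 ≤ q := div_nonneg (by linarith) (Params.weight_pos hk j).le
  have hv3 : ∀ t ∈ 𝒢v, t.card = 3 := fun t ht => h3 t (Finset.mem_filter.mp ht).1
  have hvE : ∀ a b, a ≠ b → ((𝒢v.filter fun t => a ∈ t ∧ b ∈ t).card : ℝ) ≤ dE := by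
    intro a b hab
    refine le_trans ?_ (hE a b hab)
    exact_mod_cast Finset.card_le_card (Finset.filter_subset_filter _ (Finset.filter_subset _ _))
  have hmain := integral_sq_sum_le (cube (Idx V)) 𝒢v (fun _ => 1)
    (fun t => boxFun (starSet i.succ t v ∅) (levelBox p j))
    (fun t t' => q * (if 2 ≤ (t ∩ t').card then 1 else 0) + (if t = t' then q ^ 2 else 0))
    (fun _ _ => zero_le_one) (fun _ _ => bddMeas_boxFun fun _ _ => measurableSet_levelBox _ _)
    (fun t _ => integral_star hk hj _ t v) (by
      intro t ht t' ht'
      have h1 := integral_star_mul_star_le hk hj i.succ t t' v ∅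
      rw [Finset.card_empty, pow_zero, one_mul] at h1
      refine h1.trans ?_
      have hvi : v ∈ t ∩ t' :=
        Finset.mem_inter.mpr ⟨(Finset.mem_filter.mp ht).2, (Finset.mem_filter.mp ht').2⟩
      rw [Finset.card_erase_of_mem hvi, ← hq]
      have hc1 : 1 ≤ (t ∩ t').card := Finset.card_pos.mpr ⟨v, hvi⟩
      have hc3 : (t ∩ t').card ≤ 3 :=
        hv3 t ht ▸ Finset.card_le_card Finset.inter_subset_left
      have hqq : (0 : ℝ) ≤ if t = t' then q ^ 2 else 0 := by split_ifs <;> positivity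
      have : (t ∩ t').card = 1 ∨ (t ∩ t').card = 2 ∨ (t ∩ t').card = 3 := by omega
      rcases this with h | h | h
      · rw [h]; norm_num; exact hqq
      · rw [h]; norm_num; linarith
      · have h4 : t ∩ t' = t := Finset.eq_of_subset_of_card_le Finset.inter_subset_left
          (by rw [h, hv3 t ht])
        have h5 : t ∩ t' = t' := Finset.eq_of_subset_of_card_le Finset.inter_subset_right
          (by rw [h, hv3 t' ht'])
        rw [h, if_pos (h4.symm.trans h5)]
        norm_num
        linarith)
  simp only [one_mul, Finset.sum_const, nsmul_eq_mul, mul_one] at hmain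
  refine hmain.trans ?_
  have hin : ∀ t ∈ 𝒢v, ∑ t' ∈ 𝒢v, (q * (if 2 ≤ (t ∩ t').card then 1 else 0) +
      (if t = t' then q ^ 2 else 0)) ≤ 6 * dE * q + q ^ 2 := by
    intro t ht
    rw [Finset.sum_add_distrib, ← Finset.mul_sum, Finset.sum_ite_eq, if_pos ht]
    have := mul_le_mul_of_nonneg_left (sum_pair_le hv3 hvE ht) hq0
    linarith
  refine (Finset.sum_le_sum hin).trans (le_of_eq ?_)
  rw [Finset.sum_const, nsmul_eq_mul, mul_comm]

/-- A lower tail estimate for functions with given mean and variance. -/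
theorem measureReal_lt_half_le {Ω : Type*} [MeasurableSpace Ω] (μ : Measure Ω)
    [IsProbabilityMeasure μ] {f : Ω → ℝ} (hf : BddMeas f) {τ B : ℝ} (hτ : 0 < τ)
    (hB : ∫ x, (f x - τ) ^ 2 ∂μ ≤ B) : μ.real {x | f x < τ / 2} ≤ 4 * B / τ ^ 2 := by
  have h1 := mul_meas_ge_le_integral_of_nonneg (μ := μ)
    (ae_of_all _ fun x => sq_nonneg (f x - τ)) (((hf.sub (BddMeas.const τ)).sq).integrable μ)
    (τ ^ 2 / 4)
  have h2 : μ.real {x | f x < τ / 2} ≤ μ.real {x | τ ^ 2 / 4 ≤ (f x - τ) ^ 2} := by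
    refine measureReal_mono fun x hx => ?_
    simp only [Set.mem_ofPred_eq] at hx ⊢
    nlinarith
  rw [le_div_iff₀ (by positivity)]
  have h3 : τ ^ 2 / 4 * μ.real {x | f x < τ / 2} ≤ B :=
    (mul_le_mul_of_nonneg_left h2 (by positivity)).trans (h1.trans hB)
  linarith

/-- The event that `v` fails the test of level `j` in copy `i` of the first pass. -/
def failSet (p : Params) (G : SimpleGraph V) (i : Fin 2) (v : V) (j : ℕ) : Set (Seed V) :=
  {s | (firstCount p s G i v j : ℝ) < p.weight j * p.Tt / p.k ^ 2}

theorem measurableSet_failSet (i : Fin 2) (v : V) {j : ℕ} (hj : j ≤ p.top) :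
    MeasurableSet (failSet p G i v j) :=
  measurableSet_of_sameBits (p := p) _ fun s s' h => by rw [h.firstCount hj]

/-- The test counts all triangles of `G`, but for a lower tail it may be weakened to the good ones
in `𝒢`, whose variance is controlled. Chebyshev then bounds the failure probability by `24 x + 4
x²`, where `x = Tt / (w_j τ)`. -/
theorem measureReal_failSet_le {dE : ℝ} (hk : 1 ≤ p.k) (hTt : 0 < p.Tt) {j : ℕ} (hj : j ≤ p.top)
    {𝒢 : Finset (Finset V)} (h𝒢 : 𝒢 ⊆ triangles G)
    (hE : ∀ u v, u ≠ v → ((𝒢.filter fun t => u ∈ t ∧ v ∈ t).card : ℝ) ≤ dE)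
    (hkE : p.k * dE ≤ p.Tt) (i : Fin 2) (v : V)
    (hkV : p.k ^ 2 * (𝒢.filter fun t => v ∈ t).card ≤ p.Tt ^ 2)
    (hτ : 0 < (𝒢.filter fun t => v ∈ t).card) :
    (cube (Idx V)).real (failSet p G i v j) ≤
      26 * p.Tt / (p.weight j * (𝒢.filter fun t => v ∈ t).card) := by
  have hτ' : (0 : ℝ) < (𝒢.filter fun t => v ∈ t).card := by exact_mod_cast hτ
  have hvar := integral_starCount_sub_sq_le hk hj (fun t ht => card_of_mem_triangles (h𝒢 ht)) hE i v
  set τ : ℝ := ((𝒢.filter fun t => v ∈ t).card : ℝ) with hτdef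
  have hw := Params.weight_pos hk j
  set w := p.weight j with hwdef
  have hk0 : 0 < p.k := by linarith
  set x := p.Tt / (w * τ) with hx
  have hx0 : 0 < x := by positivity
  have hxeq : 26 * p.Tt / (w * τ) = 26 * x := by rw [hx]; ring
  rw [hxeq]
  -- For `x > 1/2` the claim exceeds one. Otherwise the threshold is at most half the mean, and `4
  -- x² ≤ 2 x`.
  by_cases hhalf : 1 / 2 < x
  · exact measureReal_le_one.trans (by linarith)
  push Not at hhalf
  have hTw : p.Tt / w ≤ τ / 2 := by
    rw [hx, div_le_iff₀ (by positivity)] at hhalf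
    rw [div_le_iff₀ hw]
    linarith
  have hsub : failSet p G i v j ⊆ {s | starCount p 𝒢 i v j s < τ / 2} := by
    intro s hs
    simp only [failSet, Set.mem_ofPred_eq] at hs ⊢
    refine (starCount_mono h𝒢 i v j s).trans_lt ?_
    rw [starCount_triangles hk]
    refine lt_of_lt_of_le ?_ hTw
    calc _ < p.k ^ 2 / w ^ 2 * (w * p.Tt / p.k ^ 2) :=
          mul_lt_mul_of_pos_left hs (by positivity)
      _ = p.Tt / w := by field_simp
  refine (measureReal_mono hsub).trans ?_
  refine (measureReal_lt_half_le _ (bddMeas_starCount 𝒢 i v j) hτ' hvar).trans ?_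
  have e1 : 4 * ((6 * dE * (p.k / w) + (p.k / w) ^ 2) * τ) / τ ^ 2 =
      24 * (p.k * dE) / (w * τ) + 4 * (p.k ^ 2 * τ) / (w * τ) ^ 2 := by
    field_simp
    ring
  rw [e1]
  have e2 : 24 * (p.k * dE) / (w * τ) ≤ 24 * x := by
    rw [hx, ← mul_div_assoc]
    gcongr
  have e3 : 4 * (p.k ^ 2 * τ) / (w * τ) ^ 2 ≤ 4 * x ^ 2 := by
    rw [hx, div_pow, ← mul_div_assoc]
    gcongr
  nlinarith

/-- The two copies of the first pass are independent. -/
theorem measureReal_failSet_inter (v : V) {j : ℕ} (hj : j ≤ p.top) :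
    (cube (Idx V)).real (failSet p G 0 v j ∩ failSet p G 1 v j) =
      (cube (Idx V)).real (failSet p G 0 v j) * (cube (Idx V)).real (failSet p G 1 v j) := by
  set D : Set (Idx V) := {i | (∃ x, i = .inl (1, x)) ∨ ∃ e, i = .inr (.inr (1, e))} with hD
  have h0 := measurableSet_failSet (G := G) 0 v hj
  have h1 := measurableSet_failSet (G := G) 1 v hj
  have m0 : ∀ x y : Seed V, merge D x y ∈ failSet p G 0 v j ↔ x ∈ failSet p G 0 v j := by
    intro x y
    simp only [failSet, Set.mem_ofPred_eq]
    rw [firstCount_congr (s' := x)]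
    · intro a
      simp [dBit, merge, hD]
    · intro e
      simp [rD, merge, hD]
  have m1 : ∀ x y : Seed V, merge D x y ∈ failSet p G 1 v j ↔ y ∈ failSet p G 1 v j := by
    intro x y
    simp only [failSet, Set.mem_ofPred_eq]
    rw [firstCount_congr (s' := y)]
    · intro a
      simp [dBit, merge, hD]
    · intro e
      simp [rD, merge, hD]
  have h := integral_mul_of_merge D (BddMeas.indicator h0 1) (BddMeas.indicator h1 1)
    (fun x y => by
      by_cases hx : x ∈ failSet p G 0 v j
      · simp [hx, (m0 x y).mpr hx]
      · simp [hx, mt (m0 x y).mp hx])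
    (fun x y => by
      by_cases hx : y ∈ failSet p G 1 v j
      · simp [hx, (m1 x y).mpr hx]
      · simp [hx, mt (m1 x y).mp hx])
  rw [integral_indicator_const _ h0, integral_indicator_const _ h1] at h
  simp only [smul_eq_mul, mul_one] at h
  rw [← h, ← mul_one ((cube (Idx V)).real _), ← smul_eq_mul,
    ← integral_indicator_const _ (h0.inter h1)]
  refine integral_congr_ae (ae_of_all _ fun s => ?_)
  by_cases a0 : s ∈ failSet p G 0 v j <;> by_cases a1 : s ∈ failSet p G 1 v j <;> simp [a0, a1]

theorem not_passes_iff (s : Seed V) (v : V) (j : ℕ) :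
    ¬ Passes p s G v j ↔ s ∈ failSet p G 0 v j ∩ failSet p G 1 v j := by
  simp [Passes, failSet]

/-- Markov bounds the chance of passing level `j` in one copy by `w_j T_v / Tt`. The weights sum to
at most `3 √k`, and there are two copies. All triangles at `v` count here, since no truncation is
needed for an upper tail. -/
theorem measureReal_scale_ne_top_le (hk : 1 ≤ p.k) (hTt : 0 < p.Tt) (v : V) :
    (cube (Idx V)).real {s | scale p s G v ≠ ⊤} ≤ 6 * √p.k / p.Tt * vertexTri G v := by
  have hlev : ∀ i, ∀ j ∈ Finset.range (p.top + 1), (cube (Idx V)).real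
      {s | p.weight j * p.Tt / p.k ^ 2 ≤ (firstCount p s G i v j : ℝ)} ≤
        p.weight j / p.Tt * vertexTri G v := by
    intro i j hj
    have hj' : j ≤ p.top := Nat.lt_succ_iff.mp (Finset.mem_range.mp hj)
    have hw := Params.weight_pos hk j
    have hk0 : 0 < p.k := by linarith
    have hnn : ∀ s, 0 ≤ starCount p (triangles G) i v j s :=
      fun s => Finset.sum_nonneg fun t _ => boxFun_nonneg _
    have h1 := mul_meas_ge_le_integral_of_nonneg (μ := cube (Idx V)) (ae_of_all _ hnn)
      ((bddMeas_starCount (p := p) (triangles G) i v j).integrable _) (p.Tt / p.weight j)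
    rw [integral_starCount hk hj'] at h1
    have h2 : {s | p.weight j * p.Tt / p.k ^ 2 ≤ (firstCount p s G i v j : ℝ)} ⊆
        {s | p.Tt / p.weight j ≤ starCount p (triangles G) i v j s} := by
      intro s hs
      simp only [Set.mem_ofPred_eq] at hs ⊢
      rw [starCount_triangles hk]
      calc p.Tt / p.weight j = p.k ^ 2 / p.weight j ^ 2 * (p.weight j * p.Tt / p.k ^ 2) := by
            field_simp
        _ ≤ _ := mul_le_mul_of_nonneg_left hs (by positivity)
    refine (measureReal_mono h2).trans ?_
    rw [div_mul_eq_mul_div, le_div_iff₀ hTt]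
    rw [div_mul_eq_mul_div, div_le_iff₀ hw] at h1
    have h4 : (((triangles G).filter fun t => v ∈ t).card : ℝ) = vertexTri G v := rfl
    rw [h4] at h1
    linarith
  have hsub : {s | scale p s G v ≠ ⊤} ⊆ ⋃ j ∈ Finset.range (p.top + 1),
      ({s | p.weight j * p.Tt / p.k ^ 2 ≤ (firstCount p s G 0 v j : ℝ)} ∪
        {s | p.weight j * p.Tt / p.k ^ 2 ≤ (firstCount p s G 1 v j : ℝ)}) := by
    intro s hs
    obtain ⟨j, hj, hsj⟩ := exists_scale_eq_coe hs
    have := ((scale_eq_coe_iff v j).mp hsj).2.1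
    simp only [Passes, Fin.exists_fin_two] at this
    simp only [Set.mem_iUnion, Finset.mem_range]
    exact ⟨j, by omega, this⟩
  refine (measureReal_mono hsub (measure_ne_top _ _)).trans ((measureReal_biUnion_finset_le _ _).trans ?_)
  refine (Finset.sum_le_sum fun j hj => (measureReal_union_le _ _).trans
    (add_le_add (hlev 0 j hj) (hlev 1 j hj))).trans ?_
  simp only [← two_mul]
  rw [← Finset.mul_sum, ← Finset.sum_mul, ← Finset.sum_div]
  have h := Params.sum_weight_le hk
  have h5 : (0 : ℝ) ≤ vertexTri G v := Nat.cast_nonneg _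
  calc 2 * ((∑ i ∈ Finset.range (p.top + 1), p.weight i) / p.Tt * vertexTri G v)
      ≤ 2 * (3 * √p.k / p.Tt * vertexTri G v) := by gcongr
    _ = _ := by ring

theorem sum_vertexTri : ∑ v, vertexTri G v = 3 * numTri G := by
  unfold vertexTri numTri
  simp only [Finset.card_filter]
  rw [Finset.sum_comm]
  have : ∀ t ∈ triangles G, (∑ v, if v ∈ t then 1 else 0) = 3 := by
    intro t ht
    rw [← Finset.card_filter, Finset.filter_univ_mem, card_of_mem_triangles ht]
  rw [Finset.sum_congr rfl this]
  simp [mul_comm]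

theorem integral_heavyCount_le (hk : 1 ≤ p.k) (hTt : 0 < p.Tt) :
    ∫ s, (heavyCount (scale p s G) : ℝ) ∂cube (Idx V) ≤ 18 * √p.k / p.Tt * numTri G := by
  have h : ∀ s, (heavyCount (scale p s G) : ℝ) =
      ∑ v, {s | scale p s G v ≠ ⊤}.indicator (fun _ => (1 : ℝ)) s := by
    intro s
    rw [heavyCount, Finset.card_filter]
    push_cast
    refine Finset.sum_congr rfl fun v _ => ?_
    simp [Set.indicator_apply]
  have hm : ∀ v, MeasurableSet {s : Seed V | scale p s G v ≠ ⊤} := fun v =>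
    measurableSet_scale p G fun σ => σ v ≠ ⊤
  simp only [h]
  rw [integral_finsetSum _ fun v _ => (BddMeas.indicator (hm v) 1).integrable _]
  simp only [fun v => integral_indicator_const (μ := cube (Idx V)) (1 : ℝ) (hm v), smul_eq_mul,
    mul_one]
  refine (Finset.sum_le_sum fun v _ => measureReal_scale_ne_top_le hk hTt v).trans (le_of_eq ?_)
  rw [← Finset.mul_sum, ← Nat.cast_sum, sum_vertexTri]
  push_cast
  ring

end FirstPass

/-! ### Variance of one run with the random classification -/

section RunVariance

open scoped Classical

theorem Params.weight_zero {p : Params} : p.weight 0 = p.omega := by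
  rw [weight, pow_zero, mul_one]
  exact min_eq_left omega_le_sqrt

/-- Summation over the levels: if the probability of level `j + 1` is at most `(y / w_j)²`, then the
expected weight is at most `ω + 14 y`. -/
theorem sum_weight_mul_le {p : Params} (hk : 1 ≤ p.k) {a : ℕ → ℝ} {y : ℝ} (hy : 0 < y)
    (ha : ∀ j, 0 ≤ a j) (hsum : ∑ j ∈ Finset.range (p.top + 1), a j ≤ 1)
    (h : ∀ j < p.top, a (j + 1) ≤ (y / p.weight j) ^ 2) :
    ∑ j ∈ Finset.range (p.top + 1), p.weight j * a j ≤ p.omega + 14 * y := by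
  have hω := Params.one_le_omega hk
  -- A bounded telescoping potential replaces a split of the sum at weight `y`. Terms with `ω 2^j ≤
  -- y` are paid by the total probability, giving `2 y`; larger ones are at most `12` times the
  -- increment of `φ`, giving `12 y`.
  set φ : ℕ → ℝ := fun j => y * (p.omega * 2 ^ j / (p.omega * 2 ^ j + y)) with hφ
  have hφ0 : ∀ j, 0 ≤ φ j := fun j => by positivity
  have hφ1 : ∀ j, φ j ≤ y := by
    intro j
    refine mul_le_of_le_one_right hy.le ?_
    rw [div_le_one (by positivity)]
    linarith
  have hstep : ∀ j ∈ Finset.range p.top,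
      p.weight (j + 1) * a (j + 1) ≤ 2 * y * a (j + 1) + 12 * (φ (j + 1) - φ j) := by
    intro j hj
    have hj' := Finset.mem_range.mp hj
    have h1 := h j hj'
    have h2 := Params.weight_succ_le (p := p) j
    rw [Params.weight_of_lt_top hk hj'] at h1 h2
    have hx1 : 1 ≤ p.omega * 2 ^ j := one_le_mul_of_one_le_of_one_le hω (one_le_pow₀ one_le_two)
    have hinc : φ (j + 1) - φ j = y ^ 2 * (p.omega * 2 ^ j) /
        ((2 * (p.omega * 2 ^ j) + y) * (p.omega * 2 ^ j + y)) := by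
      simp only [hφ, pow_succ]
      field_simp
      ring
    set x := p.omega * 2 ^ j with hx
    have hx0 : 0 < x := by linarith
    have hinc0 : 0 ≤ φ (j + 1) - φ j := by rw [hinc]; positivity
    have h3 : p.weight (j + 1) * a (j + 1) ≤ 2 * x * a (j + 1) :=
      mul_le_mul_of_nonneg_right h2 (ha _)
    by_cases hxy : x ≤ y
    · have := mul_le_mul_of_nonneg_right hxy (ha (j + 1))
      linarith
    · push Not at hxy
      have h4 : y ^ 2 / (6 * x) ≤ φ (j + 1) - φ j := by
        rw [hinc, div_le_div_iff₀ (by positivity) (by positivity)]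
        have : (2 * x + y) * (x + y) ≤ 3 * x * (2 * x) :=
          mul_le_mul (by linarith) (by linarith) (by positivity) (by positivity)
        nlinarith [sq_nonneg y, mul_le_mul_of_nonneg_left this (sq_nonneg y)]
      have h5 : 2 * x * a (j + 1) ≤ 12 * (y ^ 2 / (6 * x)) := by
        calc 2 * x * a (j + 1) ≤ 2 * x * (y / x) ^ 2 := by gcongr
          _ = 12 * (y ^ 2 / (6 * x)) := by field_simp; ring
      have h6 := mul_nonneg hy.le (ha (j + 1))
      linarith
  rw [Finset.sum_range_succ'] at hsum ⊢
  have h1 := Finset.sum_le_sum hstep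
  rw [Finset.sum_add_distrib, ← Finset.mul_sum, ← Finset.mul_sum, Finset.sum_range_sub] at h1
  have h2 : 0 ≤ ∑ j ∈ Finset.range p.top, a (j + 1) := Finset.sum_nonneg fun _ _ => ha _
  rw [Params.weight_zero]
  have h3 := hφ0 0
  have h4 := hφ1 p.top
  have h5 := ha 0
  have h6 : ∑ j ∈ Finset.range p.top, a (j + 1) ≤ 1 := by linarith
  have h7 : a 0 ≤ 1 := by linarith
  nlinarith

variable {V : Type*} [Fintype V] {p : Params} {G : SimpleGraph V}

theorem vertexCost_scale_eq (s : Seed V) (v : V) :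
    vertexCost p (scale p s G) v =
      ∑ j ∈ Finset.range (p.top + 1), p.weight j *
        {s | scale p s G v = (j : WithTop ℕ)}.indicator (fun _ => (1 : ℝ)) s +
      √p.k * {s | scale p s G v = ⊤}.indicator (fun _ => (1 : ℝ)) s := by
  unfold vertexCost
  by_cases h : scale p s G v = ⊤
  · simp [h]
  · obtain ⟨j, hj, hsj⟩ := exists_scale_eq_coe h
    have hlev : lev (scale p s G) (some v) = j := by rw [lev, hsj]; rfl
    rw [if_neg h, hlev, Finset.sum_eq_single j]
    · simp [hsj]
    · intro i _ hij
      have : ¬ (j : WithTop ℕ) = (i : WithTop ℕ) := fun h => hij (WithTop.coe_injective h).symm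
      rw [Set.indicator_of_notMem, mul_zero]
      simpa [hsj] using this
    · intro hn
      exact absurd (Finset.mem_range.mpr (Nat.lt_succ_of_le hj)) hn

/-- With `y = 26 Tt / τ`, the non-light levels contribute at most `ω + 14 y`. Being light requires
failing the top level, whose weight is `√k`, and so adds at most `y`; hence the constant `390 = 15 ·
26`. -/
theorem integral_vertexCost_le {dE : ℝ} (hk : 1 ≤ p.k) (hTt : 0 < p.Tt)
    {𝒢 : Finset (Finset V)} (h𝒢 : 𝒢 ⊆ triangles G)
    (hE : ∀ u v, u ≠ v → ((𝒢.filter fun t => u ∈ t ∧ v ∈ t).card : ℝ) ≤ dE)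
    (hkE : p.k * dE ≤ p.Tt) (v : V)
    (hkV : p.k ^ 2 * (𝒢.filter fun t => v ∈ t).card ≤ p.Tt ^ 2)
    (hτ : 0 < (𝒢.filter fun t => v ∈ t).card) :
    ∫ s, vertexCost p (scale p s G) v ∂cube (Idx V) ≤
      p.omega + 390 * p.Tt / (𝒢.filter fun t => v ∈ t).card := by
  have hfail := fun i j (hj : j ≤ p.top) =>
    measureReal_failSet_le hk hTt hj h𝒢 hE hkE i v hkV hτ
  have hτ' : (0 : ℝ) < (𝒢.filter fun t => v ∈ t).card := by exact_mod_cast hτ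
  set τ : ℝ := ((𝒢.filter fun t => v ∈ t).card : ℝ) with hτdef
  set y := 26 * p.Tt / τ with hy
  have hy0 : 0 < y := by positivity
  have hfail' : ∀ i j, j ≤ p.top → (cube (Idx V)).real (failSet p G i v j) ≤ y / p.weight j := by
    intro i j hj
    refine (hfail i j hj).trans (le_of_eq ?_)
    rw [hy, div_div, mul_comm τ]
  have hm : ∀ j : WithTop ℕ, MeasurableSet {s : Seed V | scale p s G v = j} := fun j =>
    measurableSet_scale p G fun σ => σ v = j
  simp only [vertexCost_scale_eq]
  rw [integral_add ((BddMeas.sum fun j _ => (BddMeas.indicator (hm _) 1).const_mul _).integrable _)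
    (((BddMeas.indicator (hm _) 1).const_mul _).integrable _),
    integral_finsetSum _ fun j _ => (((BddMeas.indicator (hm _) 1).const_mul _).integrable _)]
  simp only [integral_const_mul, fun j => integral_indicator_const (μ := cube (Idx V)) (1 : ℝ) (hm j),
    smul_eq_mul, mul_one]
  have hlight : √p.k * (cube (Idx V)).real {s | scale p s G v = ⊤} ≤ y := by
    have hs := Params.one_le_sqrt_k hk
    have h1 : (cube (Idx V)).real {s | scale p s G v = ⊤} ≤ y / √p.k := by
      rw [← Params.weight_top hk]
      refine (measureReal_mono fun s hs => ?_).trans (hfail' 0 p.top le_rfl)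
      exact ((not_passes_iff s v p.top).mp ((scale_eq_top_iff v).mp hs _ le_rfl)).1
    rw [le_div_iff₀ (by positivity)] at h1
    linarith
  have hlevels := sum_weight_mul_le hk (y := y)
    (a := fun j => (cube (Idx V)).real {s | scale p s G v = (j : WithTop ℕ)}) hy0
    (fun _ => measureReal_nonneg) (by
      rw [← measureReal_biUnion_finset]
      · exact measureReal_le_one
      · intro i _ j _ hij
        refine Set.disjoint_left.mpr fun s hi hj => hij ?_
        exact WithTop.coe_injective (hi.symm.trans hj)
      · exact fun j _ => hm j) (by
      intro j hj
      have hj' : j ≤ p.top := hj.le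
      -- A vertex of scale `j + 1` has failed level `j` in both copies; their independence squares
      -- the bound.
      refine (measureReal_mono (s₂ := failSet p G 0 v j ∩ failSet p G 1 v j) fun s hs => ?_).trans ?_
      · exact (not_passes_iff s v j).mp
          (((scale_eq_coe_iff v (j + 1)).mp hs).2.2 j (Nat.lt_succ_self j))
      · rw [measureReal_failSet_inter v hj', pow_two]
        exact mul_le_mul (hfail' 0 j hj') (hfail' 1 j hj') measureReal_nonneg
          (div_nonneg hy0.le (Params.weight_pos hk j).le))
  have : 390 * p.Tt / τ = 15 * y := by rw [hy]; ring
  rw [this]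
  linarith

/-- The coordinates of the first pass. -/
def firstPassCoords (V : Type*) : Set (Idx V) :=
  {i | (∃ a : Fin 2, ∃ x, i = .inl (a.succ, x)) ∨ ∃ a : Fin 2, ∃ e, i = .inr (.inr (a.succ, e))}

theorem scale_merge (x y : Seed V) :
    scale p (merge (firstPassCoords V) x y) G = scale p x G := by
  refine scale_congr fun i v j _ => firstCount_congr (fun a => ?_) fun e => ?_
  · simp only [dBit, merge]
    rw [if_pos (show _ ∈ firstPassCoords V from Or.inl ⟨i, a, rfl⟩)]
  · simp only [rD, merge]
    rw [if_pos (show _ ∈ firstPassCoords V from Or.inr ⟨i, e, rfl⟩)]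

theorem estAt_merge (σ : V → WithTop ℕ) (𝒢 : Finset (Finset V)) (x y : Seed V) :
    estAt p σ 𝒢 (merge (firstPassCoords V) x y) = estAt p σ 𝒢 y := by
  have hnot : ∀ (t : Finset V) (o : Option V), ∀ i ∈ itemSet t o, i ∉ firstPassCoords V := by
    intro t o
    cases o with
    | none =>
      rw [itemSet, forall_lightSet]
      rintro x _ (⟨a, b, h⟩ | ⟨a, b, h⟩)
      · exact Fin.succ_ne_zero a (congrArg Prod.fst (Sum.inl_injective h)).symm
      · cases h
    | some v =>
      rw [itemSet, forall_starSet]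
      refine ⟨?_, fun x _ _ => ⟨?_, ?_⟩⟩
      · rintro x _ (⟨a, b, h⟩ | ⟨a, b, h⟩)
        · cases h
        · cases Sum.inr_injective h
      · rintro (⟨a, b, h⟩ | ⟨a, b, h⟩)
        · exact Fin.succ_ne_zero a (congrArg Prod.fst (Sum.inl_injective h)).symm
        · cases h
      · rintro (⟨a, b, h⟩ | ⟨a, b, h⟩)
        · cases h
        · exact Fin.succ_ne_zero a
            (congrArg Prod.fst (Sum.inr_injective (Sum.inr_injective h))).symm
  unfold estAt
  refine Finset.sum_congr rfl fun t _ => Finset.sum_congr rfl fun o _ => ?_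
  rw [boxFun_congr (y := y)]
  intro i hi
  simp only [merge, if_neg (hnot t o i hi)]

/-- With the first-pass coordinates frozen, the classification is constant and the second pass is
unbiased for it. -/
theorem integral_estAt_scale (hk : 1 ≤ p.k) (𝒢 : Finset (Finset V)) :
    ∫ s, estAt p (scale p s G) 𝒢 s ∂cube (Idx V) = 𝒢.card := by
  rw [integral_merge (firstPassCoords V) (bddMeas_estAt_scale p G 𝒢)]
  simp only [scale_merge, estAt_merge]
  simp only [fun x : Seed V => integral_estAt hk (fun v => scale_untopD_le (p := p) x G v) 𝒢]
  simp

theorem sum_card_filter_mem {𝒢 : Finset (Finset V)} (h3 : ∀ t ∈ 𝒢, t.card = 3) :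
    ∑ v, (𝒢.filter fun t => v ∈ t).card = 3 * 𝒢.card := by
  simp only [Finset.card_filter]
  rw [Finset.sum_comm]
  have : ∀ t ∈ 𝒢, (∑ v, if v ∈ t then 1 else 0) = 3 := by
    intro t ht
    rw [← Finset.card_filter, Finset.filter_univ_mem, h3 t ht]
  rw [Finset.sum_congr rfl this]
  simp [mul_comm]

/-- The variance of the estimate of one run, restricted to a set of triangles in which every vertex
is in at most `dV` and every edge in at most `dE` triangles. -/
theorem integral_run_sub_sq_le {dE dV M : ℝ} (hk : 1 ≤ p.k) (hTt : 0 < p.Tt)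
    {𝒢 : Finset (Finset V)} (h𝒢 : 𝒢 ⊆ triangles G)
    (hV : ∀ v, ((𝒢.filter fun t => v ∈ t).card : ℝ) ≤ dV)
    (hE : ∀ u v, u ≠ v → ((𝒢.filter fun t => u ∈ t ∧ v ∈ t).card : ℝ) ≤ dE)
    (hdE : 0 ≤ dE) (hkE : p.k * dE ≤ p.Tt) (hkV : p.k ^ 2 * dV ≤ p.Tt ^ 2) (hk3 : √p.k ^ 3 ≤ p.Tt)
    (hkω : p.k ^ 2 / p.omega ≤ p.Tt)
    (hω : ∀ v, p.omega * (𝒢.filter fun t => v ∈ t).card ≤ 2 * M)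
    (hTM : p.Tt ≤ M) (hM : (numTri G : ℝ) ≤ M) :
    ∫ s, (estAt p (scale p s G) 𝒢 s - 𝒢.card) ^ 2 ∂cube (Idx V) ≤ 1240 * M ^ 2 := by
  have h3 : ∀ t ∈ 𝒢, t.card = 3 := fun t ht => card_of_mem_triangles (h𝒢 ht)
  have hω1 := Params.one_le_omega hk
  have hcardT : (𝒢.card : ℝ) ≤ numTri G := by
    exact_mod_cast Finset.card_le_card h𝒢
  have hcond : ∀ x : Seed V, ∫ y, (estAt p (scale p (merge (firstPassCoords V) x y) G) 𝒢
      (merge (firstPassCoords V) x y) - 𝒢.card) ^ 2 ∂cube (Idx V) ≤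
        varBound p p.Tt dE (scale p x G) 𝒢 := by
    intro x
    simp only [scale_merge, estAt_merge]
    refine integral_estAt_sub_sq_le hk hk3 (fun j => ?_) (fun v => scale_untopD_le x G v) h3 hE
    refine le_trans ?_ hkω
    exact div_le_div_of_nonneg_left (by positivity) (by linarith) (Params.omega_le_weight hk j)
  refine (integral_le_of_merge (firstPassCoords V)
    (((bddMeas_estAt_scale p G 𝒢).sub (BddMeas.const _)).sq)
    (bddMeas_scale p G fun σ => varBound p p.Tt dE σ 𝒢) hcond).trans ?_
  unfold varBound
  have bN := bddMeas_scale p G (fun σ : V → WithTop ℕ => (heavyCount σ : ℝ))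
  have bC := fun v => bddMeas_scale p G (fun σ : V → WithTop ℕ => vertexCost p σ v)
  have hfirst : ∀ s : Seed V, (6 * p.k * dE + p.Tt + 3 * √p.k * dE * heavyCount (scale p s G)) *
      (𝒢.card : ℝ) = (6 * p.k * dE + p.Tt) * 𝒢.card +
        3 * √p.k * dE * 𝒢.card * heavyCount (scale p s G) := fun s => by ring
  simp only [hfirst, mul_comm (vertexCost _ _ _)]
  rw [integral_add ((((BddMeas.const _).add (bN.const_mul _))).integrable _)
    ((BddMeas.sum fun v _ => (bC v).const_mul _).integrable _),
    integral_add ((BddMeas.const _).integrable _) ((bN.const_mul _).integrable _),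
    integral_finsetSum _ fun v _ => ((bC v).const_mul _).integrable _]
  simp only [integral_const_mul, integral_const, probReal_univ, one_smul]
  have hM0 : 0 < M := hTt.trans_le hTM
  have hT0 : (0 : ℝ) ≤ numTri G := Nat.cast_nonneg _
  have hc0 : (0 : ℝ) ≤ 𝒢.card := Nat.cast_nonneg _
  have hcM : (𝒢.card : ℝ) ≤ M := hcardT.trans hM
  -- The three contributions are `7 M²`, `54 M²` and `3 · 392 M²`, together below `1240 M²`.
  have e1 : (6 * p.k * dE + p.Tt) * 𝒢.card ≤ 7 * M * M := by
    refine mul_le_mul (by linarith) hcM hc0 (by linarith)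
  have e2 : 3 * √p.k * dE * 𝒢.card * ∫ s, (heavyCount (scale p s G) : ℝ) ∂cube (Idx V) ≤
      54 * M * M := by
    have hs := Real.sqrt_nonneg p.k
    calc _ ≤ 3 * √p.k * dE * 𝒢.card * (18 * √p.k / p.Tt * numTri G) :=
          mul_le_mul_of_nonneg_left (integral_heavyCount_le hk hTt) (by positivity)
      _ = 54 * (√p.k * √p.k * dE) / p.Tt * (𝒢.card * numTri G) := by ring
      _ = 54 * (p.k * dE / p.Tt) * (𝒢.card * numTri G) := by
          rw [Real.mul_self_sqrt (by linarith)]; ring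
      _ ≤ 54 * 1 * (M * M) := by
          refine mul_le_mul (mul_le_mul_of_nonneg_left ((div_le_one hTt).mpr hkE) (by norm_num))
            (mul_le_mul hcM hM hT0 hM0.le) (by positivity) (by norm_num)
      _ = _ := by ring
  have e3 : ∀ v, ((𝒢.filter fun t => v ∈ t).card : ℝ) ^ 2 *
      ∫ s, vertexCost p (scale p s G) v ∂cube (Idx V) ≤
        ((𝒢.filter fun t => v ∈ t).card : ℝ) * (392 * M) := by
    intro v
    rcases Nat.eq_zero_or_pos (𝒢.filter fun t => v ∈ t).card with h0 | h0
    · rw [h0]; simp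
    · have hτ' : (0 : ℝ) < (𝒢.filter fun t => v ∈ t).card := by exact_mod_cast h0
      have h1 := integral_vertexCost_le hk hTt h𝒢 hE hkE v
        ((mul_le_mul_of_nonneg_left (hV v) (by positivity)).trans hkV) h0
      have h2 := hω v
      rw [pow_two, mul_assoc]
      refine mul_le_mul_of_nonneg_left ?_ hτ'.le
      calc _ ≤ ((𝒢.filter fun t => v ∈ t).card : ℝ) *
            (p.omega + 390 * p.Tt / (𝒢.filter fun t => v ∈ t).card) :=
            mul_le_mul_of_nonneg_left h1 hτ'.le
        _ = p.omega * (𝒢.filter fun t => v ∈ t).card + 390 * p.Tt := by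
            field_simp
        _ ≤ _ := by linarith
  have e4 : ∑ v, ((𝒢.filter fun t => v ∈ t).card : ℝ) ^ 2 *
      ∫ s, vertexCost p (scale p s G) v ∂cube (Idx V) ≤ 3 * M * (392 * M) := by
    refine (Finset.sum_le_sum fun v _ => e3 v).trans ?_
    rw [← Finset.sum_mul, ← Nat.cast_sum, sum_card_filter_mem h3]
    push_cast
    refine mul_le_mul_of_nonneg_right (by linarith) (by linarith)
  nlinarith

/-- If `k = 1`, the run keeps everything. -/
theorem estAt_mem_Icc_of_k_eq_one (hk : p.k = 1) {𝒢 : Finset (Finset V)} (s : Seed V) :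
    estAt p (scale p s G) 𝒢 s ∈ Set.Icc (0 : ℝ) 𝒢.card := by
  have hk1 : 1 ≤ p.k := hk.ge
  -- All boxes have measure one, so the normalised indicators only take the values zero and one.
  have hbox : ∀ t o, boxFun (itemSet t o) (levelBox p (lev (scale p s G) o)) s ≤ 1 := by
    intro t o
    have hw : ∀ j, p.weight j = 1 := fun j =>
      le_antisymm ((Params.weight_le_sqrt j).trans (by rw [hk, Real.sqrt_one]))
        (Params.one_le_weight hk1 j)
    rw [boxFun_eq_ite]
    split_ifs
    · refine (Finset.prod_eq_one fun i _ => ?_).le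
      rcases i with i | i | i
      · rw [volume_levelBox_inl hk1, hk]; simp
      · rw [volume_levelBox_mid hk1 (lev_le_top (fun v => scale_untopD_le s G v) o), hw]; simp
      · rw [volume_levelBox_inr hk1, hk, hw]; simp
    · exact zero_le_one
  unfold estAt
  refine ⟨Finset.sum_nonneg fun t _ => Finset.sum_nonneg fun o _ =>
    mul_nonneg (coef_nonneg _) (boxFun_nonneg _), ?_⟩
  have : ∀ t ∈ 𝒢, ∑ o, coef (scale p s G) t o *
      boxFun (itemSet t o) (levelBox p (lev (scale p s G) o)) s ≤ 1 := by
    intro t _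
    rw [← sum_coef (scale p s G) t]
    exact Finset.sum_le_sum fun o _ => mul_le_of_le_one_right (coef_nonneg _) (hbox t o)
  refine (Finset.sum_le_sum this).trans (by simp)

end RunVariance

section Good

open scoped Classical

/-! ### Truncated maxima -/

theorem exists_prefix {α : Type*} (s : Finset α) (f : α → ℕ) {b : ℝ} (hb : 0 ≤ b) :
    ∃ H : Finset α, H ⊆ s ∧ ((∑ x ∈ H, f x : ℕ) : ℝ) ≤ b ∧
      ∀ x ∈ s, x ∉ H → f x ≤ truncatedMax s f b := by
  have hperm : (descending s f).Perm s.toList := List.mergeSort_perm _ _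
  have hmem : ∀ x, x ∈ descending s f ↔ x ∈ s := fun x => by rw [hperm.mem_iff, Finset.mem_toList]
  have hnd : (descending s f).Nodup := hperm.nodup_iff.mpr s.nodup_toList
  set l := descending s f with hl
  set m := prefixLength s f b with hm
  have hspec : (((l.take m).map f).sum : ℝ) ≤ b := by
    have := Nat.findGreatest_spec (P := fun j => (((l.take j).map f).sum : ℝ) ≤ b)
      (Nat.zero_le l.length) (by simpa using hb)
    exact this
  refine ⟨(l.take m).toFinset, fun x hx => ?_, ?_, fun x hx hxH => ?_⟩
  · exact (hmem x).mp (List.mem_of_mem_take (List.mem_toFinset.mp hx))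
  · rwa [List.sum_toFinset _ (hnd.sublist (List.take_sublist _ _))]
  · have h1 : x ∈ l.drop m := by
      have : x ∈ l.take m ++ l.drop m := by rw [List.take_append_drop]; exact (hmem x).mpr hx
      rcases List.mem_append.mp this with h | h
      · exact absurd (List.mem_toFinset.mpr h) hxH
      · exact h
    have hfold : ∀ (L : List ℕ), ∀ y ∈ L, y ≤ L.foldr max 0 := by
      intro L
      induction L with
      | nil => simp
      | cons a L ih =>
        intro y hy
        rcases List.mem_cons.mp hy with rfl | h
        · exact le_max_left _ _
        · exact (ih y h).trans (le_max_right _ _)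
    exact hfold _ _ (List.mem_map_of_mem h1)

variable {V : Type*} [Fintype V]

/-- Most triangles avoid all vertices and edges that are in many triangles. -/
theorem exists_good_triangles (G : SimpleGraph V) {η : ℝ} (hη : 0 ≤ η) :
    ∃ 𝒢 ⊆ triangles G, ((triangles G \ 𝒢).card : ℝ) ≤ 2 * η * numTri G ∧
      (∀ v, (𝒢.filter fun t => v ∈ t).card ≤ DeltaV G η) ∧
      ∀ u v, u ≠ v → (𝒢.filter fun t => u ∈ t ∧ v ∈ t).card ≤ DeltaE G η := by
  have hb : 0 ≤ η * numTri G := mul_nonneg hη (Nat.cast_nonneg _)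
  obtain ⟨HV, -, hV1, hV2⟩ := exists_prefix Finset.univ (vertexTri G) hb
  obtain ⟨HE, -, hE1, hE2⟩ := exists_prefix (edges G) (edgeTri G) hb
  refine ⟨(triangles G).filter fun t => (∀ v ∈ HV, v ∉ t) ∧ ∀ e ∈ HE, ¬ ∀ x ∈ e, x ∈ t,
    Finset.filter_subset _ _, ?_, ?_, ?_⟩
  · have hsub : triangles G \ ((triangles G).filter fun t =>
        (∀ v ∈ HV, v ∉ t) ∧ ∀ e ∈ HE, ¬ ∀ x ∈ e, x ∈ t) ⊆
        (HV.biUnion fun v => (triangles G).filter fun t => v ∈ t) ∪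
          HE.biUnion fun e => (triangles G).filter fun t => ∀ x ∈ e, x ∈ t := by
      intro t ht
      simp only [Finset.mem_sdiff, Finset.mem_filter, not_and_or, not_forall, not_not] at ht
      obtain ⟨ht, h | ⟨v, hv, hvt⟩ | ⟨e, he, het⟩⟩ := ht
      · exact absurd ht h
      · exact Finset.mem_union_left _ (Finset.mem_biUnion.mpr
          ⟨v, hv, Finset.mem_filter.mpr ⟨ht, hvt⟩⟩)
      · exact Finset.mem_union_right _ (Finset.mem_biUnion.mpr
          ⟨e, he, Finset.mem_filter.mpr
            ⟨ht, fun x hx => by_contra fun h => het ⟨x, hx, h⟩⟩⟩)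
    have hcard : (triangles G \ ((triangles G).filter fun t =>
        (∀ v ∈ HV, v ∉ t) ∧ ∀ e ∈ HE, ¬ ∀ x ∈ e, x ∈ t)).card ≤
        ∑ v ∈ HV, vertexTri G v + ∑ e ∈ HE, edgeTri G e :=
      (Finset.card_le_card hsub).trans ((Finset.card_union_le _ _).trans
        (add_le_add Finset.card_biUnion_le Finset.card_biUnion_le))
    have : ((triangles G \ ((triangles G).filter fun t =>
        (∀ v ∈ HV, v ∉ t) ∧ ∀ e ∈ HE, ¬ ∀ x ∈ e, x ∈ t)).card : ℝ) ≤
        ((∑ v ∈ HV, vertexTri G v : ℕ) : ℝ) + ((∑ e ∈ HE, edgeTri G e : ℕ) : ℝ) := by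
      exact_mod_cast hcard
    linarith
  · intro v
    by_cases hv : v ∈ HV
    · rw [Finset.filter_eq_empty_iff.mpr, Finset.card_empty]
      · exact Nat.zero_le _
      · intro t ht
        exact (Finset.mem_filter.mp ht).2.1 v hv
    · exact (Finset.card_le_card (Finset.filter_subset_filter _ (Finset.filter_subset _ _))).trans
        (hV2 v (Finset.mem_univ v) hv)
  · intro u v huv
    -- The truncated maximum only speaks of edges outside `HE`. A single good triangle through `u`
    -- and `v` already shows that `uv` is such an edge; without one the count is zero.
    rcases Finset.eq_empty_or_nonempty (((triangles G).filter fun t => (∀ v ∈ HV, v ∉ t) ∧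
        ∀ e ∈ HE, ¬ ∀ x ∈ e, x ∈ t).filter fun t => u ∈ t ∧ v ∈ t) with h0 | ⟨t, ht⟩
    · rw [h0, Finset.card_empty]; exact Nat.zero_le _
    · simp only [Finset.mem_filter] at ht
      obtain ⟨⟨ht, -, htE⟩, hu, hv⟩ := ht
      have hadj : G.Adj u v := (mem_triangles.mp ht).isClique hu hv huv
      have he : s(u, v) ∈ edges G := by simpa [edges] using hadj
      have heH : s(u, v) ∉ HE := by
        intro h
        refine htE _ h fun x hx => ?_
        rcases Sym2.mem_iff.mp hx with rfl | rfl
        · exact hu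
        · exact hv
      refine le_trans (Finset.card_le_card ?_) (hE2 _ he heH)
      intro t' ht'
      simp only [Finset.mem_filter] at ht' ⊢
      refine ⟨ht'.1.1, fun x hx => ?_⟩
      rcases Sym2.mem_iff.mp hx with rfl | rfl
      · exact ht'.2.1
      · exact ht'.2.2

end Good

/-! ### The parameters chosen by the algorithm -/

section ParamsBounds

variable {Tt DV DE : ℝ}

theorem params_inv_k_pos (hTt : 1 ≤ Tt) :
    0 < min 1 (max (1 / Tt ^ (2 / 3 : ℝ)) (max (√DV / Tt) (DE / Tt))) := by
  have : 0 < 1 / Tt ^ (2 / 3 : ℝ) := by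
    have := Real.rpow_pos_of_pos (zero_lt_one.trans_le hTt) (2 / 3 : ℝ)
    positivity
  exact lt_min one_pos (this.trans_le (le_max_left _ _))

theorem one_le_params_k (hTt : 1 ≤ Tt) : 1 ≤ (params Tt DV DE).k :=
  (one_le_inv₀ (params_inv_k_pos hTt)).mpr (min_le_left _ _)

theorem params_k_le (hTt : 1 ≤ Tt) : (params Tt DV DE).k ≤ Tt ^ (2 / 3 : ℝ) := by
  have h0 := Real.rpow_pos_of_pos (zero_lt_one.trans_le hTt) (2 / 3 : ℝ)
  have h1 : 1 ≤ Tt ^ (2 / 3 : ℝ) := Real.one_le_rpow hTt (by norm_num)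
  refine inv_le_of_inv_le₀ h0 ?_
  rw [← one_div]
  exact le_min ((div_le_one h0).mpr h1) (le_max_left _ _)

theorem sqrt_params_k_pow (hTt : 1 ≤ Tt) : √(params Tt DV DE).k ^ 3 ≤ Tt := by
  have h1 := one_le_params_k (DV := DV) (DE := DE) hTt
  have h0 : 0 ≤ Tt := by linarith
  calc √(params Tt DV DE).k ^ 3 ≤ √(Tt ^ (2 / 3 : ℝ)) ^ 3 := by
        gcongr
        exact params_k_le hTt
    _ = Tt := by
        rw [Real.sqrt_eq_rpow, ← Real.rpow_natCast, ← Real.rpow_mul h0, ← Real.rpow_mul h0]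
        norm_num

/-- For `k > 1` the clipping of `1/k` at one is inactive, so each entry of the maximum bounds `k`
from above; at `k = 1` this can fail. -/
theorem params_inv_k (h : 1 < (params Tt DV DE).k) :
    1 / (params Tt DV DE).k = max (1 / Tt ^ (2 / 3 : ℝ)) (max (√DV / Tt) (DE / Tt)) := by
  have h1 : 1 / (params Tt DV DE).k =
      min 1 (max (1 / Tt ^ (2 / 3 : ℝ)) (max (√DV / Tt) (DE / Tt))) := by
    simp [params]
  rcases min_choice 1 (max (1 / Tt ^ (2 / 3 : ℝ)) (max (√DV / Tt) (DE / Tt))) with h2 | h2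
  · rw [h2] at h1
    have : 1 / (params Tt DV DE).k < 1 := (div_lt_one (by linarith)).mpr h
    linarith
  · rw [h1, h2]

theorem params_k_mul_DE (hTt : 1 ≤ Tt) (h : 1 < (params Tt DV DE).k) :
    (params Tt DV DE).k * DE ≤ Tt := by
  have h1 : DE / Tt ≤ 1 / (params Tt DV DE).k := by
    rw [params_inv_k h]
    exact (le_max_right _ _).trans (le_max_right _ _)
  rw [div_le_div_iff₀ (by linarith) (by linarith)] at h1
  linarith

theorem params_k_sq_mul_DV (hTt : 1 ≤ Tt) (hDV : 0 ≤ DV) (h : 1 < (params Tt DV DE).k) :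
    (params Tt DV DE).k ^ 2 * DV ≤ Tt ^ 2 := by
  have h1 : √DV / Tt ≤ 1 / (params Tt DV DE).k := by
    rw [params_inv_k h]
    exact (le_max_left _ _).trans (le_max_right _ _)
  rw [div_le_div_iff₀ (by linarith) (by linarith), one_mul] at h1
  calc (params Tt DV DE).k ^ 2 * DV = (√DV * (params Tt DV DE).k) ^ 2 := by
        rw [mul_pow, Real.sq_sqrt hDV, mul_comm]
    _ ≤ Tt ^ 2 := by gcongr

theorem params_omega (hTt : 1 ≤ Tt) :
    (params Tt DV DE).omega = min (max 2 (Tt / max 1 DV)) √(params Tt DV DE).k := by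
  have h0 : Tt ≠ 0 := by linarith
  simp only [Params.omega]
  congr 2
  show Tt ^ 2 / (Tt * max 1 DV) = Tt / max 1 DV
  rw [pow_two, mul_div_mul_left _ _ h0]

/-- This is the diagonal variance of a triangle counted at the least weight. If `ω` is uncapped, it
is at least `Tt / max 1 DV` and the bound is `k² max 1 DV ≤ Tt²`; if `ω = √k`, it is `k^(3/2) ≤ Tt`.
-/
theorem params_k_sq_div_omega (hTt : 1 ≤ Tt) (hDV : 0 ≤ DV) (h : 1 < (params Tt DV DE).k) :
    (params Tt DV DE).k ^ 2 / (params Tt DV DE).omega ≤ Tt := by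
  have hk3 := sqrt_params_k_pow (DV := DV) (DE := DE) hTt
  have hkV := params_k_sq_mul_DV hTt hDV h
  have hkE := params_k_le (DV := DV) (DE := DE) hTt
  rw [params_omega hTt]
  set k := (params Tt DV DE).k with hk
  have hs : 0 < √k := Real.sqrt_pos.mpr (by linarith)
  have hm : 0 < max 1 DV := lt_max_of_lt_left one_pos
  rcases min_choice (max 2 (Tt / max 1 DV)) √k with h2 | h2
  · rw [h2]
    have h3 : 0 < Tt / max 1 DV := by positivity
    have h5 : k ^ 2 * max 1 DV ≤ Tt ^ 2 := by
      rcases max_choice 1 DV with h4 | h4 <;> rw [h4]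
      · rw [mul_one]
        have : k ≤ Tt := hkE.trans (by
          conv_rhs => rw [← Real.rpow_one Tt]
          exact Real.rpow_le_rpow_of_exponent_le hTt (by norm_num))
        gcongr
      · exact hkV
    calc k ^ 2 / max 2 (Tt / max 1 DV) ≤ k ^ 2 / (Tt / max 1 DV) := by
          gcongr
          exact le_max_right _ _
      _ = k ^ 2 * max 1 DV / Tt := by field_simp
      _ ≤ Tt := by
          rw [div_le_iff₀ (by linarith)]
          linarith
  · rw [h2]
    calc k ^ 2 / √k = √k ^ 3 := by
          rw [div_eq_iff hs.ne', ← pow_succ]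
          calc k ^ 2 = (√k ^ 2) ^ 2 := by rw [Real.sq_sqrt (by linarith)]
            _ = _ := by ring
      _ ≤ Tt := hk3

open scoped Classical in
/-- The second moment of the error of one run on a set of triangles in which no vertex and no edge
is in more triangles than the algorithm expects. -/
theorem integral_run_error_sq_le {V : Type*} [Fintype V] (G : SimpleGraph V) {M : ℝ} (hTt : 1 ≤ Tt)
    (hDV : 0 ≤ DV) (hDE : 0 ≤ DE) {𝒢 : Finset (Finset V)} (h𝒢 : 𝒢 ⊆ triangles G)
    (hV : ∀ v, ((𝒢.filter fun t => v ∈ t).card : ℝ) ≤ DV)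
    (hE : ∀ u v, u ≠ v → ((𝒢.filter fun t => u ∈ t ∧ v ∈ t).card : ℝ) ≤ DE)
    (hTM : Tt ≤ M) (hM : (numTri G : ℝ) ≤ M) :
    ∫ s, (estAt (params Tt DV DE) (scale (params Tt DV DE) s G) 𝒢 s - 𝒢.card) ^ 2 ∂cube (Idx V) ≤
      1240 * M ^ 2 := by
  have hk1 := one_le_params_k (DV := DV) (DE := DE) hTt
  have hcard : (𝒢.card : ℝ) ≤ numTri G := by exact_mod_cast Finset.card_le_card h𝒢
  -- At `k = 1` the inequalities between `k`, `DV` and `DE` may fail, but the estimate is then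
  -- between `0` and the number of triangles.
  rcases hk1.eq_or_lt with hk | hk
  · have h : ∀ s : Seed V, (estAt (params Tt DV DE) (scale (params Tt DV DE) s G) 𝒢 s -
        𝒢.card) ^ 2 ≤ M ^ 2 := by
      intro s
      have := estAt_mem_Icc_of_k_eq_one (G := G) hk.symm (𝒢 := 𝒢) s
      have h1 := this.1
      have h2 := this.2
      nlinarith
    calc _ ≤ ∫ _, M ^ 2 ∂cube (Idx V) := by
          refine integral_mono ?_ ((BddMeas.const _).integrable _) h
          exact (((bddMeas_estAt_scale _ G 𝒢).sub (BddMeas.const _)).sq).integrable _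
      _ = M ^ 2 := by simp
      _ ≤ _ := by nlinarith [sq_nonneg M]
  · refine integral_run_sub_sq_le hk1 (show 0 < Tt by linarith) h𝒢 hV hE hDE
      (params_k_mul_DE hTt hk) (params_k_sq_mul_DV hTt hDV hk) (sqrt_params_k_pow hTt)
      (params_k_sq_div_omega hTt hDV hk) (fun v => ?_) hTM hM
    have hτT : ((𝒢.filter fun t => v ∈ t).card : ℝ) ≤ 𝒢.card := by
      exact_mod_cast Finset.card_le_card (Finset.filter_subset _ _)
    have hτV := hV v
    set τ : ℝ := ((𝒢.filter fun t => v ∈ t).card : ℝ)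
    have hτ0 : 0 ≤ τ := Nat.cast_nonneg _
    have h1 : (params Tt DV DE).omega ≤ max 2 (Tt / max 1 DV) := by
      rw [params_omega hTt]; exact min_le_left _ _
    have hm : 0 < max 1 DV := lt_max_of_lt_left one_pos
    refine (mul_le_mul_of_nonneg_right h1 hτ0).trans ?_
    rcases max_choice 2 (Tt / max 1 DV) with h2 | h2 <;> rw [h2]
    · linarith
    · calc Tt / max 1 DV * τ = Tt * (τ / max 1 DV) := by ring
        _ ≤ Tt * 1 := by
            refine mul_le_mul_of_nonneg_left ((div_le_one hm).mpr ?_) (by linarith)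
            exact hτV.trans (le_max_right _ _)
        _ ≤ _ := by linarith

end ParamsBounds

section Amplify

open scoped Classical

/-! ### Medians -/

/-- If the median missed the order-connected set `J`, then `J` would lie on one side of it, and all
sorted entries from the median to one end, at least half of them, would miss `J`. -/
theorem median_mem {n : ℕ} (hn : 0 < n) (x : Fin n → ℝ) {J : Set ℝ} (hJ : J.OrdConnected)
    (h : 2 * (Finset.univ.filter fun i => x i ∉ J).card < n) : median x ∈ J := by
  by_contra hmed
  unfold median at hmed
  set l := (Finset.univ.val.map x).sort (· ≤ ·) with hl
  have hlen : l.length = n := by simp [hl]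
  have hm : n / 2 < l.length := by omega
  rw [List.getD_eq_getElem _ _ hm] at hmed
  have hsorted : l.Pairwise (· ≤ ·) := Multiset.pairwise_sort _ _
  have hcount : (Finset.univ.filter fun i => x i ∉ J).card = l.countP fun y => decide (y ∉ J) := by
    rw [← Multiset.coe_countP, hl, Multiset.sort_eq, Multiset.countP_map]
    rfl
  have hle : ∀ i j (hi : i < l.length) (hj : j < l.length), i ≤ j → l[i] ≤ l[j] := by
    intro i j hi hj hij
    rcases hij.eq_or_lt with rfl | hij
    · exact le_rfl
    · exact List.pairwise_iff_getElem.mp hsorted i j hi hj hij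
  rw [hcount] at h
  by_cases hcase : ∃ a ∈ J, a < l[n / 2]
  · obtain ⟨a, ha, hal⟩ := hcase
    have hdrop : ∀ y ∈ l.drop (n / 2), y ∉ J := by
      intro y hy hyJ
      obtain ⟨i, hi, rfl⟩ := List.mem_iff_getElem.mp hy
      rw [List.getElem_drop] at hyJ
      exact hmed (hJ.out ha hyJ ⟨hal.le, hle _ _ _ _ (Nat.le_add_right _ _)⟩)
    have h1 : (l.drop (n / 2)).countP (fun y => decide (y ∉ J)) = (l.drop (n / 2)).length :=
      List.countP_eq_length.mpr fun y hy => by simpa using hdrop y hy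
    have h2 := (List.drop_sublist (n / 2) l).countP_le (p := fun y => decide (y ∉ J))
    rw [h1, List.length_drop, hlen] at h2
    omega
  · push Not at hcase
    have htake : ∀ y ∈ l.take (n / 2 + 1), y ∉ J := by
      intro y hy hyJ
      obtain ⟨i, hi, rfl⟩ := List.mem_iff_getElem.mp hy
      rw [List.getElem_take] at hyJ
      rw [List.length_take] at hi
      have h1 := hcase _ hyJ
      have h2 := hle i (n / 2) (by omega) hm (by omega)
      exact hmed (le_antisymm h1 h2 ▸ hyJ)
    have h1 : (l.take (n / 2 + 1)).countP (fun y => decide (y ∉ J)) = (l.take (n / 2 + 1)).length :=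
      List.countP_eq_length.mpr fun y hy => by simpa using htake y hy
    have h2 := (List.take_sublist (n / 2 + 1) l).countP_le (p := fun y => decide (y ∉ J))
    rw [h1, List.length_take, hlen] at h2
    omega

/-! ### Independent repetitions -/

section Repeat

variable {Ω : Type*} [MeasurableSpace Ω] (μ : Measure Ω) [IsProbabilityMeasure μ]

theorem integral_pi_eval {n : ℕ} {f : Ω → ℝ} (hf : BddMeas f) (i : Fin n) :
    ∫ s, f (s i) ∂(Measure.pi fun _ : Fin n => μ) = ∫ x, f x ∂μ := by
  have h := (measurePreserving_eval (fun _ : Fin n => μ) i).map_eq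
  conv_rhs => rw [← h]
  rw [integral_map (measurable_pi_apply i).aemeasurable hf.1.aestronglyMeasurable]

/-- Chebyshev's inequality for the mean of independent copies. -/
theorem measureReal_mean_sub_le {b : ℕ} (hb : 0 < b) {f : Ω → ℝ} (hf : BddMeas f) {m B a : ℝ}
    (hm : ∫ x, f x ∂μ = m) (hB : ∫ x, (f x - m) ^ 2 ∂μ ≤ B) (ha : 0 < a) :
    (Measure.pi fun _ : Fin b => μ).real {s | a ≤ |(∑ j, f (s j)) / b - m|} ≤ B / (b * a ^ 2) := by
  have hb' : (0 : ℝ) < b := by exact_mod_cast hb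
  have hX : BddMeas fun s : Fin b → Ω => ∑ j, f (s j) :=
    BddMeas.sum fun j _ => hf.comp (measurable_pi_apply j)
  have hint : ∫ s, ∑ j, f (s j) ∂(Measure.pi fun _ : Fin b => μ) = b * m := by
    rw [integral_finsetSum _ fun j _ => (hf.comp (measurable_pi_apply j)).integrable _]
    simp [integral_pi_eval μ hf, hm]
  have hvar : ProbabilityTheory.variance (fun s : Fin b → Ω => ∑ j, f (s j))
      (Measure.pi fun _ : Fin b => μ) ≤ b * B := by
    have h1 := ProbabilityTheory.variance_sum_pi (μ := fun _ : Fin b => μ) (X := fun _ => f)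
      fun _ => hf.memLp μ 2
    have h2 : (∑ i : Fin b, fun s : Fin b → Ω => f (s i)) = fun s => ∑ j, f (s j) := by
      funext s; simp
    rw [h2] at h1
    rw [h1, ProbabilityTheory.variance_eq_integral hf.1.aemeasurable, hm]
    simp only [Finset.sum_const, Finset.card_univ, Fintype.card_fin, nsmul_eq_mul]
    exact mul_le_mul_of_nonneg_left hB hb'.le
  have hcheb := ProbabilityTheory.meas_ge_le_variance_div_sq
    (hX.memLp (Measure.pi fun _ : Fin b => μ) 2) (mul_pos hb' ha)
  rw [hint] at hcheb
  have hset : {s : Fin b → Ω | a ≤ |(∑ j, f (s j)) / b - m|} =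
      {s | b * a ≤ |∑ j, f (s j) - b * m|} := by
    ext s
    simp only [Set.mem_ofPred_eq]
    have : ∑ j, f (s j) - b * m = b * ((∑ j, f (s j)) / b - m) := by field_simp
    rw [this, abs_mul, abs_of_pos hb', mul_le_mul_iff_right₀ hb']
  rw [hset]
  have hv0 := ProbabilityTheory.variance_nonneg (fun s : Fin b → Ω => ∑ j, f (s j))
      (Measure.pi fun _ : Fin b => μ)
  refine (ENNReal.toReal_le_of_le_ofReal (by positivity) hcheb).trans ?_
  calc _ ≤ b * B / (b * a) ^ 2 := by gcongr
    _ = _ := by field_simp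

/-- Markov's inequality for the mean of identically distributed nonnegative variables. -/
theorem measureReal_mean_ge_le {b : ℕ} (hb : 0 < b) {f : Ω → ℝ} (hf : BddMeas f)
    (h0 : ∀ x, 0 ≤ f x) {m a : ℝ} (hm : ∫ x, f x ∂μ ≤ m) (ha : 0 < a) :
    (Measure.pi fun _ : Fin b => μ).real {s | a ≤ (∑ j, f (s j)) / b} ≤ m / a := by
  have hb' : (0 : ℝ) < b := by exact_mod_cast hb
  have hX : BddMeas fun s : Fin b → Ω => (∑ j, f (s j)) / b := by
    simp only [div_eq_inv_mul]
    exact BddMeas.const_mul _ (BddMeas.sum fun j _ => hf.comp (measurable_pi_apply j))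
  have h := mul_meas_ge_le_integral_of_nonneg (μ := Measure.pi fun _ : Fin b => μ)
    (ae_of_all _ fun s => div_nonneg (Finset.sum_nonneg fun j _ => h0 (s j)) hb'.le)
    (hX.integrable _) a
  rw [integral_div, integral_finsetSum _ fun j _ =>
    (hf.comp (measurable_pi_apply j)).integrable _] at h
  simp only [integral_pi_eval μ hf, Finset.sum_const, Finset.card_univ, Fintype.card_fin,
    nsmul_eq_mul] at h
  rw [mul_div_cancel_left₀ _ hb'.ne'] at h
  rw [le_div_iff₀ ha]
  linarith

/-- If an event has probability at most `1 / 4`, it is unlikely to occur in at least half of `n`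
independent trials. -/
theorem measureReal_half_le (n : ℕ) {F : Set Ω} (hF : MeasurableSet F) (h : μ.real F ≤ 1 / 4) :
    (Measure.pi fun _ : Fin n => μ).real
      {s | n ≤ 2 * (Finset.univ.filter fun i => s i ∈ F).card} ≤ (√3 / 2) ^ n := by
  have h3 : 0 < √3 := by positivity
  have h33 : √3 * √3 = 3 := Real.mul_self_sqrt (by norm_num)
  -- An exponential Markov bound: `g` is `√3` on `F` and `1/√3` elsewhere, so the product over the
  -- trials is at least one when half of them lie in `F`. The base `√3` optimises the mean for
  -- probability `1/4`.
  set g : Ω → ℝ := fun x => (√3)⁻¹ + (√3 - (√3)⁻¹) * F.indicator (fun _ => (1 : ℝ)) x with hg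
  have hgb : BddMeas g := (BddMeas.const _).add ((BddMeas.indicator hF 1).const_mul _)
  have hinv : (√3)⁻¹ = √3 / 3 := by field_simp; linarith
  have hgin : ∀ x ∈ F, g x = √3 := by intro x hx; simp [hg, hx]
  have hgout : ∀ x ∉ F, g x = (√3)⁻¹ := by intro x hx; simp [hg, hx]
  have hg0 : ∀ x, 0 < g x := by
    intro x
    by_cases hx : x ∈ F
    · rw [hgin x hx]; exact h3
    · rw [hgout x hx]; positivity
  have hgint : ∫ x, g x ∂μ ≤ √3 / 2 := by
    rw [hg, integral_add ((BddMeas.const _).integrable μ)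
      (((BddMeas.indicator hF 1).const_mul _).integrable μ), integral_const_mul,
      integral_indicator_const _ hF]
    simp only [integral_const, probReal_univ, smul_eq_mul, mul_one, one_mul]
    rw [hinv]
    nlinarith
  have hprod : BddMeas fun s : Fin n → Ω => ∏ i, g (s i) :=
    BddMeas.prod fun i _ => hgb.comp (measurable_pi_apply i)
  have hmarkov := mul_meas_ge_le_integral_of_nonneg (μ := Measure.pi fun _ : Fin n => μ)
    (ae_of_all _ fun s => Finset.prod_nonneg fun i _ => (hg0 (s i)).le) (hprod.integrable _) 1
  rw [one_mul, integral_fintype_prod_eq_pow, Fintype.card_fin] at hmarkov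
  refine le_trans (measureReal_mono fun s hs => ?_) (hmarkov.trans ?_)
  · simp only [Set.mem_ofPred_eq] at hs ⊢
    rw [← Finset.prod_filter_mul_prod_filter_not Finset.univ (fun i => s i ∈ F),
      Finset.prod_congr rfl fun i hi => hgin _ (Finset.mem_filter.mp hi).2,
      Finset.prod_congr (s₁ := Finset.univ.filter fun i => ¬ s i ∈ F) rfl
        fun i hi => hgout _ (Finset.mem_filter.mp hi).2, Finset.prod_const, Finset.prod_const]
    have hcard := Finset.card_filter_add_card_filter_not (s := (Finset.univ : Finset (Fin n)))
      (fun i => s i ∈ F)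
    rw [Finset.card_univ, Fintype.card_fin] at hcard
    have h1 : 1 ≤ √3 := by rw [Real.one_le_sqrt]; norm_num
    rw [inv_pow, ← div_eq_mul_inv, one_le_div (by positivity)]
    exact pow_le_pow_right₀ h1 (by omega)
  · exact pow_le_pow_left₀ (integral_nonneg fun x => (hg0 x).le) hgint n

end Repeat

/-- The constant `8` comes from `log (√3 / 2) = log (3/4) / 2 ≤ -1/8`. -/
theorem pow_numBlocks_le {δ : ℝ} (hδ : 0 < δ) : (√3 / 2) ^ numBlocks 8 δ ≤ δ := by
  have h34 : 0 < √3 / 2 := by positivity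
  have hlog : Real.log (√3 / 2) ≤ -(1 / 8) := by
    have h1 : Real.log ((√3 / 2) ^ 2) = 2 * Real.log (√3 / 2) := by
      rw [Real.log_pow]; norm_num
    have h2 : (√3 / 2) ^ 2 = 3 / 4 := by
      rw [div_pow, Real.sq_sqrt (by norm_num)]; norm_num
    have h3 := Real.log_le_sub_one_of_pos (show (0 : ℝ) < 3 / 4 by norm_num)
    rw [h2] at h1
    linarith
  have hn : 8 * Real.log (1 / δ) ≤ numBlocks 8 δ := Nat.le_ceil _
  rw [one_div, Real.log_inv] at hn
  rw [← Real.log_le_log_iff (by positivity) hδ, Real.log_pow]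
  have hn0 : (0 : ℝ) ≤ numBlocks 8 δ := Nat.cast_nonneg _
  nlinarith

theorem numBlocks_pos {δ : ℝ} (hδ : 0 < δ) (hδ2 : δ ≤ 1 / 2) : 0 < numBlocks 8 δ := by
  refine Nat.ceil_pos.mpr ?_
  have : 0 < Real.log (1 / δ) := Real.log_pos (by rw [lt_div_iff₀ hδ]; linarith)
  linarith

end Amplify

/-! ### Correctness of the median of means -/

section Correct

open scoped Classical

variable {V : Type*} [Fintype V]

theorem estAt_add_sdiff (p : Params) (σ : V → WithTop ℕ) {𝒢 𝒢' : Finset (Finset V)} (h : 𝒢 ⊆ 𝒢')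
    (s : Seed V) : estAt p σ 𝒢 s + estAt p σ (𝒢' \ 𝒢) s = estAt p σ 𝒢' s := by
  unfold estAt
  rw [add_comm]
  exact Finset.sum_sdiff h

theorem estAt_nonneg (p : Params) (σ : V → WithTop ℕ) (𝒢 : Finset (Finset V)) (s : Seed V) :
    0 ≤ estAt p σ 𝒢 s :=
  Finset.sum_nonneg fun _ _ => Finset.sum_nonneg fun _ _ =>
    mul_nonneg (coef_nonneg _) (boxFun_nonneg _)

variable (G : SimpleGraph V) {Tt DV DE ε δ : ℝ}

/-- The median of means lies in `J` with probability at least `1 - δ` if the mean of a block lies in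
`J` whenever the error on the good triangles is less than `a` and the contribution of the bad
triangles is less than `d`. -/
theorem seedMeasure_combined_notMem_le {M a d : ℝ} {b : ℕ} {𝒢 : Finset (Finset V)} {J : Set ℝ}
    (hTt : 1 ≤ Tt) (hδ : 0 < δ) (hδ2 : δ ≤ 1 / 2) (hDV : 0 ≤ DV) (hDE : 0 ≤ DE)
    (h𝒢 : 𝒢 ⊆ triangles G)
    (hV : ∀ v, ((𝒢.filter fun t => v ∈ t).card : ℝ) ≤ DV)
    (hE : ∀ u v, u ≠ v → ((𝒢.filter fun t => u ∈ t ∧ v ∈ t).card : ℝ) ≤ DE)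
    (hTM : Tt ≤ M) (hM : (numTri G : ℝ) ≤ M) (hb : 0 < b) (ha : 0 < a) (hd : 0 < d)
    (hJ : J.OrdConnected)
    (hJmem : ∀ x y, |x - (𝒢.card : ℝ)| < a → 0 ≤ y → y < d → x + y ∈ J)
    (hfail : 1240 * M ^ 2 / (b * a ^ 2) + ((triangles G \ 𝒢).card : ℝ) / d ≤ 1 / 4) :
    seedMeasure V (numBlocks 8 δ) b {s | combined (params Tt DV DE) s G ∉ J} ≤
      ENNReal.ofReal δ := by
  set p := params Tt DV DE with hp
  have hk := one_le_params_k (DV := DV) (DE := DE) hTt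
  have hfg := bddMeas_estAt_scale p G 𝒢
  have hfb := bddMeas_estAt_scale p G (triangles G \ 𝒢)
  set ν : Measure (Fin b → Seed V) := Measure.pi fun _ => cube (Idx V) with hν
  have hrun : ∀ s : Seed V, runOutput p s G = estAt p (scale p s G) 𝒢 s +
      estAt p (scale p s G) (triangles G \ 𝒢) s := by
    intro s
    rw [runOutput_eq_estimate hk, estimate_eq_estAt hk, estAt_add_sdiff _ _ h𝒢]
  have hb1 := measureReal_mean_sub_le (cube (Idx V)) hb hfg (integral_estAt_scale hk 𝒢)
    (integral_run_error_sq_le G hTt hDV hDE h𝒢 hV hE hTM hM) ha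
  have hb2 := measureReal_mean_ge_le (cube (Idx V)) hb hfb (fun s => estAt_nonneg _ _ _ _)
    (integral_estAt_scale hk _).le hd
  set F : Set (Fin b → Seed V) := {s | (∑ j, runOutput p (s j) G) / b ∉ J} with hF
  have hFm : MeasurableSet F := by
    have hm : Measurable fun s : Fin b → Seed V => (∑ j, runOutput p (s j) G) / b := by
      simp only [hrun]
      exact (BddMeas.sum fun j _ => (hfg.add hfb).comp (measurable_pi_apply j)).1.div_const _
    exact hm hJ.measurableSet.compl
  have hF4 : ν.real F ≤ 1 / 4 := by
    refine le_trans ?_ ((measureReal_union_le _ _).trans ((add_le_add hb1 hb2).trans hfail))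
    refine measureReal_mono (fun s hs => ?_) (measure_ne_top _ _)
    by_contra hn
    simp only [Set.mem_union, Set.mem_ofPred_eq, not_or, not_le] at hn
    refine hs ?_
    have := hJmem _ _ hn.1 (div_nonneg (Finset.sum_nonneg fun j _ => estAt_nonneg _ _ _ _)
      (Nat.cast_nonneg b)) hn.2
    rw [← add_div, ← Finset.sum_add_distrib] at this
    simpa only [hrun] using this
  have hamp := (measureReal_half_le ν (numBlocks 8 δ) hFm hF4).trans (pow_numBlocks_le hδ)
  have hsub : {s : Seeds V (numBlocks 8 δ) b | combined p s G ∉ J} ⊆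
      {s | numBlocks 8 δ ≤ 2 * (Finset.univ.filter fun i => s i ∈ F).card} := by
    intro s hs
    by_contra hn
    simp only [Set.mem_ofPred_eq, not_le] at hn
    exact hs (median_mem (numBlocks_pos hδ hδ2) _ hJ hn)
  have hmeas : seedMeasure V (numBlocks 8 δ) b = Measure.pi fun _ => ν := rfl
  rw [hmeas]
  refine (measure_mono hsub).trans ?_
  rw [ENNReal.le_ofReal_iff_toReal_le (measure_ne_top _ _) hδ.le, ← measureReal_def]
  refine le_trans (le_of_eq ?_) hamp
  congr!

theorem ofReal_one_sub_le {Ω : Type*} [MeasurableSpace Ω] {μ : Measure Ω} [IsProbabilityMeasure μ]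
    {A B : Set Ω} (hδ : 0 ≤ δ) (h : μ A ≤ ENNReal.ofReal δ) (hB : ∀ x, x ∉ A → x ∈ B) :
    ENNReal.ofReal (1 - δ) ≤ μ B := by
  rw [ENNReal.ofReal_sub _ hδ, ENNReal.ofReal_one, tsub_le_iff_right]
  calc (1 : ℝ≥0∞) = μ Set.univ := measure_univ.symm
    _ ≤ μ (B ∪ A) := measure_mono fun x _ => by
        by_cases hx : x ∈ A
        · exact Or.inr hx
        · exact Or.inl (hB x hx)
    _ ≤ μ B + μ A := measure_union_le _ _
    _ ≤ _ := by gcongr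

instance (n b : ℕ) : IsProbabilityMeasure (seedMeasure V n b) := by
  have : seedMeasure V n b = Measure.pi fun _ => Measure.pi fun _ => cube (Idx V) := rfl
  rw [this]
  infer_instance

/-- The median of means if the guess is at most twice the number of triangles. -/
theorem seedMeasure_combined_of_le (hTt : 1 ≤ Tt) (hε : 0 < ε) (hδ : 0 < δ)
    (hδ2 : δ ≤ 1 / 2) (hDV : (DeltaV G (ε / 24) : ℝ) ≤ DV) (hDE : (DeltaE G (ε / 24) : ℝ) ≤ DE)
    (hT : Tt ≤ 2 * numTri G) :
    seedMeasure V (numBlocks 8 δ) (blockSize (10 ^ 8) ε) {s | combined (params Tt DV DE) s G ∉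
      Set.Icc ((1 - ε / 4) * numTri G : ℝ) ((1 + ε) * numTri G)} ≤ ENNReal.ofReal δ := by
  obtain ⟨𝒢, h𝒢, hbad, hV, hE⟩ := exists_good_triangles G (show 0 ≤ ε / 24 by positivity)
  set T : ℝ := (numTri G : ℝ) with hTdef
  have hT0 : 0 < T := by linarith
  have hb : (10 ^ 8 : ℝ) / ε ^ 2 ≤ blockSize (10 ^ 8) ε := Nat.le_ceil _
  have hb0 : (0 : ℝ) < blockSize (10 ^ 8) ε := lt_of_lt_of_le (by positivity) hb
  have hcard : (𝒢.card : ℝ) + ((triangles G \ 𝒢).card : ℝ) = T := by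
    have := Finset.card_sdiff_add_card_eq_card h𝒢
    rw [hTdef, numTri, ← this]; push_cast; ring
  have hbad0 : (0 : ℝ) ≤ (triangles G \ 𝒢).card := Nat.cast_nonneg _
  have hεT : 0 < ε * T := by positivity
  -- The budget is asymmetric because bad triangles only add. Below, `ε/12 + ε/8 ≤ ε/4`, so the
  -- median is at least `3T/4`; above, `1/8 + 7/8 = 1`. The larger upper budget makes Markov fail
  -- with probability at most `(1/12) / (7/8) = 2/21`.
  refine seedMeasure_combined_notMem_le G (M := 2 * T) (a := ε * T / 8) (d := 7 / 8 * (ε * T)) hTt hδ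
    hδ2 ((Nat.cast_nonneg _).trans hDV) ((Nat.cast_nonneg _).trans hDE) h𝒢
    (fun v => (Nat.cast_le.mpr (hV v)).trans hDV)
    (fun u v huv => (Nat.cast_le.mpr (hE u v huv)).trans hDE) hT (by linarith)
    (by exact_mod_cast hb0) (by positivity) (by positivity) Set.ordConnected_Icc ?_ ?_
  · intro x y hx hy hyd
    rw [abs_lt] at hx
    constructor <;> nlinarith
  · have h1 : 1240 * (2 * T) ^ 2 / (blockSize (10 ^ 8) ε * (ε * T / 8) ^ 2) ≤ 1 / 100 := by
      rw [div_le_iff₀ (by positivity)]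
      rw [div_le_iff₀ (by positivity)] at hb
      have h2 : (blockSize (10 ^ 8) ε : ℝ) * (ε * T / 8) ^ 2 =
          (blockSize (10 ^ 8) ε * ε ^ 2) * (T ^ 2 / 64) := by ring
      rw [h2]
      have h3 := mul_le_mul_of_nonneg_right hb (show 0 ≤ T ^ 2 / 64 by positivity)
      nlinarith [sq_nonneg T]
    have h2 : ((triangles G \ 𝒢).card : ℝ) / (7 / 8 * (ε * T)) ≤ 2 / 21 := by
      rw [div_le_iff₀ (by positivity)]
      linarith
    linarith

/-- The median of means if the guess is more than twice the number of triangles. -/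
theorem seedMeasure_combined_of_lt (hTt : 1 ≤ Tt) (hε : 0 < ε) (hε1 : ε ≤ 1) (hδ : 0 < δ)
    (hδ2 : δ ≤ 1 / 2) (hDV : (DeltaV G (ε / 24) : ℝ) ≤ DV) (hDE : (DeltaE G (ε / 24) : ℝ) ≤ DE)
    (hT : 2 * numTri G < Tt) :
    seedMeasure V (numBlocks 8 δ) (blockSize (10 ^ 8) ε) {s | combined (params Tt DV DE) s G ∉
      Set.Iio (3 / 4 * Tt)} ≤ ENNReal.ofReal δ := by
  obtain ⟨𝒢, h𝒢, hbad, hV, hE⟩ := exists_good_triangles G (show 0 ≤ ε / 24 by positivity)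
  set T : ℝ := (numTri G : ℝ) with hTdef
  have hT0 : 0 ≤ T := Nat.cast_nonneg _
  have hb : (10 ^ 8 : ℝ) / ε ^ 2 ≤ blockSize (10 ^ 8) ε := Nat.le_ceil _
  have hb1 : (10 ^ 8 : ℝ) ≤ blockSize (10 ^ 8) ε := by
    refine le_trans ?_ hb
    rw [le_div_iff₀ (by positivity)]
    have : ε ^ 2 ≤ 1 := pow_le_one₀ hε.le hε1
    linarith
  have hb0 : (0 : ℝ) < blockSize (10 ^ 8) ε := lt_of_lt_of_le (by norm_num) hb1
  have hcard : (𝒢.card : ℝ) + ((triangles G \ 𝒢).card : ℝ) = T := by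
    have := Finset.card_sdiff_add_card_eq_card h𝒢
    rw [hTdef, numTri, ← this]; push_cast; ring
  have hbad0 : (0 : ℝ) ≤ (triangles G \ 𝒢).card := Nat.cast_nonneg _
  have hεT : ε * T ≤ T := by nlinarith
  -- Here `T < Tt/2`, and `1/2 + 1/24 + 1/5 < 3/4`. The bad triangles number at most `Tt/24`, so
  -- Markov fails with probability at most `5/24`.
  refine seedMeasure_combined_notMem_le G (M := Tt) (a := Tt / 24) (d := Tt / 5) hTt hδ
    hδ2 ((Nat.cast_nonneg _).trans hDV) ((Nat.cast_nonneg _).trans hDE) h𝒢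
    (fun v => (Nat.cast_le.mpr (hV v)).trans hDV)
    (fun u v huv => (Nat.cast_le.mpr (hE u v huv)).trans hDE) le_rfl (by linarith)
    (by exact_mod_cast hb0) (by positivity) (by positivity) Set.ordConnected_Iio ?_ ?_
  · intro x y hx hy hyd
    rw [abs_lt] at hx
    rw [Set.mem_Iio]
    linarith
  · have h1 : 1240 * Tt ^ 2 / (blockSize (10 ^ 8) ε * (Tt / 24) ^ 2) ≤ 1 / 100 := by
      rw [div_le_iff₀ (by positivity)]
      have h3 := mul_le_mul_of_nonneg_right hb1 (show 0 ≤ (Tt / 24) ^ 2 by positivity)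
      nlinarith [sq_nonneg Tt]
    have h2 : ((triangles G \ 𝒢).card : ℝ) / (Tt / 5) ≤ 5 / 24 := by
      rw [div_le_iff₀ (by positivity)]
      linarith
    linarith

theorem answer_of_le {n b : ℕ} {p : Params} {s : Seeds V n b} (h : 3 / 4 * p.Tt ≤ combined p s G) :
    answer p s G = some (combined p s G) := if_pos h

theorem answer_of_lt {n b : ℕ} {p : Params} {s : Seeds V n b} (h : combined p s G < 3 / 4 * p.Tt) :
    answer p s G = none := if_neg (not_le.mpr h)

theorem isApprox_of_mem {n b : ℕ} {p : Params} {s : Seeds V n b}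
    (h : 3 / 4 * p.Tt ≤ combined p s G)
    (hJ : combined p s G ∈ Set.Icc ((1 - ε / 4) * numTri G : ℝ) ((1 + ε) * numTri G)) :
    IsApprox G ε (answer p s G) := by
  have hT0 : (0 : ℝ) ≤ numTri G := Nat.cast_nonneg _
  have h1 := hJ.1
  have h2 := hJ.2
  refine ⟨_, answer_of_le G h, abs_le.mpr ⟨?_, ?_⟩⟩ <;> nlinarith

theorem seedMeasure_isApprox (hTt : 1 ≤ Tt) (hε : 0 < ε) (hε1 : ε ≤ 1) (hδ : 0 < δ)
    (hδ2 : δ ≤ 1 / 2) (hDV : (DeltaV G (ε / 24) : ℝ) ≤ DV) (hDE : (DeltaE G (ε / 24) : ℝ) ≤ DE)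
    (hT : Tt ≤ numTri G) :
    ENNReal.ofReal (1 - δ) ≤ seedMeasure V (numBlocks 8 δ) (blockSize (10 ^ 8) ε)
      {s | IsApprox G ε (answer (params Tt DV DE) s G)} := by
  refine ofReal_one_sub_le hδ.le (seedMeasure_combined_of_le G hTt hε hδ hδ2 hDV hDE
    (by linarith)) fun s hs => ?_
  have hs' := not_not.mp hs
  refine isApprox_of_mem G ?_ hs'
  refine le_trans ?_ hs'.1
  show 3 / 4 * Tt ≤ _
  nlinarith

/-- For a guess up to `2T` the median is accurate, so either verdict is allowed. For a larger guess
it may be inaccurate, but it stays below the acceptance threshold. -/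
theorem seedMeasure_none_or_isApprox (hTt : 1 ≤ Tt) (hε : 0 < ε) (hε1 : ε ≤ 1) (hδ : 0 < δ)
    (hδ2 : δ ≤ 1 / 2) (hDV : (DeltaV G (ε / 24) : ℝ) ≤ DV) (hDE : (DeltaE G (ε / 24) : ℝ) ≤ DE) :
    ENNReal.ofReal (1 - δ) ≤ seedMeasure V (numBlocks 8 δ) (blockSize (10 ^ 8) ε)
      {s | answer (params Tt DV DE) s G = none ∨ IsApprox G ε (answer (params Tt DV DE) s G)} := by
  by_cases hT : Tt ≤ 2 * numTri G
  · refine ofReal_one_sub_le hδ.le (seedMeasure_combined_of_le G hTt hε hδ hδ2 hDV hDE hT)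
      fun s hs => ?_
    have hs' := not_not.mp hs
    by_cases h : 3 / 4 * (params Tt DV DE).Tt ≤ combined (params Tt DV DE) s G
    · exact Or.inr (isApprox_of_mem G h hs')
    · exact Or.inl (answer_of_lt G (not_le.mp h))
  · refine ofReal_one_sub_le hδ.le (seedMeasure_combined_of_lt G hTt hε hε1 hδ hδ2 hDV hDE
      (not_le.mp hT)) fun s hs => ?_
    exact Or.inl (answer_of_lt G (not_not.mp hs))

end Correct

section Cost

open scoped Classical

/-! ### The number of kept edges -/

theorem measureReal_cube_box {ι : Type*} [Fintype ι] (S : Finset ι) (A : ι → Set unitInterval) :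
    (cube ι).real {x | ∀ i ∈ S, x i ∈ A i} = ∏ i ∈ S, volume.real (A i) := by
  have h : {x : ι → unitInterval | ∀ i ∈ S, x i ∈ A i} =
      Set.pi Set.univ fun i => if i ∈ S then A i else Set.univ := by
    ext x
    simp only [Set.mem_ofPred_eq, Set.mem_pi, Set.mem_univ, true_imp_iff]
    refine forall_congr' fun i => ?_
    by_cases hi : i ∈ S <;> simp [hi]
  rw [h, measureReal_def, cube, Measure.pi_pi, ENNReal.toReal_prod, ← Finset.prod_subset
    (Finset.subset_univ S)]
  · exact Finset.prod_congr rfl fun i hi => by rw [if_pos hi, measureReal_def]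
  · intro i _ hi
    rw [if_neg hi]
    simp

variable {V : Type*} {p : Params}

theorem SameBits.symm {s s' : Seed V} (h : SameBits p s s') : SameBits p s' s :=
  fun i r hr => (h i r hr).symm

theorem hEq_iff {s : Seed V} {v : V} {j : ℕ} :
    hEq p s v j ↔ j ≤ p.top ∧ s (.inr (.inl v)) ∈ levelBox p j (.inr (.inl v)) := Iff.rfl

theorem SameBits.keep_subset {s s' : Seed V} (h : SameBits p s s') : keep p s ⊆ keep p s' := by
  rintro e ⟨u, v, he, h'⟩
  refine ⟨u, v, he, ?_⟩
  have hq : ∀ j, hEq p s u j → hEq p s' u j := fun j hj =>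
    hEq_iff.mpr ⟨hj.1, (h.levelBox hj.1 _).mp (hEq_iff.mp hj).2⟩
  rcases h' with ⟨i, h1, h2⟩ | ⟨i, h1, h2⟩ | ⟨h1, h2⟩ | ⟨i, j, h1, h2, h3⟩ | ⟨j, h1, h2, h3⟩
  · exact Or.inl ⟨i, (h.inv_sqrt _).mp h1, (h.inv_sqrt _).mp h2⟩
  · exact Or.inr (Or.inl ⟨i, (h.inv_sqrt _).mp h1, (h.inv_sqrt _).mp h2⟩)
  · exact Or.inr (Or.inr (Or.inl ⟨(h.inv_sqrt _).mp h1, (h.inv_sqrt _).mp h2⟩))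
  · exact Or.inr (Or.inr (Or.inr (Or.inl
      ⟨i, j, hq j h1, (h.weight _ h1.1).mp h2, (h.inv_sqrt _).mp h3⟩)))
  · exact Or.inr (Or.inr (Or.inr (Or.inr
      ⟨j, hq j h1, (h.weight _ h1.1).mp h2, (h.inv_sqrt _).mp h3⟩)))

theorem SameBits.keep_eq {s s' : Seed V} (h : SameBits p s s') : keep p s = keep p s' :=
  h.keep_subset.antisymm h.symm.keep_subset

/-- The pairs of vertices such that both are sampled. -/
noncomputable def vertexPair (i : Fin 3 × Fin 3) (u v : V) : Finset (Idx V) := {.inl (i.1, u), .inl (i.2, v)}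

/-- The coordinates that decide whether the pair `uv` is sampled through the level of `u`. -/
noncomputable def levelPair (i : Fin 3) (u v : V) : Finset (Idx V) :=
  {.inl (i, v), .inr (.inl u), .inr (.inr (i, s(u, v)))}

/-- The event that a pair of vertices is kept in a given orientation. -/
def keepDir (p : Params) (u v : V) : Set (Seed V) :=
  (⋃ i : Fin 3 × Fin 3, {s | ∀ x ∈ vertexPair i u v, s x ∈ levelBox p 0 x}) ∪
    ⋃ j ∈ Finset.range (p.top + 1), ⋃ i : Fin 3, {s | ∀ x ∈ levelPair i u v, s x ∈ levelBox p j x}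

theorem mem_keepDir_of_mem_keep {s : Seed V} {a b : V} (h : s(a, b) ∈ keep p s) :
    s ∈ keepDir p a b ∪ keepDir p b a := by
  obtain ⟨u, v, he, h⟩ := h
  have hs : s ∈ keepDir p u v := by
    have hvp : ∀ i : Fin 3 × Fin 3, (s (.inl (i.1, u)) : ℝ) < 1 / √p.k →
        (s (.inl (i.2, v)) : ℝ) < 1 / √p.k → s ∈ keepDir p u v := by
      intro i h1 h2
      refine Or.inl (Set.mem_iUnion.mpr ⟨i, fun x hx => ?_⟩)
      rcases Finset.mem_insert.mp hx with rfl | hx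
      · exact h1
      · rw [Finset.mem_singleton.mp hx]; exact h2
    have hlp : ∀ (i : Fin 3) (j : ℕ), hEq p s u j →
        (s (.inr (.inr (i, s(u, v)))) : ℝ) < p.weight j / √p.k →
        (s (.inl (i, v)) : ℝ) < 1 / √p.k → s ∈ keepDir p u v := by
      intro i j h1 h2 h3
      refine Or.inr (Set.mem_biUnion (Finset.mem_range.mpr (Nat.lt_succ_of_le h1.1))
        (Set.mem_iUnion.mpr ⟨i, fun x hx => ?_⟩))
      rcases Finset.mem_insert.mp hx with rfl | hx
      · exact h3
      rcases Finset.mem_insert.mp hx with rfl | hx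
      · exact (hEq_iff.mp h1).2
      · rw [Finset.mem_singleton.mp hx]; exact h2
    rw [he] at h
    rcases h with ⟨i, h1, h2⟩ | ⟨i, h1, h2⟩ | ⟨h1, h2⟩ | ⟨i, j, h1, h2, h3⟩ | ⟨j, h1, h2, h3⟩
    · exact hvp (i.succ, i.succ) h1 h2
    · exact hvp (0, i.succ) h1 h2
    · exact hvp (0, 0) h1 h2
    · exact hlp i.succ j h1 h2 h3
    · exact hlp 0 j h1 h2 h3
  rcases Sym2.eq_iff.mp he with ⟨rfl, rfl⟩ | ⟨rfl, rfl⟩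
  · exact Or.inl hs
  · exact Or.inr hs

variable [Fintype V]

/-- The weight cancels: keeping a pair through level `j` has probability `(1/√k) (1/w_j) (w_j/√k) =
1/k`. A union bound over nine pairs of vertex bits and three hash copies per level gives `(9 + 3
(top + 1)) / k`. -/
theorem measureReal_keepDir_le (hk : 1 ≤ p.k) {u v : V} (huv : u ≠ v) :
    (cube (Idx V)).real (keepDir p u v) ≤ 12 * ((p.top + 1) / p.k) := by
  have hs := Params.one_le_sqrt_k hk
  have hk0 : 0 < p.k := by linarith
  have hss : √p.k * √p.k = p.k := Real.mul_self_sqrt hk0.le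
  have hvp : ∀ i : Fin 3 × Fin 3,
      (cube (Idx V)).real {s | ∀ x ∈ vertexPair i u v, s x ∈ levelBox p 0 x} = 1 / p.k := by
    intro i
    rw [measureReal_cube_box, vertexPair, Finset.prod_pair (by simp [huv]),
      volume_levelBox_inl hk, volume_levelBox_inl hk, div_mul_div_comm, hss, one_mul]
  have hlp : ∀ j ≤ p.top, ∀ i : Fin 3,
      (cube (Idx V)).real {s | ∀ x ∈ levelPair i u v, s x ∈ levelBox p j x} = 1 / p.k := by
    intro j hj i
    have hw := Params.weight_pos hk j
    rw [measureReal_cube_box, levelPair, Finset.prod_insert (by simp), Finset.prod_pair (by simp),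
      volume_levelBox_inl hk, volume_levelBox_mid hk hj, volume_levelBox_inr hk]
    have h1k : 1 / p.k = 1 / √p.k * (1 / √p.k) := by rw [div_mul_div_comm, hss, one_mul]
    rw [h1k]
    field_simp
  have h1 : (cube (Idx V)).real
      (⋃ i : Fin 3 × Fin 3, {s | ∀ x ∈ vertexPair i u v, s x ∈ levelBox p 0 x}) ≤ 9 * (1 / p.k) := by
    refine (measureReal_iUnion_fintype_le _).trans (le_of_eq ?_)
    simp only [hvp, Finset.sum_const, Finset.card_univ, Fintype.card_prod, Fintype.card_fin,
      nsmul_eq_mul]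
    norm_num
  have h2 : (cube (Idx V)).real (⋃ j ∈ Finset.range (p.top + 1), ⋃ i : Fin 3,
      {s | ∀ x ∈ levelPair i u v, s x ∈ levelBox p j x}) ≤ (p.top + 1) * (3 * (1 / p.k)) := by
    refine (measureReal_biUnion_finset_le _ _).trans ?_
    refine (Finset.sum_le_card_nsmul _ _ (3 * (1 / p.k)) fun j hj => ?_).trans (le_of_eq ?_)
    · refine (measureReal_iUnion_fintype_le _).trans (le_of_eq ?_)
      simp only [hlp j (Nat.lt_succ_iff.mp (Finset.mem_range.mp hj)), Finset.sum_const,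
        Finset.card_univ, Fintype.card_fin, nsmul_eq_mul]
      norm_num
    · rw [Finset.card_range, nsmul_eq_mul]; push_cast; rfl
  refine (measureReal_union_le _ _).trans ((add_le_add h1 h2).trans ?_)
  have : 0 ≤ (p.top : ℝ) / p.k := by positivity
  have e1 : (p.top + 1) * (3 * (1 / p.k)) = 3 * ((p.top : ℝ) / p.k) + 3 * (1 / p.k) := by ring
  have e2 : ((p.top : ℝ) + 1) / p.k = (p.top : ℝ) / p.k + 1 / p.k := by ring
  rw [e1, e2]
  linarith

variable {G : SimpleGraph V}

theorem keptCount_le (s : Seed V) :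
    (keptCount p s G : ℝ) ≤ ∑ e ∈ edges G, Set.indicator {s | e ∈ keep p s} (fun _ => 1) s := by
  have h : edges (sampled p s G) ⊆ (edges G).filter fun e => e ∈ keep p s := by
    intro e he
    have he' : e ∈ (sampled p s G).edgeSet := by simpa [edges] using he
    rw [sampled, SimpleGraph.edgeSet_fromEdgeSet] at he'
    simpa [edges] using he'.1
  refine (Nat.cast_le.mpr (Finset.card_le_card h)).trans (le_of_eq ?_)
  rw [Finset.card_filter]
  push_cast
  exact Finset.sum_congr rfl fun e _ => by simp [Set.indicator_apply]

theorem bddMeas_keptCount (p : Params) (G : SimpleGraph V) :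
    BddMeas fun s : Seed V => (keptCount p s G : ℝ) :=
  bddMeas_of_sameBits (p := p) _ fun s s' h => by
    unfold keptCount sampled
    rw [h.keep_eq]

theorem integral_keptCount_le (hk : 1 ≤ p.k) (G : SimpleGraph V) :
    ∫ s, (keptCount p s G : ℝ) ∂cube (Idx V) ≤ (edges G).card * (24 * ((p.top + 1) / p.k)) := by
  have hm : ∀ e : Sym2 V, MeasurableSet {s : Seed V | e ∈ keep p s} := fun e =>
    measurableSet_of_sameBits (p := p) _ fun s s' h => by rw [h.keep_eq]
  have hi : ∀ e : Sym2 V, BddMeas fun s : Seed V =>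
      Set.indicator {s | e ∈ keep p s} (fun _ => (1 : ℝ)) s := fun e => BddMeas.indicator (hm e) 1
  refine (integral_mono ((bddMeas_keptCount p G).integrable _)
    ((BddMeas.sum fun e _ => hi e).integrable _) fun s => keptCount_le s).trans ?_
  rw [integral_finsetSum _ fun e _ => (hi e).integrable _, ← nsmul_eq_mul]
  refine Finset.sum_le_card_nsmul _ _ _ fun e he => ?_
  rw [integral_indicator_const _ (hm e), smul_eq_mul, mul_one]
  induction e with | _ a b =>
  have hab : a ≠ b := by
    have : G.Adj a b := by simpa [edges] using he
    exact this.ne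
  refine (measureReal_mono (fun s hs => mem_keepDir_of_mem_keep hs) (measure_ne_top _ _)).trans ?_
  refine (measureReal_union_le _ _).trans ?_
  have h1 := measureReal_keepDir_le hk hab
  have h2 := measureReal_keepDir_le hk hab.symm
  linarith

theorem lintegral_totalKept_le (hk : 1 ≤ p.k) (G : SimpleGraph V) (n b : ℕ) :
    ∫⁻ s, (totalKept p s G : ℝ≥0∞) ∂seedMeasure V n b ≤
      ENNReal.ofReal (n * b * ((edges G).card * (24 * ((p.top + 1) / p.k)))) := by
  have hf := bddMeas_keptCount p G
  have hg : BddMeas fun s : Fin b → Seed V => ∑ j, (keptCount p (s j) G : ℝ) :=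
    BddMeas.sum fun j _ => hf.comp (measurable_pi_apply j)
  have hh : BddMeas fun s : Seeds V n b => ∑ i, ∑ j, (keptCount p (s i j) G : ℝ) :=
    BddMeas.sum fun i _ => hg.comp (measurable_pi_apply i)
  have hmeas : seedMeasure V n b = Measure.pi fun _ => Measure.pi fun _ => cube (Idx V) := rfl
  have hcast : ∀ s : Seeds V n b, (totalKept p s G : ℝ≥0∞) =
      ENNReal.ofReal (∑ i, ∑ j, (keptCount p (s i j) G : ℝ)) := by
    intro s
    rw [← ENNReal.ofReal_natCast, totalKept]
    push_cast
    rfl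
  simp only [hcast]
  rw [← ofReal_integral_eq_lintegral_ofReal (hh.integrable _)
    (ae_of_all _ fun s => Finset.sum_nonneg fun i _ => Finset.sum_nonneg fun j _ =>
      Nat.cast_nonneg _)]
  refine ENNReal.ofReal_le_ofReal ?_
  rw [hmeas, integral_finsetSum _ fun i _ => (hg.comp (measurable_pi_apply i)).integrable _]
  have h1 : ∀ i : Fin n, ∫ s : Seeds V n b, ∑ j, (keptCount p (s i j) G : ℝ)
      ∂(Measure.pi fun _ => Measure.pi fun _ => cube (Idx V)) =
        b * ∫ s, (keptCount p s G : ℝ) ∂cube (Idx V) := by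
    intro i
    rw [integral_pi_eval (Measure.pi fun _ => cube (Idx V)) hg i,
      integral_finsetSum _ fun j _ => (hf.comp (measurable_pi_apply j)).integrable _]
    rw [Finset.sum_congr rfl fun j _ => integral_pi_eval (cube (Idx V)) hf j]
    simp
  rw [Finset.sum_congr rfl fun i _ => h1 i]
  simp only [Finset.sum_const, Finset.card_univ, Fintype.card_fin, nsmul_eq_mul]
  rw [mul_assoc]
  gcongr
  exact integral_keptCount_le hk G

end Cost

/-! ### The number of kept edges in terms of the parameters -/

section CostParams

variable {Tt DV DE : ℝ}

/-- From `2^top ≤ √k` and `k^(3/2) ≤ Tt` one gets `3 top log 2 ≤ log Tt`, and `3 log 2 > 2` absorbs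
the extra one. -/
theorem params_top_mul_le (hTt : 1 ≤ Tt) (h : 0 < (params Tt DV DE).top) :
    ((params Tt DV DE).top : ℝ) + 1 ≤ Real.log Tt := by
  have hk := one_le_params_k (DV := DV) (DE := DE) hTt
  have hs := sqrt_params_k_pow (DV := DV) (DE := DE) hTt
  set p := params Tt DV DE
  have h1 := Params.omega_mul_lt_of_lt_top hk (Nat.sub_lt h one_pos)
  have h2 := Params.two_le_omega_of_top_pos hk h
  have h3 : (2 : ℝ) ^ p.top ≤ √p.k := by
    obtain ⟨t, ht⟩ := Nat.exists_eq_succ_of_ne_zero h.ne'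
    rw [ht, Nat.succ_sub_one] at h1
    rw [ht, pow_succ, mul_comm]
    exact (mul_le_mul_of_nonneg_right h2 (by positivity)).trans h1.le
  have h4 : ((2 : ℝ) ^ p.top) ^ 3 ≤ Tt := (pow_le_pow_left₀ (by positivity) h3 3).trans hs
  have h5 := Real.log_le_log (by positivity) h4
  rw [Real.log_pow, Real.log_pow] at h5
  have h6 : (1 : ℝ) ≤ p.top := by exact_mod_cast h
  have h7 := Real.log_two_gt_d9
  push_cast at h5
  nlinarith

/-- If `Tt^(-2/3)` alone determined `1/k`, then `k^(3/2) = Tt` and `DV ≤ k`. Hence `Tt / max 1 DV ≥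
√k`, which forces `ω = √k` and leaves a single level. -/
theorem params_inv_k_le_of_top_pos (hTt : 1 ≤ Tt) (hDE : 0 ≤ DE)
    (h : 0 < (params Tt DV DE).top) :
    1 / (params Tt DV DE).k ≤ √DV / Tt + DE / Tt := by
  have hk := one_le_params_k (DV := DV) (DE := DE) hTt
  have h0 : 0 < Tt := by linarith
  have h1 := Params.omega_mul_lt_of_lt_top hk h
  rw [pow_zero, mul_one] at h1
  have hω := Params.one_le_omega hk
  have hk1 : 1 < (params Tt DV DE).k := by
    have := hω.trans_lt h1
    rwa [Real.lt_sqrt zero_le_one, one_pow] at this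
  have hinv := params_inv_k hk1
  have hv : 0 ≤ √DV / Tt := by positivity
  have he : 0 ≤ DE / Tt := by positivity
  by_contra! hlt
  have ha : 1 / (params Tt DV DE).k = 1 / Tt ^ (2 / 3 : ℝ) := by
    rw [hinv] at hlt ⊢
    refine max_eq_left (le_of_not_gt fun hc => ?_)
    rw [max_eq_right hc.le] at hlt
    rcases max_choice (√DV / Tt) (DE / Tt) with hm | hm <;> rw [hm] at hlt <;> linarith
  have hTk : √(params Tt DV DE).k ^ 3 = Tt := by
    have hkT : (params Tt DV DE).k = Tt ^ (2 / 3 : ℝ) := by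
      rwa [one_div, one_div, inv_inj] at ha
    rw [hkT, Real.sqrt_eq_rpow, ← Real.rpow_natCast, ← Real.rpow_mul h0.le, ← Real.rpow_mul h0.le]
    norm_num
  have hvk : √DV / Tt < 1 / (params Tt DV DE).k := by linarith
  rw [div_lt_div_iff₀ h0 (by linarith), one_mul] at hvk
  rw [params_omega hTt] at h1
  refine h1.not_ge (le_min ((le_max_right _ _).trans' ?_) le_rfl)
  set k := (params Tt DV DE).k
  have hs : 0 < √k := Real.sqrt_pos.mpr (by linarith)
  have hss : √k * √k = k := Real.mul_self_sqrt (by linarith)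
  have hTk' : √k * k = Tt := by rw [← hTk, pow_succ, pow_two, hss, mul_comm]
  have hDVk : DV ≤ k := by
    refine (Real.sqrt_le_sqrt_iff (by linarith)).mp (le_of_mul_le_mul_right ?_ (mul_pos hs hs))
    rw [hss]
    calc √DV * k ≤ Tt := hvk.le
      _ = √k * k := hTk'.symm
  rw [le_div_iff₀ (lt_max_of_lt_left one_pos)]
  calc √k * max 1 DV ≤ √k * k := mul_le_mul_of_nonneg_left (max_le hk1.le hDVk) hs.le
    _ = Tt := hTk'

theorem params_cost_le (hTt : 1 ≤ Tt) (hDE : 0 ≤ DE) :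
    ((params Tt DV DE).top + 1) / (params Tt DV DE).k ≤
      2 * (1 / Tt ^ (2 / 3 : ℝ) + √DV * Real.log Tt / Tt + DE * Real.log Tt / Tt) := by
  have hk := one_le_params_k (DV := DV) (DE := DE) hTt
  have h0 : 0 < Tt := by linarith
  have hl := Real.log_nonneg hTt
  have ha : 0 < 1 / Tt ^ (2 / 3 : ℝ) := one_div_pos.mpr (Real.rpow_pos_of_pos h0 _)
  have hv : 0 ≤ √DV / Tt := by positivity
  have he : 0 ≤ DE / Tt := by positivity
  have e1 : √DV * Real.log Tt / Tt = √DV / Tt * Real.log Tt := by ring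
  have e2 : DE * Real.log Tt / Tt = DE / Tt * Real.log Tt := by ring
  rw [e1, e2]
  have hvl := mul_nonneg hv hl
  have hel := mul_nonneg he hl
  rcases Nat.eq_zero_or_pos (params Tt DV DE).top with h | h
  · have hkinv : 1 / (params Tt DV DE).k =
        min 1 (max (1 / Tt ^ (2 / 3 : ℝ)) (max (√DV / Tt) (DE / Tt))) := by
      rw [one_div]; exact inv_inv _
    rw [h, Nat.cast_zero, zero_add, hkinv]
    -- With one level the only obstacle is that `log Tt` may be small. For `Tt < 2` the clipping
    -- `1/k ≤ 1` is paid by `Tt^(-2/3) ≥ 1/2`; otherwise `log Tt ≥ 1/2`.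
    rcases lt_or_ge Tt 2 with h2 | h2
    · refine (min_le_left _ _).trans ?_
      have : Tt ^ (2 / 3 : ℝ) ≤ 2 :=
        (Real.rpow_le_self_of_one_le hTt (by norm_num)).trans h2.le
      have : 1 / 2 ≤ 1 / Tt ^ (2 / 3 : ℝ) :=
        one_div_le_one_div_of_le (Real.rpow_pos_of_pos h0 _) this
      linarith
    · have hl2 : 1 / 2 ≤ Real.log Tt := by
        have := Real.log_le_log two_pos h2
        have := Real.log_two_gt_d9
        linarith
      have h3 := mul_le_mul_of_nonneg_left hl2 hv
      have h4 := mul_le_mul_of_nonneg_left hl2 he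
      refine (min_le_right _ _).trans (max_le ?_ (max_le ?_ ?_)) <;> linarith
  · have h1 := params_top_mul_le hTt h
    have h2 := params_inv_k_le_of_top_pos hTt hDE h
    have h3 : 0 ≤ 1 / (params Tt DV DE).k := by positivity
    calc ((params Tt DV DE).top + 1) / (params Tt DV DE).k
        = ((params Tt DV DE).top + 1) * (1 / (params Tt DV DE).k) := by ring
      _ ≤ Real.log Tt * (√DV / Tt + DE / Tt) := mul_le_mul h1 h2 h3 hl
      _ ≤ _ := by linarith

theorem numBlocks_le {δ : ℝ} (hδ : 0 < δ) (hδ2 : δ ≤ 1 / 2) :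
    (numBlocks 8 δ : ℝ) ≤ 10 * Real.log (1 / δ) := by
  have h1 : Real.log 2 ≤ Real.log (1 / δ) :=
    Real.log_le_log two_pos ((le_div_iff₀ hδ).mpr (by linarith))
  have h2 := Real.log_two_gt_d9
  have h3 := Nat.ceil_lt_add_one (show 0 ≤ 8 * Real.log (1 / δ) by linarith)
  refine h3.le.trans ?_
  linarith

theorem blockSize_le {A ε : ℝ} (hA : 0 ≤ A) (hε : 0 < ε) (hε1 : ε ≤ 1) :
    (blockSize A ε : ℝ) ≤ (A + 1) / ε ^ 2 := by
  have h3 := Nat.ceil_lt_add_one (show 0 ≤ A / ε ^ 2 by positivity)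
  have h1 : 1 ≤ 1 / ε ^ 2 := (one_le_div (by positivity)).mpr (pow_le_one₀ hε.le hε1)
  refine h3.le.trans ?_
  rw [add_div]
  linarith

/-- The expected number of kept edges. -/
theorem lintegral_totalKept_params_le {V : Type*} [Fintype V] (G : SimpleGraph V) {ε δ c dV dE : ℝ}
    (hTt : 1 ≤ Tt) (hε : 0 < ε) (hε1 : ε ≤ 1) (hδ : 0 < δ) (hδ2 : δ ≤ 1 / 2) (hc : 1 ≤ c)
    (hDE : 0 ≤ DE) (hdV : DV ≤ c * dV) (hdE : DE ≤ c * dE) :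
    ∫⁻ s, (totalKept (params Tt DV DE) s G : ℝ≥0∞)
        ∂seedMeasure V (numBlocks 8 δ) (blockSize (10 ^ 8) ε) ≤
      ENNReal.ofReal ((480 * (10 ^ 8 + 1) * c) * ((edges G).card * Real.log (1 / δ) / ε ^ 2 *
        (1 / Tt ^ (2 / 3 : ℝ) + √dV * Real.log Tt / Tt + dE * Real.log Tt / Tt))) := by
  have hk := one_le_params_k (DV := DV) (DE := DE) hTt
  have h0 : 0 < Tt := by linarith
  have hl := Real.log_nonneg hTt
  refine (lintegral_totalKept_le hk G _ _).trans (ENNReal.ofReal_le_ofReal ?_)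
  have hn := numBlocks_le hδ hδ2
  have hb := blockSize_le (A := 10 ^ 8) (by norm_num) hε hε1
  have hcost := params_cost_le (DV := DV) hTt hDE
  have ha : 0 < 1 / Tt ^ (2 / 3 : ℝ) := one_div_pos.mpr (Real.rpow_pos_of_pos h0 _)
  have hsq : √DV ≤ c * √dV := by
    refine (Real.sqrt_le_sqrt hdV).trans ?_
    rw [Real.sqrt_mul (by linarith)]
    exact mul_le_mul_of_nonneg_right (Real.sqrt_le_iff.mpr ⟨by linarith, by nlinarith⟩) (Real.sqrt_nonneg _)
  have hX : 1 / Tt ^ (2 / 3 : ℝ) + √DV * Real.log Tt / Tt + DE * Real.log Tt / Tt ≤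
      c * (1 / Tt ^ (2 / 3 : ℝ) + √dV * Real.log Tt / Tt + dE * Real.log Tt / Tt) := by
    have h1 : √DV * Real.log Tt / Tt ≤ c * √dV * Real.log Tt / Tt := by gcongr
    have h2 : DE * Real.log Tt / Tt ≤ c * dE * Real.log Tt / Tt := by gcongr
    have h3 := mul_le_mul_of_nonneg_right hc ha.le
    calc _ ≤ c * (1 / Tt ^ (2 / 3 : ℝ)) + c * √dV * Real.log Tt / Tt
          + c * dE * Real.log Tt / Tt := by linarith
      _ = _ := by ring
  have hlog : 0 ≤ Real.log (1 / δ) :=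
    Real.log_nonneg ((le_div_iff₀ hδ).mpr (by linarith))
  calc (numBlocks 8 δ : ℝ) * blockSize (10 ^ 8) ε * ((edges G).card *
        (24 * (((params Tt DV DE).top + 1) / (params Tt DV DE).k)))
      ≤ 10 * Real.log (1 / δ) * ((10 ^ 8 + 1) / ε ^ 2) * ((edges G).card * (24 * (2 * (c *
        (1 / Tt ^ (2 / 3 : ℝ) + √dV * Real.log Tt / Tt + dE * Real.log Tt / Tt))))) := by
        have : 0 ≤ ((params Tt DV DE).top + 1) / (params Tt DV DE).k := by positivity
        gcongr
        linarith
    _ = _ := by ring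

end CostParams

end TriangleEstimation

theorem mainTheorem4 :
    ∃ A B : ℝ, 0 < A ∧ 0 < B ∧ ∀ c : ℝ, 1 ≤ c → ∃ C : ℝ, 0 < C ∧
      ∀ (V : Type*) [Fintype V] (G : SimpleGraph V) (Tt ε δ DV DE : ℝ),
        1 ≤ Tt → 0 < ε → ε ≤ 1 → 0 < δ → δ ≤ 1 / 2 →
        (DeltaV G (ε / 24) : ℝ) ≤ DV → DV ≤ c * DeltaV G (ε / 24) →
        (DeltaE G (ε / 24) : ℝ) ≤ DE → DE ≤ c * DeltaE G (ε / 24) →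
        (Tt ≤ numTri G →
          ENNReal.ofReal (1 - δ) ≤
            seedMeasure V (numBlocks B δ) (blockSize A ε)
              {s | IsApprox G ε (answer (params Tt DV DE) s G)}) ∧
        ((numTri G : ℝ) < Tt →
          ENNReal.ofReal (1 - δ) ≤
            seedMeasure V (numBlocks B δ) (blockSize A ε)
              {s | answer (params Tt DV DE) s G = none ∨
                IsApprox G ε (answer (params Tt DV DE) s G)}) ∧
        ∫⁻ s, (totalKept (params Tt DV DE) s G : ℝ≥0∞)
            ∂(seedMeasure V (numBlocks B δ) (blockSize A ε)) ≤
          ENNReal.ofReal (C * ((edges G).card * Real.log (1 / δ) / ε ^ 2 *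
            (1 / Tt ^ (2 / 3 : ℝ)
              + √(DeltaV G (ε / 24) : ℝ) * Real.log Tt / Tt
              + DeltaE G (ε / 24) * Real.log Tt / Tt))) := by
  refine ⟨10 ^ 8, 8, by norm_num, by norm_num, fun c hc =>
    ⟨480 * (10 ^ 8 + 1) * c, by positivity, ?_⟩⟩
  intro V _ G Tt ε δ DV DE hTt hε hε1 hδ hδ2 hDV hDV' hDE hDE'
  exact ⟨fun hT => seedMeasure_isApprox G hTt hε hε1 hδ hδ2 hDV hDE hT,
    fun _ => seedMeasure_none_or_isApprox G hTt hε hε1 hδ hδ2 hDV hDE,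
    lintegral_totalKept_params_le G hTt hε hε1 hδ hδ2 hc
      ((Nat.cast_nonneg _).trans hDE) hDV' hDE'⟩
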